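/- **Setting.** Let $d\ge 2$, $p\in[1,2]$, $1/p+1/q=1$, $\kappa\in(0,1]$, $s=\frac{1+\kappa}{\kappa}$, $r\ge s$. Let $\mathcal X\subset\mathbb R^d$ be compact and convex, $\mathcal X_\tau=\mathcal X+\tau B_2^d$, and let $f(x)=\mathbb E_{\xi}f(x,\xi)$ be finite on $\mathcal X$. For some $t>0$ and all $\xi$, let $f(\cdot,\xi)$ be convex and $M_2(\xi)$-Lipschitz in $\|\cdot\|_2$ on $\mathcal X_t$, with $\mathbb E[M_2(\xi)^{1+\kappa}]\le M_2^{1+\kappa}$, $M_2>0$. Let $x^*$ minimize $f$ on $\mathcal X$ and let $\frac{\mu_r}{2}\|x-x^*\|_p^r\le f(x)-f(x^*)$ for all $x\in\mathcal X$, with $\mu_r>0$. **Prox-function.** Write $D_\Psi(y,x)=\Psi(y)-\Psi(x)-\langle\nabla\Psi(x),y-x\rangle$. Let $\Psi:\mathbb R^d\to\mathbb R$ be a differentiable convex function that is $(1,s)$-uniformly convex, $D_\Psi(y,x)\ge\frac1s\|x-y\|_p^s$ for all $x,y$; let $x_0\in\arg\min_{\mathcal X}\Psi$, and let $L$ be a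 growth constant of $\Psi$ at $x_0$: $D_\Psi(x,x_0)\le\frac Ls\|x-x_0\|_p^s$ for all $x$. (For $1<p\le 2$ this holds for $\Psi(x)=K_q^{1/\kappa}\frac{\kappa}{1+\kappa}\|x-x_0\|_p^{s}$ with $K_q=10\max\{1,(q-1)^{(1+\kappa)/2}\}$ and $L=K_q^{1/\kappa}$; this is part of the statement.) Put $R_0=\sup_{x,y\in\mathcal X}(sD_\Psi(x,y))^{1/s}$, $R_k=R_0/2^k$. **Algorithm.** ZO-RSMD with prox-function $\Phi$, started at $z$, with $T$ steps, stepsize $\nu$, smoothing constant $\tau$ and oracle $\phi$: put $x_0:=z$; for $j=0,\dots,T-1$ draw $\xi_j$ and $\mathbf e_j$ uniform on the Euclidean unit sphere, all independent, and put $g_{j+1}=\frac{d}{2\tau}(\phi(x_j+\tau\mathbf e_j,\xi_j)-\phi(x_j-\tau\mathbf e_j,\xi_j))\mathbf e_j$, $y_{j+1}=\nabla\Phi^*(\nabla\Phi(x_j)-\nu g_{j+1})$, $x_{j+1}=\arg\min_{x\in\mathcal X}D_\Phi(x,y_{j+1})$, where $\Phi^*$ is the Fenchel conjugate; the output is $\frac1T\sum_{j<T}x_j$.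 ZO-Restarts starts from an arbitrary (possibly random, independent of the samples) point $z_0\in\mathcal X$; for $k=1,\dots,N$ it runs ZO-RSMD from $z_{k-1}$ with $T_k,\nu_k,\tau_k$, the prox-function $\Psi(\cdot-z_{k-1}+x_0)$ re-centred at $z_{k-1}$, and the oracle $\phi_k(x,\xi)=f(x,\xi)+\delta_k(x)$, and calls the output $z_k$; finally $x_{\rm final}=z_N$. The noise is deterministic with $|\delta_k|\le\Delta_k$ on $\mathcal X_{\tau_k}$. **Theorem.** There are constants $A,c,B>0$ and $m_1,m_2,m_3\ge0$ depending only on $\kappa$ and $r$ such that, in every such setting and for every $\varepsilon>0$ with $2\varepsilon<\mu_rR_0^r$, the following holds with $$N=\Big\lceil\tfrac1r\log_2\tfrac{\mu_rR_0^r}{2\varepsilon}\Big\rceil,\qquad \bar\Delta_k=\frac{c}{L^{m_2}}\cdot\frac{\mu_r^2R_0^{2r-1}}{M_2\sqrt d}\cdot\frac1{2^{k(2r-1)}},\qquad a_q=d^{\frac1q-\frac12}\min\{\sqrt{32\ln d-8},\sqrt{2q-1}\}.$$ 1. The admissible noise level of the last restart satisfies $$\frac{1}{BL^{m_3}}\cdot\frac{\mu_r^{1/r}\varepsilon^{2-1/r}}{M_2\sqrt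 d}\le\bar\Delta_N\le BL^{m_3}\cdot\frac{\mu_r^{1/r}\varepsilon^{2-1/r}}{M_2\sqrt d}.$$ 2. For all noise levels $0\le\Delta_k\le\bar\Delta_k$ there are $\sigma_k$, $T_k\in\mathbb N$, $\tau_k$, $\nu_k$ ($1\le k\le N$) with $$\sigma_k^{1+\kappa}=2^\kappa\Big(\tfrac{\sqrt d}{2^{1/4}}a_qM_2\Big)^{1+\kappa}+2^\kappa\Big(\tfrac{da_q\Delta_k}{\tau_k}\Big)^{1+\kappa},\qquad \tau_k=\frac{\sigma_kR_k}{M_2T_k^{\kappa/(1+\kappa)}},\qquad \nu_k=\frac{R_k^{1/\kappa}}{\sigma_k}T_k^{-\frac1{1+\kappa}},$$ $$AL^{m_1}\Big[\frac{\sigma_k2^{1+r}}{\mu_rR_k^{r-1}}\Big]^{\frac{1+\kappa}\kappa}\le T_k\le 2AL^{m_1}\Big[\frac{\sigma_k2^{1+r}}{\mu_rR_k^{r-1}}\Big]^{\frac{1+\kappa}\kappa}.$$ 3. For every such choice, the total number of steps satisfies $$\sum_{k=1}^NT_k\le BL^{m_3}\Big[\frac{a_qM_2\sqrt d}{\mu_r^{1/r}}\cdot\frac1{\varepsilon^{(r-1)/r}}\Big]^{\frac{1+\kappa}\kappa},$$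 and, if $\tau_k\le t$ for all $k\le N$, then $\mathbb E f(x_{\rm final})-f(x^*)\le\varepsilon$. (The factors $L^{m_i}$ are what $\widetilde O$ hides: they are polylogarithmic in $d$ whenever $L$ is.) -/

import Mathlib

open MeasureTheory ProbabilityTheory

namespace ZORestart

/-- The space `ℝ^d`, with its Euclidean inner product. -/
abbrev Vec (d : ℕ) : Type := EuclideanSpace ℝ (Fin d)

/-- The `ℓ_p`-norm on `ℝ^d`. -/
noncomputable def lpNorm {d : ℕ} (p : ENNReal) (x : Vec d) : ℝ :=
  ‖(WithLp.toLp p (WithLp.ofLp x) : PiLp p (fun _ : Fin d => ℝ))‖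

/-- The `τ`-neighbourhood `X_τ = X + τ B_2` of `X`. -/
def nbhd {d : ℕ} (X : Set (Vec d)) (τ : ℝ) : Set (Vec d) :=
  {z | ∃ x ∈ X, ∃ u : Vec d, ‖u‖ ≤ 1 ∧ z = x + τ • u}

/-- The uniform distribution on the Euclidean unit sphere of `ℝ^d`. -/
noncomputable def uniformSphere (d : ℕ) : Measure (Vec d) :=
  (((volume : Measure (Vec d)).toSphere Set.univ)⁻¹ •
    (volume : Measure (Vec d)).toSphere).map Subtype.val

/-- The exponent `(1 + κ) / κ`. -/
noncomputable def sExp (κ : ℝ) : ℝ := (1 + κ) / κ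

/-! ### Prox-functions -/

/-- Bregman divergence `D_Ψ(y, x) = Ψ(y) - Ψ(x) - ⟨∇Ψ(x), y - x⟩`. -/
noncomputable def bregman {d : ℕ} (Ψ : Vec d → ℝ) (y x : Vec d) : ℝ :=
  Ψ y - Ψ x - inner ℝ (gradient Ψ x) (y - x)

/-- `Ψ` is `(K, s)`-uniformly convex with respect to the `ℓ_p`-norm. -/
structure UniformlyConvex {d : ℕ} (p : ENNReal) (K s : ℝ) (Ψ : Vec d → ℝ) : Prop where
  differentiable : Differentiable ℝ Ψ
  convex : ConvexOn ℝ Set.univ Ψ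
  lower : ∀ x y, K / s * lpNorm p (x - y) ^ s ≤ bregman Ψ y x

/-- `Ψ` has growth constant `L` of order `s` at the point `x₀`:
`D_Ψ(x, x₀) ≤ (L / s) ‖x - x₀‖_p ^ s` for all `x`. -/
def HasProxGrowth {d : ℕ} (p : ENNReal) (s L : ℝ) (x₀ : Vec d) (Ψ : Vec d → ℝ) : Prop :=
  ∀ x, bregman Ψ x x₀ ≤ L / s * lpNorm p (x - x₀) ^ s

/-- `K_q = 10 max {1, (q - 1)^((1 + κ) / 2)}` (used for finite `q`). -/
noncomputable def Kq (κ : ℝ) (q : ENNReal) : ℝ :=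
  10 * max 1 ((q.toReal - 1) ^ ((1 + κ) / 2))

/-- The prox-function `K_q^(1/κ) φ_p(x - x₀)`, with `φ_p(x) = κ / (1 + κ) ‖x‖_p ^ ((1 + κ) / κ)`. -/
noncomputable def powerProx {d : ℕ} (κ : ℝ) (p q : ENNReal) (x₀ x : Vec d) : ℝ :=
  Kq κ q ^ (1 / κ) * (κ / (1 + κ) * lpNorm p (x - x₀) ^ sExp κ)

/-- The prox-function obtained from `Ψ`, centred at `x₀`, by moving its centre to `z`. -/
def recentre {d : ℕ} (Ψ : Vec d → ℝ) (x₀ z : Vec d) : Vec d → ℝ :=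
  fun x => Ψ (x - z + x₀)

/-- `R₀ = sup_{x, y ∈ X} ((1 + κ) / κ · D_Ψ(x, y)) ^ (κ / (1 + κ))`. -/
noncomputable def R0 {d : ℕ} (κ : ℝ) (X : Set (Vec d)) (Ψ : Vec d → ℝ) : ℝ :=
  sSup {ρ | ∃ x ∈ X, ∃ y ∈ X, ρ = (sExp κ * bregman Ψ x y) ^ (κ / (1 + κ))}

/-- Fenchel conjugate `Ψ*(y) = sup_x (⟨x, y⟩ - Ψ(x))`. -/
noncomputable def fenchel {d : ℕ} (Ψ : Vec d → ℝ) (y : Vec d) : ℝ :=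
  ⨆ x : Vec d, (inner ℝ x y - Ψ x)

/-- A minimizer of `D_Ψ(·, y)` over `X`. -/
noncomputable def bregmanProj {d : ℕ} (X : Set (Vec d)) (Ψ : Vec d → ℝ) (y : Vec d) : Vec d :=
  Classical.epsilon fun x => x ∈ X ∧ IsMinOn (fun z => bregman Ψ z y) X x

/-! ### The algorithms -/

/-- Two-point gradient estimate, `h` being the oracle `φ(·, ξ)` at the sampled `ξ`. -/
noncomputable def gradEst {d : ℕ} (h : Vec d → ℝ) (τ : ℝ) (x e : Vec d) : Vec d :=
  ((d : ℝ) / (2 * τ) * (h (x + τ • e) - h (x - τ • e))) • e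

/-- One mirror descent step. -/
noncomputable def mirrorStep {d : ℕ} (X : Set (Vec d)) (Ψ : Vec d → ℝ) (ν : ℝ)
    (x g : Vec d) : Vec d :=
  bregmanProj X Ψ (gradient (fenchel Ψ) (gradient Ψ x - ν • g))

/-- The iterates of ZO-RSMD started at `z`, with oracle `φ` and samples `ξ_j`, `e_j`. -/
noncomputable def rsmdIter {d : ℕ} {Ξ : Type*} (X : Set (Vec d)) (Ψ : Vec d → ℝ) (ν τ : ℝ)
    (φ : Vec d → Ξ → ℝ) (ξ : ℕ → Ξ) (e : ℕ → Vec d) (z : Vec d) : ℕ → Vec d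
  | 0 => z
  | j + 1 =>
      let x := rsmdIter X Ψ ν τ φ ξ e z j
      mirrorStep X Ψ ν x (gradEst (fun y => φ y (ξ j)) τ x (e j))

/-- The output of ZO-RSMD after `T` steps: the average of the iterates `0, …, T - 1`. -/
noncomputable def rsmdOutput {d : ℕ} {Ξ : Type*} (X : Set (Vec d)) (Ψ : Vec d → ℝ) (T : ℕ)
    (ν τ : ℝ) (φ : Vec d → Ξ → ℝ) (ξ : ℕ → Ξ) (e : ℕ → Vec d) (z : Vec d) : Vec d :=
  (1 / (T : ℝ)) • ∑ j ∈ Finset.range T, rsmdIter X Ψ ν τ φ ξ e z j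

/-- ZO-Restarts with ZO-RSMD: the point reached after the given number of restarts.  Restart `k`
(`k = 1, 2, …`) runs `T k` steps of ZO-RSMD from the output of the previous restart, with the
prox-function centred at that point, and queries `f(x, ξ) + δ_k(x)`. -/
noncomputable def restarts {d : ℕ} {Ξ : Type*} (X : Set (Vec d)) (Ψ : Vec d → ℝ) (x₀ : Vec d)
    (T : ℕ → ℕ) (ν τ : ℕ → ℝ) (f : Vec d → Ξ → ℝ) (δ : ℕ → Vec d → ℝ)
    (ξ : ℕ × ℕ → Ξ) (e : ℕ × ℕ → Vec d) (z : Vec d) : ℕ → Vec d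
  | 0 => z
  | k + 1 =>
      let w := restarts X Ψ x₀ T ν τ f δ ξ e z k
      rsmdOutput X (recentre Ψ x₀ w) (T (k + 1)) (ν (k + 1)) (τ (k + 1))
        (fun x s => f x s + δ (k + 1) x) (fun j => ξ (k + 1, j)) (fun j => e (k + 1, j)) w

/-! ### The parameters -/

/-- `a_q = d^(1/q - 1/2) min {√(32 ln d - 8), √(2q - 1)}`, where `√(2q - 1) = ∞` if `q = ∞`. -/
noncomputable def aq (d : ℕ) (q : ENNReal) : ℝ :=
  (d : ℝ) ^ ((1 / q).toReal - 1 / 2) *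
    (if q = ⊤ then √(32 * Real.log d - 8)
      else min √(32 * Real.log d - 8) √(2 * q.toReal - 1))

/-- `σ_q`, where `σ_q^(1+κ) = 2^κ (√d / 2^(1/4) a_q M₂)^(1+κ) + 2^κ (d a_q Δ / τ)^(1+κ)`. -/
noncomputable def sigmaq (d : ℕ) (q : ENNReal) (κ M₂ Δ τ : ℝ) : ℝ :=
  ((2 : ℝ) ^ κ * (√d / (2 : ℝ) ^ (1 / 4 : ℝ) * aq d q * M₂) ^ (1 + κ) +
    (2 : ℝ) ^ κ * (d * aq d q * Δ / τ) ^ (1 + κ)) ^ (1 / (1 + κ))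

/-- The number of restarts. -/
noncomputable def numRestarts (r μ ε R : ℝ) : ℕ :=
  ⌈1 / r * Real.logb 2 (μ * R ^ r / (2 * ε))⌉₊

/-- `μ² R₀^(2r - 1) / (M₂ √d) · 2^(-k (2r - 1))`, the order of the noise level of restart `k`. -/
noncomputable def noiseLevel (d : ℕ) (r μ M₂ R : ℝ) (k : ℕ) : ℝ :=
  μ ^ 2 * R ^ (2 * r - 1) / (M₂ * √d) * (1 / (2 : ℝ) ^ ((k : ℝ) * (2 * r - 1)))

/-- The parameters of restarts `1, …, N` are chosen by the rule of the theorem, with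
`R_k = R / 2^k` and with `A` the constant factor in the number of steps. -/
structure IsSchedule (d : ℕ) (q : ENNReal) (κ r μ M₂ R A : ℝ) (N : ℕ) (Δ σ : ℕ → ℝ)
    (T : ℕ → ℕ) (τ ν : ℕ → ℝ) : Prop where
  sigma_eq : ∀ k ∈ Finset.Icc 1 N, σ k = sigmaq d q κ M₂ (Δ k) (τ k)
  steps_ge : ∀ k ∈ Finset.Icc 1 N,
    A * (σ k * 2 ^ (1 + r) / (μ * (R / 2 ^ k) ^ (r - 1))) ^ ((1 + κ) / κ) ≤ T k
  steps_le : ∀ k ∈ Finset.Icc 1 N,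
    (T k : ℝ) ≤ 2 * (A * (σ k * 2 ^ (1 + r) / (μ * (R / 2 ^ k) ^ (r - 1))) ^ ((1 + κ) / κ))
  tau_eq : ∀ k ∈ Finset.Icc 1 N,
    τ k = σ k * (R / 2 ^ k) / (M₂ * (T k : ℝ) ^ (κ / (1 + κ)))
  nu_eq : ∀ k ∈ Finset.Icc 1 N,
    ν k = (R / 2 ^ k) ^ (1 / κ) / σ k * (T k : ℝ) ^ (-(1 / (1 + κ)))

/-! ### Assumptions on the objective -/

/-- The expected objective `f(x) = E_ξ f(x, ξ)`. -/
noncomputable def expObj {d : ℕ} {Ξ : Type*} [MeasurableSpace Ξ] (𝒟 : Measure Ξ)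
    (f : Vec d → Ξ → ℝ) (x : Vec d) : ℝ := ∫ s, f x s ∂𝒟

/-- The stochastic objective has finite expectations on `X`, and on `X_t` it is convex and
`M(ξ)`-Lipschitz in the Euclidean norm, with `E M(ξ)^(1+κ) ≤ M₂^(1+κ)`. -/
structure IsObjective {d : ℕ} {Ξ : Type*} [MeasurableSpace Ξ] (κ M₂ t : ℝ) (X : Set (Vec d))
    (𝒟 : Measure Ξ) (f : Vec d → Ξ → ℝ) : Prop where
  measurable : ∀ x ∈ nbhd X t, Measurable (f x)
  integrable : ∀ x ∈ X, Integrable (f x) 𝒟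
  convex : ∀ s, ConvexOn ℝ (nbhd X t) (fun x => f x s)
  lipschitz : ∃ M : Ξ → ℝ, (∀ s, 0 ≤ M s) ∧
    (∀ s, ∀ x ∈ nbhd X t, ∀ y ∈ nbhd X t, |f x s - f y s| ≤ M s * ‖x - y‖) ∧
    Integrable (fun s => M s ^ (1 + κ)) 𝒟 ∧ ∫ s, M s ^ (1 + κ) ∂𝒟 ≤ M₂ ^ (1 + κ)

/-- `x'` minimizes `F` over `X` and `F` satisfies the `r`-growth condition there. -/
structure HasGrowth {d : ℕ} (p : ENNReal) (r μ : ℝ) (X : Set (Vec d)) (F : Vec d → ℝ)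
    (x' : Vec d) : Prop where
  mem : x' ∈ X
  isMin : IsMinOn F X x'
  growth : ∀ x ∈ X, μ / 2 * lpNorm p (x - x') ^ r ≤ F x - F x'

/-- The samples `(ξ_i, e_i)` are independent, `ξ_i ∼ 𝒟` and `e_i` uniform on the sphere being
independent of each other, and the random starting point in `X` is independent of all of them. -/
structure IsSampling {d : ℕ} {Ξ Ω : Type*} [MeasurableSpace Ξ] [MeasurableSpace Ω]
    (X : Set (Vec d)) (𝒟 : Measure Ξ) (P : Measure Ω) (ξ : ℕ × ℕ → Ω → Ξ)
    (e : ℕ × ℕ → Ω → Vec d) (z : Ω → Vec d) : Prop where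
  measurable_xi : ∀ i, Measurable (ξ i)
  measurable_e : ∀ i, Measurable (e i)
  law : ∀ i, P.map (fun ω => (ξ i ω, e i ω)) = 𝒟.prod (uniformSphere d)
  indep : iIndepFun (fun i ω => (ξ i ω, e i ω)) P
  measurable_start : Measurable z
  start_mem : ∀ ω, z ω ∈ X
  indep_start : IndepFun z (fun ω i => (ξ i ω, e i ω)) P

end ZORestart

namespace ZORestart

/-! ### The uniform distribution on the sphere -/

section Sphere

variable {d : ℕ}

/-! Write `s = (1 + κ) / κ`, let `u` be the minimizer and `ρ = R_k`. A restart begins at a point `w`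
with `E ‖u - w‖_p^s ≤ 2 (2ρ)^s` and ends with expected gap at most `(μ/2) ρ^r`
(`integral_epoch_le`). Because `r ≥ s`, the growth condition converts this gap into `E ‖u - z‖_p^s ≤
2 ρ^s` (`HasGrowth.integral_lpNorm_rpow_le`), which is what the next restart, of radius `ρ/2`,
needs. After `N` restarts the gap is `(μ/2) R_N^r ≤ ε` by the choice of `N`.

Inside a restart the Bregman divergence obeys `D_{j+1} ≤ D_j - ν ⟨g, x_j - u⟩ + ν^(1+κ)
‖g‖_*^(1+κ)`, by optimality of the mirror step, uniform convexity and Young's inequality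
(`mirrorStep_inequality`). Two facts about the two-point estimate `g` then suffice.

Bias: `E ⟨g, x - u⟩ ≥ f(x) - f(u) - O(M₂ τ) - O(√d Δ / τ) ‖x - u‖`. Without noise, `d E[F(e) ⟨v,
e⟩]` is by the divergence theorem an average of directional derivatives over the ball, and convexity
bounds these from below. It is proved by integrating by parts against a radial cutoff whose
derivative lives in a thin shell (`sub_le_integral_mul_inner_uniformSphere`).

Moment: `E ‖g‖_*^(1+κ)` is of order `σ^(1+κ)`. The difference `F(e) - F(-e)` of a `K`-Lipschitz
function on the sphere is of order `K/√d` in `L⁴`, and the dual norm of `e` is of order `a_q` in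
`L⁴`; the two are multiplied with the arithmetic-geometric mean inequality. Both estimates come from
the Gaussian, whose norm and direction are independent and satisfy `E ‖x‖⁴ ≥ d²`. Concentration
follows from rotating one Gaussian vector into its negative through an independent copy.

The distance `‖x_j - u‖` in the bias is not bounded by a multiple of `ρ` beforehand. It is at most
`ρ` plus a multiple of `D_j`, so noise merely inflates the recursion by a factor `1 + a` with `a T ≤
1/2` (`sum_le_of_recursion`).

The parameters `σ, T, τ` are defined circularly. A solution exists by the intermediate value theorem
(`exists_schedule`), and every solution has `σ` comparable to its noiseless part, because the
admissible noise is quadratic in the smallest possible `M₂ τ` (`epochBounds_of_schedule`). The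
numbers of steps are then dominated by a geometric series whose last term is the claimed complexity.

Finally, the objective is extended by a nonexpansive retraction onto `X_t` and the noise is clipped.
Almost surely neither changes the iterates, since every query stays in the relevant neighbourhood of
`X`. -/

lemma nontrivial_vec (hd : 0 < d) : Nontrivial (Vec d) := by
  have : Nonempty (Fin d) := ⟨⟨0, hd⟩⟩
  infer_instance

lemma isProbabilityMeasure_uniformSphere (hd : 0 < d) :
    IsProbabilityMeasure (uniformSphere d) := by
  have := nontrivial_vec hd
  constructor
  rw [uniformSphere, Measure.map_apply measurable_subtype_coe MeasurableSet.univ]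
  simp only [Set.preimage_univ, Measure.smul_apply, smul_eq_mul]
  exact ENNReal.inv_mul_cancel
    (by rw [Ne, Measure.measure_univ_eq_zero]; exact Measure.toSphere_ne_zero _)
    (measure_ne_top _ _)

lemma ae_norm_eq_one_uniformSphere : ∀ᵐ e ∂(uniformSphere d), ‖e‖ = 1 := by
  rw [uniformSphere, ae_map_iff measurable_subtype_coe.aemeasurable
    (measurableSet_eq_fun measurable_norm measurable_const)]
  exact Filter.Eventually.of_forall fun x => by simp

lemma integral_uniformSphere (ψ : Vec d → ℝ) :
    ∫ e, ψ e ∂(uniformSphere d) =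
      ((volume : Measure (Vec d)).toSphere.real Set.univ)⁻¹ *
        ∫ e, ψ e ∂((volume : Measure (Vec d)).toSphere) := by
  have hme : MeasurableEmbedding (Subtype.val : Metric.sphere (0 : Vec d) 1 → Vec d) :=
    MeasurableEmbedding.subtype_coe Metric.isClosed_sphere.measurableSet
  rw [uniformSphere, hme.integral_map, integral_smul_measure]
  simp [Measure.real]

/-- Integration in polar coordinates of a function with separated variables. -/
lemma integral_norm_mul_direction (hd : 0 < d) (a : ℝ → ℝ) (ψ : Vec d → ℝ) :
    ∫ x : Vec d, a ‖x‖ * ψ (‖x‖⁻¹ • x) =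
      (∫ e, ψ e ∂(uniformSphere d)) * ∫ x : Vec d, a ‖x‖ := by
  have := nontrivial_vec hd
  have key : ∀ φ : Vec d → ℝ, ∫ x : Vec d, a ‖x‖ * φ (‖x‖⁻¹ • x) =
      (∫ e, φ e ∂((volume : Measure (Vec d)).toSphere)) *
        ∫ r : Set.Ioi (0 : ℝ), a r ∂(Measure.volumeIoiPow (Module.finrank ℝ (Vec d) - 1)) := by
    intro φ
    calc ∫ x : Vec d, a ‖x‖ * φ (‖x‖⁻¹ • x)
        = ∫ x : ({(0)}ᶜ : Set (Vec d)), a ‖x.1‖ * φ (‖x.1‖⁻¹ • x.1)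
            ∂((volume : Measure (Vec d)).comap (↑)) := by
          rw [integral_subtype_comap (measurableSet_singleton _).compl
            fun x : Vec d ↦ a ‖x‖ * φ (‖x‖⁻¹ • x), restrict_compl_singleton]
      _ = ∫ x, φ x.1 * a x.2 ∂(volume : Measure (Vec d)).toSphere.prod
            (.volumeIoiPow (Module.finrank ℝ (Vec d) - 1)) := by
          have := (volume : Measure (Vec d)).measurePreserving_homeomorphUnitSphereProd.integral_comp
            (Homeomorph.measurableEmbedding _)
            (fun x : Metric.sphere (0 : Vec d) 1 × Set.Ioi (0 : ℝ) => φ x.1 * a x.2)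
          simp only [homeomorphUnitSphereProd_apply_fst_coe,
            homeomorphUnitSphereProd_apply_snd_coe] at this
          rw [← this]
          exact integral_congr_ae (Filter.Eventually.of_forall fun x => by simp [mul_comm])
      _ = _ := integral_prod_mul (fun x : Metric.sphere (0 : Vec d) 1 => φ x)
            (fun r : Set.Ioi (0 : ℝ) => a r)
  -- The constant function identifies the radial integral up to the total mass of the sphere, which
  -- the normalization then cancels.
  have h1 := key fun _ => 1
  simp only [mul_one, integral_const, smul_eq_mul] at h1
  have hne : (volume : Measure (Vec d)).toSphere.real Set.univ ≠ 0 := by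
    rw [Measure.real, ENNReal.toReal_ne_zero]
    exact ⟨by rw [Ne, Measure.measure_univ_eq_zero]; exact Measure.toSphere_ne_zero _,
      measure_ne_top _ _⟩
  rw [key ψ, h1, integral_uniformSphere]
  field_simp

/-- The density of the standard Gaussian distribution. -/
noncomputable def gaussDensity (d : ℕ) (r : ℝ) : ℝ :=
  ((2 * Real.pi) ^ ((d : ℝ) / 2))⁻¹ * Real.exp (-(1 / 2) * r ^ 2)

lemma gaussDensity_pos (d : ℕ) (r : ℝ) : 0 < gaussDensity d r := by
  unfold gaussDensity; positivity

lemma continuous_gaussDensity (d : ℕ) : Continuous (gaussDensity d) := by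
  unfold gaussDensity; fun_prop

/-- Both measures have the same characteristic function, by the complex Gaussian integral.
Integrability of the density comes for free from its integral being `1`, since a non-integrable
function has integral `0`. -/
lemma stdGaussian_eq_withDensity (d : ℕ) :
    stdGaussian (Vec d) =
      (volume : Measure (Vec d)).withDensity fun x => ENNReal.ofReal (gaussDensity d ‖x‖) := by
  have hint : ∫ x : Vec d, gaussDensity d ‖x‖ = 1 := by
    unfold gaussDensity
    rw [integral_const_mul, GaussianFourier.integral_rexp_neg_mul_sq_norm (by norm_num)]
    simp only [finrank_euclideanSpace, Fintype.card_fin]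
    rw [show Real.pi / (1 / 2) = 2 * Real.pi by ring]
    exact inv_mul_cancel₀ (by positivity)
  have hI : Integrable fun x : Vec d => gaussDensity d ‖x‖ := by
    by_contra h
    rw [integral_undef h] at hint
    exact zero_ne_one hint
  have hfin : IsFiniteMeasure
      ((volume : Measure (Vec d)).withDensity fun x => ENNReal.ofReal (gaussDensity d ‖x‖)) :=
    isFiniteMeasure_withDensity_ofReal hI.2
  refine Measure.ext_of_charFun ?_
  ext t
  have hmeas : Measurable fun x : Vec d => gaussDensity d ‖x‖ :=
    (continuous_gaussDensity d).measurable.comp measurable_norm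
  rw [charFun_stdGaussian, charFun_apply,
    integral_withDensity_eq_integral_toReal_smul hmeas.ennreal_ofReal
      (Filter.Eventually.of_forall fun _ => ENNReal.ofReal_lt_top)]
  have h := GaussianFourier.integral_cexp_neg_mul_sq_norm_add (V := Vec d)
    (b := (1 / 2 : ℂ)) (by norm_num) Complex.I t
  simp only [finrank_euclideanSpace, Fintype.card_fin] at h
  have hc : ∀ x : Vec d, (ENNReal.ofReal (gaussDensity d ‖x‖)).toReal •
      Complex.exp ((inner ℝ x t : ℝ) * Complex.I) =
      ((((2 * Real.pi) ^ ((d : ℝ) / 2))⁻¹ : ℝ) : ℂ) *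
        Complex.exp (-(1 / 2 : ℂ) * ‖x‖ ^ 2 + Complex.I * (inner ℝ t x : ℝ)) := by
    intro x
    rw [ENNReal.toReal_ofReal (gaussDensity_pos d _).le, Complex.exp_add, gaussDensity,
      Complex.real_smul, real_inner_comm]
    push_cast
    ring_nf
  simp_rw [hc]
  rw [integral_const_mul, h, ← mul_assoc]
  have : ((((2 * Real.pi) ^ ((d : ℝ) / 2))⁻¹ : ℝ) : ℂ) *
      ((Real.pi : ℂ) / (1 / 2)) ^ ((d : ℂ) / 2) = 1 := by
    rw [show (Real.pi : ℂ) / (1 / 2) = ((2 * Real.pi : ℝ) : ℂ) by push_cast; ring,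
      show (d : ℂ) / 2 = ((d / 2 : ℝ) : ℂ) by push_cast; ring,
      ← Complex.ofReal_cpow (by positivity), ← Complex.ofReal_mul,
      inv_mul_cancel₀ (by positivity), Complex.ofReal_one]
  rw [this, one_mul]
  congr 1
  simp only [Complex.I_sq]
  ring

lemma integral_stdGaussian (g : Vec d → ℝ) :
    ∫ x, g x ∂(stdGaussian (Vec d)) = ∫ x, gaussDensity d ‖x‖ * g x := by
  have hmeas : Measurable fun x : Vec d => gaussDensity d ‖x‖ :=
    (continuous_gaussDensity d).measurable.comp measurable_norm
  rw [stdGaussian_eq_withDensity,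
    integral_withDensity_eq_integral_toReal_smul hmeas.ennreal_ofReal
      (Filter.Eventually.of_forall fun _ => ENNReal.ofReal_lt_top)]
  simp_rw [ENNReal.toReal_ofReal (gaussDensity_pos d _).le, smul_eq_mul]

/-- Norm and direction of a Gaussian vector are independent. -/
lemma integral_stdGaussian_mul_direction (hd : 0 < d) (a : ℝ → ℝ) (ψ : Vec d → ℝ) :
    ∫ x, a ‖x‖ * ψ (‖x‖⁻¹ • x) ∂(stdGaussian (Vec d)) =
      (∫ x : Vec d, a ‖x‖ ∂(stdGaussian (Vec d))) * ∫ e, ψ e ∂(uniformSphere d) := by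
  rw [integral_stdGaussian, integral_stdGaussian, mul_comm,
    ← integral_norm_mul_direction hd (fun r => gaussDensity d r * a r) ψ]
  simp_rw [mul_assoc]

lemma stdGaussian_absolutelyContinuous :
    stdGaussian (Vec d) ≪ (volume : Measure (Vec d)) := by
  rw [stdGaussian_eq_withDensity]
  exact withDensity_absolutelyContinuous _ _

end Sphere

end ZORestart

/-! ### Gaussian moments and their transfer to the sphere. -/

namespace ZORestart

section GaussianMoments

variable {d : ℕ}

lemma map_inner_stdGaussian {a : Vec d} (ha : ‖a‖ = 1) :
    (stdGaussian (Vec d)).map (fun x => inner ℝ a x) = gaussianReal 0 1 := by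
  have h := IsGaussian.map_eq_gaussianReal (μ := stdGaussian (Vec d)) (innerSL ℝ a)
  rw [integral_strongDual_stdGaussian, variance_dual_stdGaussian, innerSL_apply_norm, ha] at h
  simpa using h

/-- Raise `y ≤ exp y` with `y = x² / (2m)` to the power `m / 2`. A single exponential moment thus
controls all moments, with the growth `m^(m/2)` that later makes the `ℓ_m`-norm bounds linear in
`√m`. -/
lemma abs_rpow_le_exp {m : ℝ} (hm : 0 < m) (x : ℝ) :
    |x| ^ m ≤ (2 * m) ^ (m / 2) * Real.exp (x ^ 2 / 4) := by
  have h1 : x ^ 2 ≤ 2 * m * Real.exp (x ^ 2 / (2 * m)) := by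
    have := Real.add_one_le_exp (x ^ 2 / (2 * m))
    have h2 : x ^ 2 = 2 * m * (x ^ 2 / (2 * m)) := by field_simp
    nlinarith
  calc |x| ^ m = (x ^ 2) ^ (m / 2) := by
        rw [← sq_abs, ← Real.rpow_natCast, ← Real.rpow_mul (abs_nonneg x)]
        congr 1; push_cast; ring
    _ ≤ (2 * m * Real.exp (x ^ 2 / (2 * m))) ^ (m / 2) :=
        Real.rpow_le_rpow (sq_nonneg x) h1 (by positivity)
    _ = _ := by
        rw [Real.mul_rpow (by positivity) (by positivity), ← Real.exp_mul]
        congr 2; field_simp; ring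

lemma integrable_exp_sq_gaussianReal :
    Integrable (fun x : ℝ => Real.exp (x ^ 2 / 4)) (gaussianReal 0 1) ∧
      ∫ x, Real.exp (x ^ 2 / 4) ∂(gaussianReal 0 1) ≤ 2 := by
  have hI : ∫ x, Real.exp (x ^ 2 / 4) ∂(gaussianReal 0 1) = √2 := by
    rw [integral_gaussianReal_eq_integral_smul one_ne_zero]
    have : ∀ x : ℝ, gaussianPDFReal 0 1 x • Real.exp (x ^ 2 / 4) =
        (√(2 * Real.pi))⁻¹ * Real.exp (-(1 / 4) * x ^ 2) := by
      intro x
      rw [gaussianPDFReal, smul_eq_mul, mul_assoc, ← Real.exp_add]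
      simp only [NNReal.coe_one, mul_one, sub_zero]
      congr 2; ring
    simp_rw [this]
    rw [integral_const_mul, integral_gaussian, show Real.pi / (1 / 4) = 2 * (2 * Real.pi) by ring,
      Real.sqrt_mul zero_le_two (2 * Real.pi)]
    have : √(2 * Real.pi) ≠ 0 := by positivity
    rw [mul_comm √2, inv_mul_cancel_left₀ this]
  refine ⟨?_, ?_⟩
  · by_contra h
    rw [integral_undef h] at hI
    exact absurd hI.symm (by positivity)
  · rw [hI]
    exact Real.sqrt_le_iff.2 ⟨by norm_num, by norm_num⟩

lemma integrable_abs_rpow_gaussianReal {m : ℝ} (hm : 0 < m) :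
    Integrable (fun x : ℝ => |x| ^ m) (gaussianReal 0 1) := by
  refine (integrable_exp_sq_gaussianReal.1.const_mul ((2 * m) ^ (m / 2))).mono'
    (by fun_prop (disch := exact hm.le)) (Filter.Eventually.of_forall fun x => ?_)
  rw [Real.norm_of_nonneg (by positivity)]
  exact abs_rpow_le_exp hm x

lemma integral_abs_rpow_gaussianReal_le {m : ℝ} (hm : 0 < m) :
    ∫ x, |x| ^ m ∂(gaussianReal 0 1) ≤ 2 * (2 * m) ^ (m / 2) := by
  calc ∫ x, |x| ^ m ∂(gaussianReal 0 1)
      ≤ ∫ x, (2 * m) ^ (m / 2) * Real.exp (x ^ 2 / 4) ∂(gaussianReal 0 1) :=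
        integral_mono (integrable_abs_rpow_gaussianReal hm)
          (integrable_exp_sq_gaussianReal.1.const_mul _) fun x => abs_rpow_le_exp hm x
    _ ≤ _ := by
        rw [integral_const_mul, mul_comm]
        exact mul_le_mul_of_nonneg_right integrable_exp_sq_gaussianReal.2 (by positivity)

lemma integrable_abs_inner_rpow {a : Vec d} (ha : ‖a‖ = 1) {m : ℝ} (hm : 0 < m) :
    Integrable (fun x => |inner ℝ a x| ^ m) (stdGaussian (Vec d)) := by
  have h := integrable_abs_rpow_gaussianReal hm
  rw [← map_inner_stdGaussian ha] at h
  exact h.comp_measurable (by fun_prop)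

lemma integral_abs_inner_rpow_le {a : Vec d} (ha : ‖a‖ = 1) {m : ℝ} (hm : 0 < m) :
    ∫ x, |inner ℝ a x| ^ m ∂(stdGaussian (Vec d)) ≤ 2 * (2 * m) ^ (m / 2) := by
  have h := integral_abs_rpow_gaussianReal_le hm
  rw [← map_inner_stdGaussian ha, integral_map (by fun_prop) (by fun_prop (disch := exact hm.le))] at h
  exact h

lemma integrable_norm_pow_stdGaussian (k : ℕ) :
    Integrable (fun x : Vec d => ‖x‖ ^ k) (stdGaussian (Vec d)) := by
  have := (IsGaussian.memLp_id (stdGaussian (Vec d)) k (by simp)).integrable_norm_pow'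
  simpa using this

lemma integral_inner_sq_stdGaussian (a : Vec d) :
    ∫ x, (inner ℝ a x) ^ 2 ∂(stdGaussian (Vec d)) = ‖a‖ ^ 2 := by
  have h := variance_dual_stdGaussian (innerSL ℝ a)
  rw [variance_of_integral_eq_zero (by fun_prop) (integral_strongDual_stdGaussian _),
    innerSL_apply_norm] at h
  simpa using h

/-- The constant is `2 (2m)^(m/2)` at `m = 4`; the exact value `3` is not needed. -/
lemma integral_inner_pow_four_le (a : Vec d) :
    ∫ x, (inner ℝ a x) ^ 4 ∂(stdGaussian (Vec d)) ≤ 128 * ‖a‖ ^ 4 := by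
  rcases eq_or_ne a 0 with rfl | ha
  · simp
  have hn : ‖a‖ ≠ 0 := by simpa using ha
  have h := integral_abs_inner_rpow_le (a := ‖a‖⁻¹ • a) (by rw [norm_smul, norm_inv, norm_norm, inv_mul_cancel₀ hn])
    (m := 4) (by norm_num)
  have h2 : ∀ x : Vec d, |inner ℝ (‖a‖⁻¹ • a) x| ^ (4 : ℝ) = (‖a‖ ^ 4)⁻¹ * (inner ℝ a x) ^ 4 := by
    intro x
    rw [show (4 : ℝ) = (4 : ℕ) by norm_num, Real.rpow_natCast, real_inner_smul_left,
      Even.pow_abs (by decide)]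
    field_simp
  simp_rw [h2] at h
  rw [integral_const_mul, show (4 : ℝ) / 2 = (2 : ℕ) by norm_num, Real.rpow_natCast,
    inv_mul_le_iff₀ (by positivity)] at h
  linarith

lemma integral_norm_sq_stdGaussian :
    ∫ x : Vec d, ‖x‖ ^ 2 ∂(stdGaussian (Vec d)) = d := by
  have h : ∀ x : Vec d, ‖x‖ ^ 2 = ∑ i, (inner ℝ (EuclideanSpace.single i (1 : ℝ)) x) ^ 2 := by
    intro x
    rw [EuclideanSpace.real_norm_sq_eq]
    simp [EuclideanSpace.inner_single_left]
  simp_rw [h]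
  rw [integral_finsetSum]
  · simp_rw [integral_inner_sq_stdGaussian]
    simp
  · intro i _
    have := integrable_abs_inner_rpow (a := EuclideanSpace.single i (1 : ℝ)) (by simp)
      (m := 2) (by norm_num)
    simpa using this

/-- Jensen for the square of `‖x‖²`, whose mean is `d`, by means of the tangent line `2 d y - d² ≤
y²`. -/
lemma sq_le_integral_norm_pow_four :
    (d : ℝ) ^ 2 ≤ ∫ x : Vec d, ‖x‖ ^ 4 ∂(stdGaussian (Vec d)) := by
  have h : ∫ x : Vec d, (2 * d * ‖x‖ ^ 2 - d ^ 2) ∂(stdGaussian (Vec d)) ≤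
      ∫ x : Vec d, ‖x‖ ^ 4 ∂(stdGaussian (Vec d)) := by
    refine integral_mono (((integrable_norm_pow_stdGaussian 2).const_mul _).sub
      (integrable_const _)) (integrable_norm_pow_stdGaussian 4) fun x => ?_
    nlinarith [sq_nonneg (‖x‖ ^ 2 - d)]
  rw [integral_sub ((integrable_norm_pow_stdGaussian 2).const_mul _) (integrable_const _),
    integral_const_mul, integral_norm_sq_stdGaussian] at h
  simp at h
  nlinarith

/-- Integrals of homogeneous functions on the sphere and with respect to the Gaussian. -/
lemma integral_homogeneous_stdGaussian (hd : 0 < d) (k : ℕ) (hk : k ≠ 0) {ψ : Vec d → ℝ}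
    (h0 : ψ 0 = 0) (hψ : ∀ (c : ℝ) (x : Vec d), 0 < c → ψ (c • x) = c ^ k * ψ x) :
    ∫ x, ψ x ∂(stdGaussian (Vec d)) =
      (∫ x : Vec d, ‖x‖ ^ k ∂(stdGaussian (Vec d))) * ∫ e, ψ e ∂(uniformSphere d) := by
  rw [← integral_stdGaussian_mul_direction hd (fun r => r ^ k) ψ]
  refine integral_congr_ae (Filter.Eventually.of_forall fun x => ?_)
  rcases eq_or_ne x 0 with rfl | hx
  · simp [h0, hk]
  · have hn : 0 < ‖x‖ := norm_pos_iff.2 hx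
    simp only
    rw [← hψ _ _ hn, smul_smul, mul_inv_cancel₀ hn.ne', one_smul]

lemma integral_inner_sq_uniformSphere (hd : 0 < d) (v : Vec d) :
    ∫ e, (inner ℝ v e) ^ 2 ∂(uniformSphere d) = ‖v‖ ^ 2 / d := by
  have h := integral_homogeneous_stdGaussian hd 2 two_ne_zero (ψ := fun e => (inner ℝ v e) ^ 2)
    (by simp) (fun c x _ => by rw [real_inner_smul_right, mul_pow])
  rw [integral_inner_sq_stdGaussian, integral_norm_sq_stdGaussian] at h
  have : (d : ℝ) ≠ 0 := by positivity
  rw [h]; field_simp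

/-- The device for moving fourth moments to the sphere: a 4-homogeneous integrand factors into
`‖x‖⁴` times its value at the direction, and `E ‖x‖⁴ ≥ d²`. -/
lemma sq_mul_integral_uniformSphere_le (hd : 0 < d) {ψ : Vec d → ℝ}
    (h0 : ψ 0 = 0) (hψ : ∀ (c : ℝ) (x : Vec d), 0 < c → ψ (c • x) = c ^ 4 * ψ x)
    (hpos : ∀ x, 0 ≤ ψ x) :
    (d : ℝ) ^ 2 * ∫ e, ψ e ∂(uniformSphere d) ≤ ∫ x, ψ x ∂(stdGaussian (Vec d)) := by
  rw [integral_homogeneous_stdGaussian hd 4 (by norm_num) h0 hψ]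
  exact mul_le_mul_of_nonneg_right sq_le_integral_norm_pow_four (integral_nonneg hpos)

/-- `x^θ ≤ a^θ (1 + x / a)`, used in place of Jensen's inequality. -/
lemma rpow_le_rpow_mul_one_add {x a θ : ℝ} (hx : 0 ≤ x) (ha : 0 < a) (hθ : 0 ≤ θ) (hθ1 : θ ≤ 1) :
    x ^ θ ≤ a ^ θ * (1 + x / a) := by
  have h : x ^ θ = a ^ θ * (x / a) ^ θ := by
    rw [← Real.mul_rpow ha.le (by positivity)]; congr 1; field_simp
  rw [h]
  refine mul_le_mul_of_nonneg_left ?_ (by positivity)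
  have hy : 0 ≤ x / a := by positivity
  rcases le_total (x / a) 1 with h1 | h1
  · linarith [Real.rpow_le_one hy h1 hθ]
  · calc (x / a) ^ θ ≤ (x / a) ^ (1 : ℝ) := Real.rpow_le_rpow_of_exponent_le h1 hθ1
      _ ≤ _ := by rw [Real.rpow_one]; linarith

/-- The `ℓ_m`-norm for a real exponent `m`. -/
noncomputable def lmNorm (m : ℝ) (x : Vec d) : ℝ := (∑ i, |x i| ^ m) ^ (1 / m)

lemma lmNorm_nonneg (m : ℝ) (x : Vec d) : 0 ≤ lmNorm m x := by
  unfold lmNorm; positivity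

lemma lmNorm_smul {m : ℝ} (hm : 0 < m) (c : ℝ) (x : Vec d) :
    lmNorm m (c • x) = |c| * lmNorm m x := by
  unfold lmNorm
  simp only [PiLp.smul_apply, smul_eq_mul, abs_mul]
  simp_rw [Real.mul_rpow (abs_nonneg c) (abs_nonneg _)]
  rw [← Finset.mul_sum, Real.mul_rpow (by positivity) (by positivity),
    ← Real.rpow_mul (abs_nonneg c), mul_one_div_cancel hm.ne', Real.rpow_one]

lemma continuous_lmNorm {m : ℝ} (hm : 0 < m) : Continuous (lmNorm (d := d) m) := by
  unfold lmNorm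
  refine Continuous.rpow_const (continuous_finsetSum _ fun i _ => ?_) fun _ => Or.inr (by positivity)
  exact Continuous.rpow_const (by fun_prop) fun _ => Or.inr hm.le

/-- For the Gaussian, `∑ |x_i|^m` has mean at most `a = d · 2 (2m)^(m/2)`. As `4 / m ≤ 1`, the power
`4 / m` of the sum has mean of order `a^(4/m)`, that is `d^(4/m) (2m)²`. -/
lemma integral_lmNorm_pow_four_uniformSphere_le (hd : 0 < d) {m : ℝ} (hm : 4 ≤ m) :
    ∫ e, lmNorm m e ^ 4 ∂(uniformSphere d) ≤ 16 * m ^ 2 * (d : ℝ) ^ (4 / m) / d ^ 2 := by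
  have hm0 : 0 < m := by linarith
  have hd' : (0 : ℝ) < d := by exact_mod_cast hd
  have h := sq_mul_integral_uniformSphere_le hd (ψ := fun e => lmNorm m e ^ 4)
    (by simp [lmNorm, Real.zero_rpow hm0.ne', hm0.ne'])
    (fun c x hc => by rw [lmNorm_smul hm0, mul_pow, abs_of_pos hc])
    (fun x => by positivity)
  rw [le_div_iff₀ (by positivity), mul_comm]
  refine h.trans ?_
  set a : ℝ := d * (2 * (2 * m) ^ (m / 2)) with ha
  have hapos : 0 < a := by positivity
  have hcoord : ∀ i : Fin d, ∀ x : Vec d, |x i| ^ m =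
      |inner ℝ (EuclideanSpace.single i (1 : ℝ)) x| ^ m := by
    intro i x; simp [EuclideanSpace.inner_single_left]
  have hint : Integrable (fun x : Vec d => ∑ i, |x i| ^ m) (stdGaussian (Vec d)) := by
    refine integrable_finsetSum _ fun i _ => ?_
    simp_rw [hcoord i]
    exact integrable_abs_inner_rpow (by simp) hm0
  have hS : ∫ x : Vec d, ∑ i, |x i| ^ m ∂(stdGaussian (Vec d)) ≤ a := by
    rw [integral_finsetSum]
    · calc ∑ i, ∫ x : Vec d, |x i| ^ m ∂(stdGaussian (Vec d))
          ≤ ∑ i : Fin d, 2 * (2 * m) ^ (m / 2) := by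
            refine Finset.sum_le_sum fun i _ => ?_
            simp_rw [hcoord i]
            exact integral_abs_inner_rpow_le (by simp) hm0
        _ = a := by simp [ha]
    · intro i _
      simp_rw [hcoord i]
      exact integrable_abs_inner_rpow (by simp) hm0
  have hpt : ∀ x : Vec d, lmNorm m x ^ 4 ≤ a ^ (4 / m) * (1 + (∑ i, |x i| ^ m) / a) := by
    intro x
    have : lmNorm m x ^ 4 = (∑ i, |x i| ^ m) ^ (4 / m) := by
      rw [lmNorm, ← Real.rpow_natCast, ← Real.rpow_mul (by positivity)]
      congr 1; push_cast; ring
    rw [this]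
    exact rpow_le_rpow_mul_one_add (by positivity) hapos (by positivity)
      ((div_le_one hm0).2 hm)
  calc ∫ x, lmNorm m x ^ 4 ∂(stdGaussian (Vec d))
      ≤ ∫ x : Vec d, a ^ (4 / m) * (1 + (∑ i, |x i| ^ m) / a) ∂(stdGaussian (Vec d)) :=
        integral_mono_of_nonneg (Filter.Eventually.of_forall fun x => by positivity)
          (((integrable_const 1).add (hint.div_const a)).const_mul _)
          (Filter.Eventually.of_forall hpt)
    _ = a ^ (4 / m) * (1 + (∫ x : Vec d, ∑ i, |x i| ^ m ∂(stdGaussian (Vec d))) / a) := by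
        rw [integral_const_mul, integral_add (integrable_const 1) (hint.div_const a),
          integral_div]
        simp
    _ ≤ a ^ (4 / m) * 2 := by
        refine mul_le_mul_of_nonneg_left ?_ (by positivity)
        have := (div_le_one hapos).2 hS
        linarith
    _ = (d : ℝ) ^ (4 / m) * (2 : ℝ) ^ (4 / m) * (2 * m) ^ 2 * 2 := by
        rw [ha, Real.mul_rpow (by positivity) (by positivity),
          Real.mul_rpow (by positivity) (by positivity), ← Real.rpow_mul (by positivity),
          show m / 2 * (4 / m) = (2 : ℕ) by push_cast; field_simp; norm_num, Real.rpow_natCast]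
        ring
    _ ≤ (d : ℝ) ^ (4 / m) * 2 * (2 * m) ^ 2 * 2 := by
        gcongr
        calc (2 : ℝ) ^ (4 / m) ≤ 2 ^ (1 : ℝ) :=
              Real.rpow_le_rpow_of_exponent_le (by norm_num) ((div_le_one hm0).2 hm)
          _ = 2 := Real.rpow_one 2
    _ = 16 * m ^ 2 * (d : ℝ) ^ (4 / m) := by ring

end GaussianMoments

end ZORestart

/-! ### Concentration of Lipschitz functions on the sphere. -/

namespace ZORestart

section Concentration

variable {d : ℕ}

open scoped NNReal

/-- Jensen for the fourth power, through the tangent `h⁴ ≥ 4 a³ h - 3 a⁴` at the mean value `a`. -/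
lemma pow_four_integral_le {h : ℝ → ℝ} (hh : IntervalIntegrable h volume 0 Real.pi)
    (h4 : IntervalIntegrable (fun θ => h θ ^ 4) volume 0 Real.pi) :
    (∫ θ in (0 : ℝ)..Real.pi, h θ) ^ 4 ≤ Real.pi ^ 3 * ∫ θ in (0 : ℝ)..Real.pi, h θ ^ 4 := by
  have hpi := Real.pi_pos
  set I := ∫ θ in (0 : ℝ)..Real.pi, h θ with hI
  set a := I / Real.pi with ha
  have hmono : ∫ θ in (0 : ℝ)..Real.pi, (4 * a ^ 3 * h θ - 3 * a ^ 4) ≤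
      ∫ θ in (0 : ℝ)..Real.pi, h θ ^ 4 := by
    refine intervalIntegral.integral_mono_on hpi.le ((hh.const_mul _).sub (by simp)) h4 ?_
    intro θ _
    nlinarith [mul_nonneg (sq_nonneg (h θ - a)) (add_nonneg (sq_nonneg (h θ + a)) (sq_nonneg a)),
      sq_nonneg (h θ ^ 2 - a ^ 2), mul_nonneg (sq_nonneg a) (sq_nonneg (h θ - a))]
  rw [intervalIntegral.integral_sub (hh.const_mul _) (by simp), intervalIntegral.integral_const_mul,
    intervalIntegral.integral_const, ← hI, smul_eq_mul, sub_zero] at hmono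
  have hIa : I = a * Real.pi := by rw [ha]; field_simp
  calc I ^ 4 = Real.pi ^ 3 * (4 * a ^ 3 * I - Real.pi * (3 * a ^ 4)) := by rw [hIa]; ring
    _ ≤ _ := mul_le_mul_of_nonneg_left hmono (by positivity)

lemma map_rotation_stdGaussian (θ : ℝ) :
    ((stdGaussian (Vec d)).prod (stdGaussian (Vec d))).map (ContinuousLinearMap.rotation θ) =
      (stdGaussian (Vec d)).prod (stdGaussian (Vec d)) :=
  IsGaussian.map_rotation_eq_self_of_forall_strongDual_eq_zero
    (fun L => integral_strongDual_stdGaussian L) θ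

lemma measurable_fderiv_apply_pair (H : Vec d → ℝ) :
    Measurable fun p : Vec d × Vec d => fderiv ℝ H p.1 p.2 := by
  have h : ∀ p : Vec d × Vec d, fderiv ℝ H p.1 p.2 = inner ℝ (gradient H p.1) p.2 := by
    intro p; simp [gradient]
  simp_rw [h]
  have hg : Measurable (gradient H) :=
    (InnerProductSpace.toDual ℝ (Vec d)).symm.continuous.measurable.comp (measurable_fderiv ℝ H)
  fun_prop

lemma integrable_norm_add_norm_pow_four (K : ℝ) :
    Integrable (fun p : Vec d × Vec d => (K * (‖p.1‖ + ‖p.2‖)) ^ 4)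
      ((stdGaussian (Vec d)).prod (stdGaussian (Vec d))) := by
  have h1 := (integrable_norm_pow_stdGaussian (d := d) 4).comp_fst (stdGaussian (Vec d))
  have h2 := (integrable_norm_pow_stdGaussian (d := d) 4).comp_snd (stdGaussian (Vec d))
  refine ((h1.add h2).const_mul (8 * K ^ 4)).mono' (by fun_prop)
    (Filter.Eventually.of_forall fun p => ?_)
  rw [Real.norm_of_nonneg (by positivity)]
  simp only [Pi.add_apply]
  rw [mul_pow, mul_comm 8, mul_assoc]
  refine mul_le_mul_of_nonneg_left ?_ (by positivity)
  have := add_pow_le (norm_nonneg p.1) (norm_nonneg p.2) 4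
  norm_num at this
  exact this

lemma norm_rotation_path_sub_le (x y : Vec d) (θ θ' : ℝ) :
    ‖(Real.cos θ • x + Real.sin θ • y) - (Real.cos θ' • x + Real.sin θ' • y)‖ ≤
      (‖x‖ + ‖y‖) * |θ - θ'| := by
  have h : (Real.cos θ • x + Real.sin θ • y) - (Real.cos θ' • x + Real.sin θ' • y) =
      (Real.cos θ - Real.cos θ') • x + (Real.sin θ - Real.sin θ') • y := by
    module
  rw [h]
  refine (norm_add_le _ _).trans ?_
  rw [norm_smul, norm_smul, Real.norm_eq_abs, Real.norm_eq_abs]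
  have h1 : |Real.cos θ - Real.cos θ'| ≤ |θ - θ'| := by
    simpa [Real.dist_eq] using Real.lipschitzWith_cos.dist_le_mul θ θ'
  have h2 : |Real.sin θ - Real.sin θ'| ≤ |θ - θ'| := by
    simpa [Real.dist_eq] using Real.lipschitzWith_sin.dist_le_mul θ θ'
  nlinarith [mul_le_mul_of_nonneg_right h1 (norm_nonneg x),
    mul_le_mul_of_nonneg_right h2 (norm_nonneg y)]

/-- Dimension-free fourth moment bound for the odd part of a Lipschitz function of a Gaussian. -/
lemma integral_sub_neg_pow_four_stdGaussian_le {H : Vec d → ℝ} {K : ℝ≥0} (hH : LipschitzWith K H) :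
    ∫ x, (H x - H (-x)) ^ 4 ∂(stdGaussian (Vec d)) ≤ 128 * Real.pi ^ 4 * K ^ 4 := by
  set γ := stdGaussian (Vec d) with hγ
  -- The path rotates `x` through an independent copy `y`: it is at `x` for `θ = 0` and at `-x` for
  -- `θ = π`, so the integral of its derivative is `H (-x) - H x`.
  set f : Vec d × Vec d → ℝ → ℝ :=
    fun p θ => H (Real.cos θ • p.1 + Real.sin θ • p.2) with hf
  have hcont : Continuous f.uncurry := by
    simp only [hf, Function.uncurry_def]
    exact hH.continuous.comp (by fun_prop)
  set h : Vec d × Vec d → ℝ → ℝ := fun p θ => deriv (f p) θ with hh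
  have hmeas : Measurable fun q : (Vec d × Vec d) × ℝ => h q.1 q.2 :=
    measurable_deriv_with_param hcont
  have hlip : ∀ p, LipschitzWith (K * (‖p.1‖₊ + ‖p.2‖₊)) (f p) := by
    intro p
    refine LipschitzWith.of_dist_le_mul fun θ θ' => ?_
    refine (hH.dist_le_mul _ _).trans ?_
    rw [NNReal.coe_mul, mul_assoc]
    refine mul_le_mul_of_nonneg_left ?_ K.2
    rw [NNReal.coe_add, coe_nnnorm, coe_nnnorm, dist_eq_norm, Real.dist_eq]
    exact norm_rotation_path_sub_le _ _ _ _
  have hbd : ∀ p θ, |h p θ| ≤ K * (‖p.1‖ + ‖p.2‖) := fun p θ =>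
    (norm_deriv_le_of_lipschitz (hlip p)).trans_eq (by simp)
  have hbd4 : ∀ p θ, h p θ ^ 4 ≤ (K * (‖p.1‖ + ‖p.2‖)) ^ 4 := by
    intro p θ
    rw [← Even.pow_abs (by decide) (h p θ)]
    exact pow_le_pow_left₀ (abs_nonneg _) (hbd p θ) 4
  have hii : ∀ p, ∀ k : ℕ, IntervalIntegrable (fun θ => h p θ ^ k) volume 0 Real.pi := by
    intro p k
    refine (intervalIntegrable_const (c := (K * (‖p.1‖ + ‖p.2‖)) ^ k)).mono_fun'
      ((hmeas.comp (measurable_const.prodMk measurable_id)).pow_const k).aestronglyMeasurable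
      (Filter.Eventually.of_forall fun θ => ?_)
    simp only [norm_pow]
    exact pow_le_pow_left₀ (abs_nonneg _) (hbd p θ) k
  have hFTC : ∀ p : Vec d × Vec d, (H p.1 - H (-p.1)) ^ 4 ≤
      Real.pi ^ 3 * ∫ θ in (0 : ℝ)..Real.pi, h p θ ^ 4 := by
    intro p
    have h1 := ((hlip p).lipschitzOnWith
      (s := Set.uIcc 0 Real.pi)).absolutelyContinuousOnInterval.integral_deriv_eq_sub
    have h2 := pow_four_integral_le (by simpa using hii p 1) (hii p 4)
    rw [show (∫ θ in (0 : ℝ)..Real.pi, h p θ) = f p Real.pi - f p 0 from h1] at h2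
    refine le_trans (le_of_eq ?_) h2
    simp only [hf, Real.cos_pi, Real.sin_pi, Real.cos_zero, Real.sin_zero, zero_smul, add_zero,
      one_smul, neg_smul]
    ring
  set ν := (volume : Measure ℝ).restrict (Set.Ioc 0 Real.pi) with hν
  have hint4 : Integrable (fun q : (Vec d × Vec d) × ℝ => h q.1 q.2 ^ 4) ((γ.prod γ).prod ν) := by
    refine ((integrable_norm_add_norm_pow_four (d := d) K).comp_fst ν).mono'
      (hmeas.pow_const 4).aestronglyMeasurable (Filter.Eventually.of_forall fun q => ?_)
    rw [Real.norm_of_nonneg (by positivity)]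
    exact hbd4 q.1 q.2
  -- At a fixed angle, position and velocity of the path form a rotated pair, hence again two
  -- independent Gaussians. The derivative therefore has the law of `fderiv ℝ H x y`, which for
  -- fixed `x` is a centred Gaussian in `y` of standard deviation at most `K`. Rademacher's theorem
  -- provides differentiability almost everywhere.
  have hslice : ∀ θ, ∫ p, h p θ ^ 4 ∂(γ.prod γ) ≤ 128 * K ^ 4 := by
    intro θ
    have hmr : Measurable (ContinuousLinearMap.rotation (E := Vec d) θ) := by fun_prop
    have hGm : Measurable fun p : Vec d × Vec d => (fderiv ℝ H p.1 p.2) ^ 4 :=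
      (measurable_fderiv_apply_pair H).pow_const 4
    have hae : ∀ᵐ p ∂(γ.prod γ), DifferentiableAt ℝ H p.1 := by
      have h0 : ∀ᵐ x ∂γ, DifferentiableAt ℝ H x :=
        stdGaussian_absolutelyContinuous.ae_le hH.ae_differentiableAt
      exact Measure.quasiMeasurePreserving_fst.ae h0
    have hae' : ∀ᵐ p ∂(γ.prod γ),
        DifferentiableAt ℝ H (ContinuousLinearMap.rotation (E := Vec d) θ p).1 := by
      rw [hγ, ← map_rotation_stdGaussian θ] at hae
      exact ae_of_ae_map hmr.aemeasurable hae
    have heq : ∫ p, h p θ ^ 4 ∂(γ.prod γ) = ∫ p, (fderiv ℝ H p.1 p.2) ^ 4 ∂(γ.prod γ) := by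
      have hrot : ∫ p, (fderiv ℝ H p.1 p.2) ^ 4 ∂(γ.prod γ) = ∫ p,
          (fderiv ℝ H (ContinuousLinearMap.rotation (E := Vec d) θ p).1
            (ContinuousLinearMap.rotation (E := Vec d) θ p).2) ^ 4 ∂(γ.prod γ) := by
        conv_lhs => rw [hγ, ← map_rotation_stdGaussian θ]
        exact integral_map hmr.aemeasurable hGm.aestronglyMeasurable
      rw [hrot]
      refine integral_congr_ae ?_
      filter_upwards [hae'] with p hp
      have hpath : HasDerivAt (fun θ : ℝ => Real.cos θ • p.1 + Real.sin θ • p.2)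
          (-Real.sin θ • p.1 + Real.cos θ • p.2) θ :=
        ((Real.hasDerivAt_cos θ).smul_const p.1).add ((Real.hasDerivAt_sin θ).smul_const p.2)
      have := (hp.hasFDerivAt.comp_hasDerivAt θ hpath).deriv
      simp only [ContinuousLinearMap.rotation_apply] at this ⊢
      rw [← this]
      rfl
    rw [heq]
    have hbdG : ∀ p : Vec d × Vec d, (fderiv ℝ H p.1 p.2) ^ 4 ≤ (K * (‖p.1‖ + ‖p.2‖)) ^ 4 := by
      intro p
      rw [← Even.pow_abs (by decide) (fderiv ℝ H p.1 p.2)]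
      refine pow_le_pow_left₀ (abs_nonneg _) ?_ 4
      calc |fderiv ℝ H p.1 p.2| ≤ ‖fderiv ℝ H p.1‖ * ‖p.2‖ :=
            (Real.norm_eq_abs _).symm.trans_le (ContinuousLinearMap.le_opNorm _ _)
        _ ≤ K * ‖p.2‖ := mul_le_mul_of_nonneg_right (norm_fderiv_le_of_lipschitz ℝ hH)
            (norm_nonneg _)
        _ ≤ _ := mul_le_mul_of_nonneg_left (by linarith [norm_nonneg p.1]) K.2
    have hGint : Integrable (fun p : Vec d × Vec d => (fderiv ℝ H p.1 p.2) ^ 4) (γ.prod γ) := by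
      refine (integrable_norm_add_norm_pow_four (d := d) K).mono' hGm.aestronglyMeasurable
        (Filter.Eventually.of_forall fun p => ?_)
      rw [Real.norm_of_nonneg (by positivity)]
      exact hbdG p
    rw [integral_prod _ hGint]
    calc ∫ x, ∫ y, (fderiv ℝ H x y) ^ 4 ∂γ ∂γ ≤ ∫ _x : Vec d, 128 * (K : ℝ) ^ 4 ∂γ := by
          refine integral_mono hGint.integral_prod_left (integrable_const _) fun x => ?_
          have hi := integral_inner_pow_four_le (gradient H x)
          have hn : ‖gradient H x‖ ≤ K := by
            rw [gradient, LinearIsometryEquiv.norm_map]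
            exact norm_fderiv_le_of_lipschitz ℝ hH
          calc ∫ y, (fderiv ℝ H x y) ^ 4 ∂γ = ∫ y, (inner ℝ (gradient H x) y) ^ 4 ∂γ := by
                simp [gradient]
            _ ≤ 128 * ‖gradient H x‖ ^ 4 := hi
            _ ≤ 128 * K ^ 4 := by gcongr
      _ = 128 * K ^ 4 := by simp
  have hswap : ∫ p, (∫ θ in (0 : ℝ)..Real.pi, h p θ ^ 4) ∂(γ.prod γ) ≤ Real.pi * (128 * K ^ 4) := by
    simp_rw [intervalIntegral.integral_of_le Real.pi_pos.le]
    rw [integral_integral_swap hint4]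
    calc ∫ θ in Set.Ioc 0 Real.pi, ∫ p, h p θ ^ 4 ∂(γ.prod γ)
        ≤ ∫ _θ in Set.Ioc 0 Real.pi, 128 * (K : ℝ) ^ 4 :=
          integral_mono hint4.integral_prod_right (integrable_const _) hslice
      _ = Real.pi * (128 * K ^ 4) := by simp [Real.pi_pos.le]
  calc ∫ x, (H x - H (-x)) ^ 4 ∂γ = ∫ p : Vec d × Vec d, (H p.1 - H (-p.1)) ^ 4 ∂(γ.prod γ) := by
        rw [integral_fun_fst (fun x => (H x - H (-x)) ^ 4)]; simp
    _ ≤ ∫ p, Real.pi ^ 3 * (∫ θ in (0 : ℝ)..Real.pi, h p θ ^ 4) ∂(γ.prod γ) := by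
        refine integral_mono_of_nonneg (Filter.Eventually.of_forall fun p => by positivity) ?_
          (Filter.Eventually.of_forall hFTC)
        simp_rw [intervalIntegral.integral_of_le Real.pi_pos.le]
        exact hint4.integral_prod_left.const_mul _
    _ ≤ Real.pi ^ 3 * (Real.pi * (128 * K ^ 4)) := by
        rw [integral_const_mul]
        exact mul_le_mul_of_nonneg_left hswap (by positivity)
    _ = _ := by ring

/-- The `1`-homogeneous extension of `F - F 0` from the unit sphere. -/
noncomputable def homExt (F : Vec d → ℝ) (x : Vec d) : ℝ := ‖x‖ * (F (‖x‖⁻¹ • x) - F 0)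

/-- A change of length costs `K`, because `F - F 0` is at most `K` on the unit sphere. A change of
direction costs `2 K`, because `‖y‖` times the distance of the directions of `x` and `y` is at most
`2 ‖x - y‖`. -/
lemma lipschitzWith_homExt {F : Vec d → ℝ} {K : ℝ≥0} (hF : LipschitzWith K F) :
    LipschitzWith (3 * K) (homExt F) := by
  refine LipschitzWith.of_dist_le_mul fun x y => ?_
  have hdir : ∀ z : Vec d, |F (‖z‖⁻¹ • z) - F 0| ≤ K := by
    intro z
    have h := hF.dist_le_mul (‖z‖⁻¹ • z) 0
    rw [Real.dist_eq, dist_zero_right, norm_smul, norm_inv, norm_norm] at h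
    exact h.trans (mul_le_of_le_one_right K.2 inv_mul_le_one)
  have hK : (0 : ℝ) ≤ K := K.2
  rw [Real.dist_eq, dist_eq_norm, NNReal.coe_mul, NNReal.coe_ofNat]
  rcases eq_or_ne x 0 with rfl | hx
  · simp only [homExt, norm_zero, zero_mul, zero_sub, abs_neg, norm_neg, abs_mul, abs_norm]
    nlinarith [hdir y, norm_nonneg y, mul_nonneg hK (norm_nonneg y)]
  have hxn : 0 < ‖x‖ := norm_pos_iff.2 hx
  have h1 : homExt F x - homExt F y = (‖x‖ - ‖y‖) * (F (‖x‖⁻¹ • x) - F 0) +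
      ‖y‖ * (F (‖x‖⁻¹ • x) - F (‖y‖⁻¹ • y)) := by unfold homExt; ring
  have h2 : ‖y‖ * |F (‖x‖⁻¹ • x) - F (‖y‖⁻¹ • y)| ≤ 2 * K * ‖x - y‖ := by
    rcases eq_or_ne y 0 with rfl | hy
    · simp; positivity
    have hyn : 0 < ‖y‖ := norm_pos_iff.2 hy
    have h3 := hF.dist_le_mul (‖x‖⁻¹ • x) (‖y‖⁻¹ • y)
    rw [Real.dist_eq, dist_eq_norm] at h3
    have h4 : ‖y‖ * ‖‖x‖⁻¹ • x - ‖y‖⁻¹ • y‖ ≤ 2 * ‖x - y‖ := by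
      have h5 : ‖y‖ • (‖x‖⁻¹ • x - ‖y‖⁻¹ • y) = (x - y) + ((‖y‖ - ‖x‖) * ‖x‖⁻¹) • x := by
        rw [smul_sub, smul_smul, smul_smul, mul_inv_cancel₀ hyn.ne', sub_mul,
          mul_inv_cancel₀ hxn.ne']
        module
      calc ‖y‖ * ‖‖x‖⁻¹ • x - ‖y‖⁻¹ • y‖ = ‖‖y‖ • (‖x‖⁻¹ • x - ‖y‖⁻¹ • y)‖ := by
            rw [norm_smul, norm_norm]
        _ ≤ ‖x - y‖ + ‖((‖y‖ - ‖x‖) * ‖x‖⁻¹) • x‖ := by rw [h5]; exact norm_add_le _ _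
        _ = ‖x - y‖ + |‖y‖ - ‖x‖| := by
            rw [norm_smul, norm_mul, norm_inv, norm_norm, Real.norm_eq_abs]; field_simp
        _ ≤ 2 * ‖x - y‖ := by
            have := abs_norm_sub_norm_le y x
            rw [norm_sub_rev] at this
            linarith
    calc ‖y‖ * |F (‖x‖⁻¹ • x) - F (‖y‖⁻¹ • y)|
        ≤ ‖y‖ * (K * ‖‖x‖⁻¹ • x - ‖y‖⁻¹ • y‖) := mul_le_mul_of_nonneg_left h3 hyn.le
      _ = K * (‖y‖ * ‖‖x‖⁻¹ • x - ‖y‖⁻¹ • y‖) := by ring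
      _ ≤ K * (2 * ‖x - y‖) := mul_le_mul_of_nonneg_left h4 hK
      _ = _ := by ring
  rw [h1]
  refine (abs_add_le _ _).trans ?_
  rw [abs_mul, abs_mul, abs_norm]
  have h6 : |‖x‖ - ‖y‖| * |F (‖x‖⁻¹ • x) - F 0| ≤ ‖x - y‖ * K :=
    mul_le_mul (abs_norm_sub_norm_le x y) (hdir x) (abs_nonneg _) (norm_nonneg _)
  linarith

/-- Concentration on the sphere: the odd part of a `K`-Lipschitz function is of order `K / √d`. -/
lemma integral_sub_neg_pow_four_uniformSphere_le (hd : 0 < d) {F : Vec d → ℝ} {K : ℝ≥0}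
    (hF : LipschitzWith K F) :
    ∫ e, (F e - F (-e)) ^ 4 ∂(uniformSphere d) ≤ 128 * (3 * Real.pi) ^ 4 * K ^ 4 / d ^ 2 := by
  have hd' : (0 : ℝ) < d := by exact_mod_cast hd
  have h1 := integral_sub_neg_pow_four_stdGaussian_le (lipschitzWith_homExt hF)
  have h2 := sq_mul_integral_uniformSphere_le hd
    (ψ := fun x => (homExt F x - homExt F (-x)) ^ 4) (by simp) (fun c x hc => by
      simp only [homExt, norm_neg, norm_smul, Real.norm_eq_abs, abs_of_pos hc, smul_neg, smul_smul,
        mul_inv_rev, mul_assoc, inv_mul_cancel₀ hc.ne', mul_one]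
      ring) (fun x => by positivity)
  have h3 : ∫ e, (homExt F e - homExt F (-e)) ^ 4 ∂(uniformSphere d) =
      ∫ e, (F e - F (-e)) ^ 4 ∂(uniformSphere d) := by
    refine integral_congr_ae ?_
    filter_upwards [ae_norm_eq_one_uniformSphere] with e he
    simp [homExt, he]
  rw [h3] at h2
  rw [le_div_iff₀ (by positivity), mul_comm]
  refine (h2.trans h1).trans (le_of_eq ?_)
  push_cast
  ring

end Concentration

end ZORestart

/-! ### Spherical averages of convex functions as approximate subgradients. -/

namespace ZORestart

section Divergence

variable {d : ℕ}

open scoped NNReal Topology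

/-- The piecewise linear cutoff that equals `1` up to `1 - η` and vanishes from `1` on. -/
noncomputable def radialCutoff (η ρ : ℝ) : ℝ := max 0 (min 1 ((1 - ρ) / η))

lemma radialCutoff_nonneg (η ρ : ℝ) : 0 ≤ radialCutoff η ρ := le_max_left _ _

lemma radialCutoff_le_one (η ρ : ℝ) : radialCutoff η ρ ≤ 1 := by
  unfold radialCutoff; simp

lemma radialCutoff_eq_zero {η ρ : ℝ} (hη : 0 < η) (h : 1 ≤ ρ) : radialCutoff η ρ = 0 := by
  unfold radialCutoff
  refine max_eq_left ((min_le_right _ _).trans ?_)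
  exact div_nonpos_of_nonpos_of_nonneg (by linarith) hη.le

lemma radialCutoff_eq_one {η ρ : ℝ} (hη : 0 < η) (h : ρ ≤ 1 - η) : radialCutoff η ρ = 1 := by
  unfold radialCutoff
  have : 1 ≤ (1 - ρ) / η := by rw [le_div_iff₀ hη]; linarith
  rw [min_eq_left this]; simp

lemma radialCutoff_eq_linear {η ρ : ℝ} (hη : 0 < η) (h : 1 - η ≤ ρ) (h1 : ρ ≤ 1) :
    radialCutoff η ρ = (1 - ρ) / η := by
  unfold radialCutoff
  rw [min_eq_right (by rw [div_le_iff₀ hη]; linarith),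
    max_eq_right (div_nonneg (by linarith) hη.le)]

lemma lipschitzWith_radialCutoff {η : ℝ} (hη : 0 < η) :
    LipschitzWith (Real.toNNReal η⁻¹) fun y : Vec d => radialCutoff η ‖y‖ := by
  have h : LipschitzWith (Real.toNNReal η⁻¹) fun y : Vec d => (1 - ‖y‖) / η := by
    refine LipschitzWith.of_dist_le_mul fun x y => ?_
    rw [Real.dist_eq, dist_eq_norm, Real.coe_toNNReal _ (by positivity), ← sub_div, abs_div,
      abs_of_pos hη, div_eq_inv_mul]
    refine mul_le_mul_of_nonneg_left ?_ (by positivity)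
    rw [show 1 - ‖x‖ - (1 - ‖y‖) = -(‖x‖ - ‖y‖) by ring, abs_neg]
    exact abs_norm_sub_norm_le x y
  exact (h.const_min 1).const_max 0

lemma hasCompactSupport_radialCutoff {η : ℝ} (hη : 0 < η) :
    HasCompactSupport fun y : Vec d => radialCutoff η ‖y‖ := by
  refine HasCompactSupport.intro (isCompact_closedBall (0 : Vec d) 1) fun x hx => ?_
  refine radialCutoff_eq_zero hη ?_
  simp only [Metric.mem_closedBall, dist_zero_right, not_le] at hx
  exact hx.le

/-- The density of the shell `1 - η < |y| < 1`, normalized by its width. -/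
noncomputable def shellWeight (η ρ : ℝ) : ℝ := (Set.Ioo (1 - η) 1).indicator (fun _ => η⁻¹) ρ

lemma shellWeight_nonneg {η : ℝ} (hη : 0 < η) (ρ : ℝ) : 0 ≤ shellWeight η ρ :=
  Set.indicator_nonneg (fun _ _ => by positivity) ρ

/-- In the shell the gradient is `-1/η` times the radial unit vector, and the sign is absorbed by
`-v`; elsewhere the cutoff is locally constant. The two excluded spheres carry its kinks and are
null sets. -/
lemma lineDeriv_radialCutoff {η : ℝ} (hη : 0 < η) (hη1 : η < 1) {y : Vec d} (v : Vec d)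
    (h1 : ‖y‖ ≠ 1 - η) (h2 : ‖y‖ ≠ 1) :
    lineDeriv ℝ (fun y : Vec d => radialCutoff η ‖y‖) y (-v) =
      shellWeight η ‖y‖ * inner ℝ v (‖y‖⁻¹ • y) := by
  by_cases hmem : ‖y‖ ∈ Set.Ioo (1 - η) 1
  · have hy : y ≠ 0 := by
      rintro rfl
      rw [norm_zero] at hmem
      linarith [hmem.1]
    have hev : (fun y : Vec d => radialCutoff η ‖y‖) =ᶠ[𝓝 y] fun y => (1 - ‖y‖) / η := by
      filter_upwards [continuous_norm.continuousAt.preimage_mem_nhds (Ioo_mem_nhds hmem.1 hmem.2)]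
        with z hz
      exact radialCutoff_eq_linear hη hz.1.le hz.2.le
    have hd : HasFDerivAt (fun y : Vec d => ‖y‖) (‖y‖⁻¹ • innerSL ℝ y) y := by
      have h := (hasStrictFDerivAt_norm_sq y).hasFDerivAt.sqrt (by simpa using hy)
      simp only [Real.sqrt_sq (norm_nonneg _)] at h
      have heq : (1 / (2 * ‖y‖)) • 2 • innerSL ℝ y = ‖y‖⁻¹ • innerSL ℝ y := by
        rw [← Nat.cast_smul_eq_nsmul ℝ, smul_smul]
        congr 1
        have : ‖y‖ ≠ 0 := norm_ne_zero_iff.2 hy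
        push_cast
        field_simp
      rw [heq] at h
      exact h
    have hd2 : HasFDerivAt (fun y : Vec d => (1 - ‖y‖) / η)
        (η⁻¹ • (-(‖y‖⁻¹ • innerSL ℝ y))) y := by
      have := (hd.const_sub 1).const_smul η⁻¹
      refine this.congr_of_eventuallyEq (Filter.Eventually.of_forall fun z => ?_)
      simp [div_eq_inv_mul]
    rw [Filter.EventuallyEq.lineDeriv_eq hev, hd2.differentiableAt.lineDeriv_eq_fderiv, hd2.fderiv,
      shellWeight, Set.indicator_of_mem hmem]
    simp [real_inner_smul_right, real_inner_comm]
  · rw [shellWeight, Set.indicator_of_notMem hmem, zero_mul]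
    rcases lt_or_gt_of_ne h1 with h | h
    · have hev : (fun y : Vec d => radialCutoff η ‖y‖) =ᶠ[𝓝 y] fun _ => (1 : ℝ) := by
        filter_upwards [continuous_norm.continuousAt.preimage_mem_nhds (Iio_mem_nhds h)] with z hz
        exact radialCutoff_eq_one hη (le_of_lt hz)
      rw [Filter.EventuallyEq.lineDeriv_eq hev]
      simp [lineDeriv]
    · have h3 : 1 < ‖y‖ := by
        by_contra h4
        exact hmem ⟨h, lt_of_le_of_ne (not_lt.1 h4) h2⟩
      have hev : (fun y : Vec d => radialCutoff η ‖y‖) =ᶠ[𝓝 y] fun _ => (0 : ℝ) := by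
        filter_upwards [continuous_norm.continuousAt.preimage_mem_nhds (Ioi_mem_nhds h3)] with z hz
        exact radialCutoff_eq_zero hη (le_of_lt hz)
      rw [Filter.EventuallyEq.lineDeriv_eq hev]
      simp [lineDeriv]

lemma integral_shellWeight {η : ℝ} (hη : 0 < η) (hη1 : η < 1) (hd : 0 < d) :
    Integrable (fun y : Vec d => shellWeight η ‖y‖) ∧
    ∫ y : Vec d, shellWeight η ‖y‖ =
      volume.real (Metric.ball (0 : Vec d) 1) * ((1 - (1 - η) ^ d) / η) := by
  have := nontrivial_vec hd
  have hs : (fun y : Vec d => shellWeight η ‖y‖) =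
      (Metric.ball (0 : Vec d) 1 \ Metric.closedBall 0 (1 - η)).indicator fun _ => η⁻¹ := by
    ext y
    simp only [shellWeight, Set.indicator, Set.mem_Ioo, Set.mem_sdiff, Metric.mem_ball,
      dist_zero_right, Metric.mem_closedBall, not_le]
    congr 1
    exact propext and_comm
  have hms : MeasurableSet (Metric.ball (0 : Vec d) 1 \ Metric.closedBall 0 (1 - η)) :=
    measurableSet_ball.diff measurableSet_closedBall
  rw [hs]
  constructor
  · refine (integrableOn_const ?_).integrable_indicator hms
    exact ((measure_mono Set.sdiff_subset).trans_lt measure_ball_lt_top).ne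
  · rw [integral_indicator_const _ hms, measureReal_sdiff
      (fun y hy => Metric.closedBall_subset_ball (by linarith) hy) measurableSet_closedBall
      measure_ball_lt_top.ne]
    have : volume.real (Metric.closedBall (0 : Vec d) (1 - η)) =
        (1 - η) ^ d * volume.real (Metric.ball (0 : Vec d) 1) := by
      rw [Measure.real, Measure.addHaar_closedBall _ _ (by linarith), ENNReal.toReal_mul,
        finrank_euclideanSpace, Fintype.card_fin, ENNReal.toReal_ofReal (by
          have : 0 < 1 - η := by linarith
          positivity), Measure.real]
    rw [this, smul_eq_mul]
    ring

lemma integral_radialCutoff_bounds {η : ℝ} (hη : 0 < η) (hη1 : η < 1) (hd : 0 < d) :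
    Integrable (fun y : Vec d => radialCutoff η ‖y‖) ∧
    volume.real (Metric.ball (0 : Vec d) 1) * (1 - η) ^ d ≤ ∫ y : Vec d, radialCutoff η ‖y‖ ∧
    ∫ y : Vec d, radialCutoff η ‖y‖ ≤ volume.real (Metric.ball (0 : Vec d) 1) := by
  have := nontrivial_vec hd
  have hI : Integrable (fun y : Vec d => radialCutoff η ‖y‖) :=
    (lipschitzWith_radialCutoff hη).continuous.integrable_of_hasCompactSupport
      (hasCompactSupport_radialCutoff hη)
  refine ⟨hI, ?_, ?_⟩
  · have : volume.real (Metric.closedBall (0 : Vec d) (1 - η)) =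
        (1 - η) ^ d * volume.real (Metric.ball (0 : Vec d) 1) := by
      rw [Measure.real, Measure.addHaar_closedBall _ _ (by linarith), ENNReal.toReal_mul,
        finrank_euclideanSpace, Fintype.card_fin, ENNReal.toReal_ofReal (by
          have : 0 < 1 - η := by linarith
          positivity), Measure.real]
    rw [mul_comm, ← this]
    calc volume.real (Metric.closedBall (0 : Vec d) (1 - η))
        = ∫ y : Vec d, (Metric.closedBall (0 : Vec d) (1 - η)).indicator (fun _ => (1 : ℝ)) y := by
          rw [integral_indicator_const _ measurableSet_closedBall]; simp
      _ ≤ _ := by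
          refine integral_mono ((integrableOn_const
            measure_closedBall_lt_top.ne).integrable_indicator measurableSet_closedBall) hI ?_
          intro y
          simp only [Set.indicator]
          split_ifs with h
          · rw [radialCutoff_eq_one hη (by simpa using h)]
          · exact radialCutoff_nonneg _ _
  · calc ∫ y : Vec d, radialCutoff η ‖y‖
        ≤ ∫ y : Vec d, (Metric.ball (0 : Vec d) 1).indicator (fun _ => (1 : ℝ)) y := by
          refine integral_mono hI ((integrableOn_const
            measure_ball_lt_top.ne).integrable_indicator measurableSet_ball) ?_
          intro y
          simp only [Set.indicator]
          split_ifs with h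
          · exact radialCutoff_le_one _ _
          · rw [radialCutoff_eq_zero hη (by simpa using h)]
      _ = _ := by rw [integral_indicator_const _ measurableSet_ball]; simp

/-- The subgradient inequality. The derivative is computed from the left, as only the segment from
`y` to `y - v` is known to lie in `S`. -/
lemma sub_le_lineDeriv {F : Vec d → ℝ} {S : Set (Vec d)} (hF : ConvexOn ℝ S F) {y v : Vec d}
    (hy : y ∈ S) (hyv : y - v ∈ S) (hdiff : DifferentiableAt ℝ F y) :
    F y - F (y - v) ≤ lineDeriv ℝ F y v := by
  have hs := hdiff.lineDifferentiableAt (v := v) |>.hasLineDerivAt.tendsto_slope_zero_left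
  have hs' : Filter.Tendsto (fun t : ℝ => t⁻¹ • (F (y + t • v) - F y)) (𝓝[<] 0)
    (𝓝 (lineDeriv ℝ F y v)) := hs
  refine ge_of_tendsto hs' ?_
  have h1 : Set.Ioo (-1 : ℝ) 0 ∈ 𝓝[<] (0 : ℝ) := Ioo_mem_nhdsLT (by norm_num)
  filter_upwards [h1] with t ht
  have hc := hF.2 hy hyv (show (0 : ℝ) ≤ 1 + t by linarith [ht.1])
    (show (0 : ℝ) ≤ -t by linarith [ht.2]) (by ring)
  have he : (1 + t) • y + (-t) • (y - v) = y + t • v := by module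
  rw [he] at hc
  simp only [smul_eq_mul] at hc ⊢
  have ht0 : t⁻¹ < 0 := inv_lt_zero.2 ht.2
  have h2 : F (y + t • v) - F y ≤ t * (F y - F (y - v)) := by linarith
  have h3 := mul_le_mul_of_nonpos_left h2 ht0.le
  rwa [← mul_assoc, inv_mul_cancel₀ ht.2.ne, one_mul] at h3

/-- For a convex Lipschitz function the averages of `F(e) ⟨v, e⟩` over the sphere act as an
approximate subgradient at the centre. -/
lemma sub_le_integral_mul_inner_uniformSphere (hd : 0 < d) {F : Vec d → ℝ} {K : ℝ≥0}
    (hF : LipschitzWith K F) {S : Set (Vec d)} (hconv : ConvexOn ℝ S F) {v : Vec d}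
    (h0 : Metric.closedBall 0 1 ⊆ S) (hv : ∀ y ∈ Metric.closedBall (0 : Vec d) 1, y - v ∈ S) :
    F 0 - F (-v) - 2 * K ≤ d * ∫ e, F e * inner ℝ v e ∂(uniformSphere d) := by
  have hnt := nontrivial_vec hd
  set Sv := ∫ e, F e * inner ℝ v e ∂(uniformSphere d) with hSv
  set V := volume.real (Metric.ball (0 : Vec d) 1) with hV
  have hVpos : 0 < V := by
    rw [hV, Measure.real]
    exact ENNReal.toReal_pos (Metric.measure_ball_pos _ _ one_pos).ne' measure_ball_lt_top.ne
  set k0 := F 0 - F (-v) - 2 * K with hk0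
  have hK : (0 : ℝ) ≤ K := K.2
  -- A divergence theorem without surface measure: integrate the derivative of `F` against the
  -- cutoff and move the derivative onto the cutoff. `G` is the mass of the cutoff relative to the
  -- unit ball, and `K η ‖v‖` is the price of replacing `F` in the shell by its value at the radial
  -- projection.
  have main : ∀ η : ℝ, 0 < η → η < 1 → ∃ G : ℝ, (1 - η) ^ d ≤ G ∧ G ≤ 1 ∧
      k0 * G ≤ (Sv + K * η * ‖v‖) * ((1 - (1 - η) ^ d) / η) := by
    intro η hη hη1
    obtain ⟨hgI, hg1, hg2⟩ := integral_radialCutoff_bounds hη hη1 hd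
    obtain ⟨hwI, hw⟩ := integral_shellWeight hη hη1 hd
    set g : Vec d → ℝ := fun y => radialCutoff η ‖y‖ with hg
    have hgc : Continuous g := (lipschitzWith_radialCutoff hη).continuous
    refine ⟨(∫ y, g y) / V, by rwa [le_div_iff₀ hVpos, mul_comm],
      (div_le_one hVpos).2 hg2, ?_⟩
    have hparts := hF.integral_lineDeriv_mul_eq (μ := volume) (lipschitzWith_radialCutoff hη)
      (hasCompactSupport_radialCutoff hη) v
    -- The loss `2 K` in `k0` arises here: for `‖y‖ ≤ 1`, replacing `F y` by `F 0` and `F (y - v)`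
    -- by `F (-v)` costs at most `K` each.
    have hlower : k0 * ∫ y, g y ≤ ∫ y, lineDeriv ℝ F y v * g y := by
      rw [← integral_const_mul]
      refine integral_mono_ae (hgI.const_mul _) ?_ ?_
      · refine (hgI.const_mul (K * ‖v‖)).mono'
          (((measurable_lineDeriv hF.continuous).mul hgc.measurable).aestronglyMeasurable)
          (Filter.Eventually.of_forall fun y => ?_)
        rw [norm_mul, Real.norm_of_nonneg (radialCutoff_nonneg η ‖y‖)]
        exact mul_le_mul_of_nonneg_right (norm_lineDeriv_le_of_lipschitz ℝ hF)
          (radialCutoff_nonneg _ _)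
      · filter_upwards [hF.ae_differentiableAt] with y hy
        rcases le_or_gt 1 ‖y‖ with h | h
        · simp [hg, radialCutoff_eq_zero hη h]
        refine mul_le_mul_of_nonneg_right ?_ (radialCutoff_nonneg _ _)
        have hyb : y ∈ Metric.closedBall (0 : Vec d) 1 := by simpa using h.le
        refine le_trans ?_ (sub_le_lineDeriv hconv (h0 hyb) (hv y hyb) hy)
        have h1 := hF.dist_le_mul y 0
        have h2 := hF.dist_le_mul (y - v) (-v)
        rw [Real.dist_eq, dist_eq_norm] at h1 h2
        rw [sub_zero] at h1
        rw [show y - v - -v = y by abel] at h2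
        have h3 : K * ‖y‖ ≤ K := mul_le_of_le_one_right hK h.le
        have := abs_le.1 (h1.trans h3)
        have := abs_le.1 (h2.trans h3)
        rw [hk0]
        linarith
    have hupper : ∫ y, lineDeriv ℝ g y (-v) * F y ≤
        (Sv + K * η * ‖v‖) * ∫ y : Vec d, shellWeight η ‖y‖ := by
      have hpol := integral_norm_mul_direction hd (shellWeight η) fun e => F e * inner ℝ v e
      rw [← hSv] at hpol
      have hdir : ∀ y : Vec d, ‖‖y‖⁻¹ • y‖ ≤ 1 := fun y => by
        rw [norm_smul, norm_inv, norm_norm]; exact inv_mul_le_one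
      have hin : ∀ y : Vec d, |inner ℝ v (‖y‖⁻¹ • y)| ≤ ‖v‖ := fun y =>
        (abs_real_inner_le_norm _ _).trans (mul_le_of_le_one_right (norm_nonneg _) (hdir y))
      have hsm : Measurable fun y : Vec d => shellWeight η ‖y‖ :=
        (measurable_const.indicator measurableSet_Ioo).comp measurable_norm
      have hdm : Measurable fun y : Vec d => ‖y‖⁻¹ • y := by fun_prop
      have hI1 : Integrable fun y : Vec d =>
          shellWeight η ‖y‖ * (F (‖y‖⁻¹ • y) * inner ℝ v (‖y‖⁻¹ • y)) := by
        refine (hwI.mul_const ((|F 0| + K) * ‖v‖)).mono' ?_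
          (Filter.Eventually.of_forall fun y => ?_)
        · have := hF.continuous.measurable.comp hdm
          exact (hsm.mul (this.mul (measurable_const.inner hdm))).aestronglyMeasurable
        · rw [norm_mul, Real.norm_of_nonneg (shellWeight_nonneg hη _), norm_mul]
          refine mul_le_mul_of_nonneg_left ?_ (shellWeight_nonneg hη _)
          refine mul_le_mul ?_ (hin y) (norm_nonneg _) (by positivity)
          have h1 := hF.dist_le_mul (‖y‖⁻¹ • y) 0
          rw [Real.dist_eq, dist_zero_right] at h1
          have h2 := h1.trans (mul_le_of_le_one_right hK (hdir y))
          rw [Real.norm_eq_abs]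
          have := abs_sub_abs_le_abs_sub (F (‖y‖⁻¹ • y)) (F 0)
          linarith
      have hsph : ∀ r : ℝ, r ≠ 0 → ∀ᵐ y : Vec d, ‖y‖ ≠ r := fun r hr => by
        have := Measure.addHaar_sphere_of_ne_zero (volume : Measure (Vec d)) 0 hr
        rw [← compl_mem_ae_iff] at this
        filter_upwards [this] with y hy
        simpa using hy
      have hline : ∀ᵐ y : Vec d, lineDeriv ℝ g y (-v) =
          shellWeight η ‖y‖ * inner ℝ v (‖y‖⁻¹ • y) := by
        filter_upwards [hsph (1 - η) (by linarith), hsph 1 one_ne_zero] with y h1 h2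
        exact lineDeriv_radialCutoff hη hη1 v h1 h2
      calc ∫ y, lineDeriv ℝ g y (-v) * F y
          ≤ ∫ y : Vec d, (shellWeight η ‖y‖ * (F (‖y‖⁻¹ • y) * inner ℝ v (‖y‖⁻¹ • y)) +
              K * η * ‖v‖ * shellWeight η ‖y‖) := by
            refine integral_mono_ae ?_ (hI1.add (hwI.const_mul _)) ?_
            · refine (hwI.mul_const (‖v‖ * (|F 0| + K))).mono'
                ((measurable_lineDeriv hgc).mul hF.continuous.measurable).aestronglyMeasurable ?_
              filter_upwards [hline] with y hy
              rw [hy]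
              by_cases hmem : ‖y‖ ∈ Set.Ioo (1 - η) 1
              · rw [mul_assoc, norm_mul, Real.norm_of_nonneg (shellWeight_nonneg hη _), norm_mul]
                refine mul_le_mul_of_nonneg_left ?_ (shellWeight_nonneg hη _)
                refine mul_le_mul (hin y) ?_ (norm_nonneg _) (norm_nonneg _)
                have h1 := hF.dist_le_mul y 0
                rw [Real.dist_eq, dist_zero_right] at h1
                have h2 := h1.trans (mul_le_of_le_one_right hK hmem.2.le)
                rw [Real.norm_eq_abs]
                have := abs_sub_abs_le_abs_sub (F y) (F 0)
                linarith
              · simp [shellWeight, Set.indicator_of_notMem hmem]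
            · filter_upwards [hline] with y hy
              rw [hy]
              by_cases hmem : ‖y‖ ∈ Set.Ioo (1 - η) 1
              · have hyn : 0 < ‖y‖ := by linarith [hmem.1]
                have h3 := hF.dist_le_mul y (‖y‖⁻¹ • y)
                have h4 : dist y (‖y‖⁻¹ • y) ≤ η := by
                  have : y - ‖y‖⁻¹ • y = (1 - ‖y‖⁻¹) • y := by module
                  rw [dist_eq_norm, this, norm_smul, Real.norm_eq_abs]
                  calc |1 - ‖y‖⁻¹| * ‖y‖ = |(1 - ‖y‖⁻¹) * ‖y‖| := by rw [abs_mul, abs_norm]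
                    _ = |‖y‖ - 1| := by congr 1; field_simp
                    _ ≤ η := by rw [abs_le]; constructor <;> linarith [hmem.1, hmem.2]
                have h5 : |F y - F (‖y‖⁻¹ • y)| ≤ K * η := by
                  rw [← Real.dist_eq]
                  exact h3.trans (mul_le_mul_of_nonneg_left h4 hK)
                have h6 : (F y - F (‖y‖⁻¹ • y)) * inner ℝ v (‖y‖⁻¹ • y) ≤ K * η * ‖v‖ := by
                  refine (le_abs_self _).trans ?_
                  rw [abs_mul]
                  exact mul_le_mul h5 (hin y) (abs_nonneg _) (by positivity)
                have := mul_le_mul_of_nonneg_left h6 (shellWeight_nonneg hη ‖y‖)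
                linarith
              · simp [shellWeight, Set.indicator_of_notMem hmem]
        _ = _ := by
            rw [integral_add hI1 (hwI.const_mul _), hpol, integral_const_mul]
            ring
    rw [hw] at hupper
    have h := hlower.trans (hparts.trans_le hupper)
    rw [mul_div_assoc', div_le_iff₀ hVpos]
    calc _ ≤ _ := h
      _ = _ := by ring
  choose! G hG1 hG2 hG3 using main
  have hIoo : Set.Ioo (0 : ℝ) 1 ∈ 𝓝[>] (0 : ℝ) := Ioo_mem_nhdsGT one_pos
  have hid : Filter.Tendsto (fun η : ℝ => η) (𝓝[>] 0) (𝓝 0) := nhdsWithin_le_nhds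
  have hpow : Filter.Tendsto (fun η : ℝ => (1 - η) ^ d) (𝓝[>] 0) (𝓝 1) := by
    have : Filter.Tendsto (fun η : ℝ => (1 - η) ^ d) (𝓝[>] 0) (𝓝 ((1 - 0) ^ d)) :=
      (hid.const_sub 1).pow d
    simpa using this
  have hGt : Filter.Tendsto G (𝓝[>] 0) (𝓝 1) := by
    refine tendsto_of_tendsto_of_tendsto_of_le_of_le' hpow tendsto_const_nhds ?_ ?_
    · filter_upwards [hIoo] with η hη using hG1 η hη.1 hη.2
    · filter_upwards [hIoo] with η hη using hG2 η hη.1 hη.2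
  -- The normalized shell volume tends to the ratio `d` of the surface of the unit ball to its
  -- volume: this is the dimension factor in the estimator.
  have hslope : Filter.Tendsto (fun η : ℝ => (1 - (1 - η) ^ d) / η) (𝓝[>] 0) (𝓝 d) := by
    have hder : HasDerivAt (fun η : ℝ => -(1 - η) ^ d) d 0 := by
      have := (((hasDerivAt_id (0 : ℝ)).const_sub 1).pow d).neg
      convert! this using 1
      simp
    refine hder.tendsto_slope_zero_right.congr fun η => ?_
    simp only [zero_add, sub_zero, one_pow, smul_eq_mul]
    ring
  have hR : Filter.Tendsto (fun η : ℝ => (Sv + K * η * ‖v‖) * ((1 - (1 - η) ^ d) / η)) (𝓝[>] 0)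
      (𝓝 ((Sv + K * 0 * ‖v‖) * d)) :=
    (((hid.const_mul (K : ℝ)).mul_const ‖v‖).const_add Sv).mul hslope
  have hL : Filter.Tendsto (fun η : ℝ => k0 * G η) (𝓝[>] 0) (𝓝 (k0 * 1)) := hGt.const_mul k0
  have := le_of_tendsto_of_tendsto hL hR (by
    filter_upwards [hIoo] with η hη using hG3 η hη.1 hη.2)
  simpa [mul_comm] using this

end Divergence

end ZORestart

/-! ### Finite-dimensional norms, duality and the constant `aq`. -/

namespace ZORestart

section Norms

variable {d : ℕ}

lemma sum_abs_rpow_eq {m : ℝ} (hm : 0 < m) (x : Vec d) :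
    ∑ i, |x i| ^ m = lmNorm m x ^ m := by
  rw [lmNorm, ← Real.rpow_mul (by positivity), one_div_mul_cancel hm.ne', Real.rpow_one]

lemma abs_apply_le_lmNorm {m : ℝ} (hm : 0 < m) (x : Vec d) (i : Fin d) : |x i| ≤ lmNorm m x := by
  have h : |x i| ^ m ≤ lmNorm m x ^ m := by
    rw [← sum_abs_rpow_eq hm]
    exact Finset.single_le_sum (f := fun i => |x i| ^ m) (fun j _ => by positivity)
      (Finset.mem_univ i)
  exact (Real.rpow_le_rpow_iff (abs_nonneg _) (lmNorm_nonneg _ _) hm).1 h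

lemma lmNorm_antitone {m n : ℝ} (hm : 0 < m) (hmn : m ≤ n) (x : Vec d) :
    lmNorm n x ≤ lmNorm m x := by
  have hn : 0 < n := hm.trans_le hmn
  refine (Real.rpow_le_rpow_iff (lmNorm_nonneg _ _) (lmNorm_nonneg _ _) hn).1 ?_
  rw [← sum_abs_rpow_eq hn]
  calc ∑ i, |x i| ^ n ≤ ∑ i, |x i| ^ m * lmNorm m x ^ (n - m) := by
        refine Finset.sum_le_sum fun i _ => ?_
        rcases eq_or_lt_of_le (abs_nonneg (x i)) with h | h
        · rw [← h, Real.zero_rpow hn.ne', Real.zero_rpow hm.ne', zero_mul]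
        · calc |x i| ^ n = |x i| ^ m * |x i| ^ (n - m) := by
                rw [← Real.rpow_add h]; congr 1; ring
            _ ≤ _ := by
                gcongr
                exact abs_apply_le_lmNorm hm x i
    _ = lmNorm m x ^ n := by
        rw [← Finset.sum_mul, sum_abs_rpow_eq hm]
        rcases eq_or_lt_of_le (lmNorm_nonneg m x) with h | h
        · rw [← h, Real.zero_rpow hm.ne', Real.zero_rpow hn.ne', zero_mul]
        · rw [← Real.rpow_add h]; congr 1; ring

lemma lmNorm_le_card_rpow_mul {m n : ℝ} (hm : 0 < m) (hmn : m ≤ n) (x : Vec d) :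
    lmNorm m x ≤ (d : ℝ) ^ (1 / m - 1 / n) * lmNorm n x := by
  have hn : 0 < n := hm.trans_le hmn
  have h := Real.rpow_sum_le_const_mul_sum_rpow Finset.univ (fun i => |x i| ^ m)
    (p := n / m) ((one_le_div hm).2 hmn)
  simp only [Finset.card_univ, Fintype.card_fin, abs_of_nonneg (Real.rpow_nonneg (abs_nonneg _) _)]
    at h
  simp_rw [← Real.rpow_mul (abs_nonneg _), mul_div_cancel₀ n hm.ne'] at h
  calc lmNorm m x = ((∑ i, |x i| ^ m) ^ (n / m)) ^ (1 / n) := by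
        rw [lmNorm, ← Real.rpow_mul (by positivity)]; congr 1; field_simp
    _ ≤ ((d : ℝ) ^ (n / m - 1) * ∑ i, |x i| ^ n) ^ (1 / n) :=
        Real.rpow_le_rpow (by positivity) h (by positivity)
    _ = _ := by
        rw [Real.mul_rpow (by positivity) (by positivity), ← Real.rpow_mul (by positivity), lmNorm]
        congr 2; field_simp

lemma lmNorm_one (x : Vec d) : lmNorm 1 x = ∑ i, |x i| := by simp [lmNorm]

lemma lmNorm_two (x : Vec d) : lmNorm 2 x = ‖x‖ := by
  rw [EuclideanSpace.norm_eq, lmNorm, Real.sqrt_eq_rpow]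
  simp

lemma toReal_mem_Icc {p : ENNReal} (hp1 : 1 ≤ p) (hp2 : p ≤ 2) :
    1 ≤ p.toReal ∧ p.toReal ≤ 2 := by
  have hpt : p ≠ ⊤ := (hp2.trans_lt (by simp)).ne
  exact ⟨by simpa using ENNReal.toReal_mono hpt hp1,
    by simpa using ENNReal.toReal_mono (by simp) hp2⟩

lemma lpNorm_eq_lmNorm {p : ENNReal} (hp1 : 1 ≤ p) (hp2 : p ≤ 2) (x : Vec d) :
    lpNorm p x = lmNorm p.toReal x := by
  rw [lpNorm, PiLp.norm_eq_sum (by linarith [(toReal_mem_Icc hp1 hp2).1]), lmNorm]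
  rfl

lemma lpNorm_nonneg {p : ENNReal} (hp1 : 1 ≤ p) (x : Vec d) : 0 ≤ lpNorm p x := by
  have : Fact (1 ≤ p) := ⟨hp1⟩
  exact norm_nonneg _

lemma lpNorm_add_le {p : ENNReal} (hp1 : 1 ≤ p) (x y : Vec d) :
    lpNorm p (x + y) ≤ lpNorm p x + lpNorm p y := by
  have : Fact (1 ≤ p) := ⟨hp1⟩
  exact norm_add_le (WithLp.toLp p x.ofLp : PiLp p (fun _ : Fin d => ℝ)) (WithLp.toLp p y.ofLp)

lemma lpNorm_smul {p : ENNReal} (hp1 : 1 ≤ p) (c : ℝ) (x : Vec d) :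
    lpNorm p (c • x) = |c| * lpNorm p x := by
  have : Fact (1 ≤ p) := ⟨hp1⟩
  exact norm_smul c (WithLp.toLp p x.ofLp : PiLp p (fun _ : Fin d => ℝ))

lemma lpNorm_zero {p : ENNReal} (hp1 : 1 ≤ p) : lpNorm p (0 : Vec d) = 0 := by
  simpa using lpNorm_smul hp1 0 (0 : Vec d)

lemma lpNorm_neg {p : ENNReal} (hp1 : 1 ≤ p) (x : Vec d) : lpNorm p (-x) = lpNorm p x := by
  simpa using lpNorm_smul hp1 (-1) x

lemma lpNorm_sub_comm {p : ENNReal} (hp1 : 1 ≤ p) (x y : Vec d) :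
    lpNorm p (x - y) = lpNorm p (y - x) := by
  rw [← lpNorm_neg hp1, neg_sub]

lemma norm_le_lpNorm {p : ENNReal} (hp1 : 1 ≤ p) (hp2 : p ≤ 2) (x : Vec d) :
    ‖x‖ ≤ lpNorm p x := by
  have h := toReal_mem_Icc hp1 hp2
  rw [lpNorm_eq_lmNorm hp1 hp2, ← lmNorm_two]
  exact lmNorm_antitone (by linarith) h.2 x

lemma continuous_lpNorm {p : ENNReal} (hp1 : 1 ≤ p) (hp2 : p ≤ 2) :
    Continuous (lpNorm (d := d) p) := by
  have h := toReal_mem_Icc hp1 hp2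
  have : lpNorm (d := d) p = lmNorm p.toReal := funext fun x => lpNorm_eq_lmNorm hp1 hp2 x
  rw [this]
  exact continuous_lmNorm (by linarith)

lemma lpNorm_le_mul_norm {p : ENNReal} (hp1 : 1 ≤ p) (hp2 : p ≤ 2) (x : Vec d) :
    lpNorm p x ≤ d * ‖x‖ := by
  rw [lpNorm_eq_lmNorm hp1 hp2]
  refine (lmNorm_antitone one_pos (toReal_mem_Icc hp1 hp2).1 x).trans ?_
  rw [lmNorm_one]
  calc ∑ i, |x i| ≤ ∑ _i : Fin d, ‖x‖ :=
        Finset.sum_le_sum fun i _ => PiLp.norm_apply_le x i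
    _ = d * ‖x‖ := by simp

lemma inner_eq_sum (g v : Vec d) : inner ℝ g v = ∑ i, g i * v i := by
  simp [PiLp.inner_apply, mul_comm]

/-- Hölder's inequality with the dual norm replaced by an `ℓ_m`-norm. -/
lemma abs_inner_le_lmNorm_mul_lpNorm {p q : ENNReal} (hp1 : 1 ≤ p) (hp2 : p ≤ 2)
    (hpq : p.HolderConjugate q) {m : ℝ} (hm : 1 ≤ m) (g v : Vec d) :
    |inner ℝ g v| ≤ max 1 ((d : ℝ) ^ ((1 / q).toReal - 1 / m)) * lmNorm m g * lpNorm p v := by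
  have hm0 : 0 < m := by linarith
  have hpr := toReal_mem_Icc hp1 hp2
  have habs : |inner ℝ g v| ≤ ∑ i, |g i| * |v i| := by
    rw [inner_eq_sum]
    exact (Finset.abs_sum_le_sum_abs _ _).trans_eq (by simp_rw [abs_mul])
  refine habs.trans ?_
  rcases eq_or_lt_of_le hp1 with h1 | h1
  · calc ∑ i, |g i| * |v i| ≤ ∑ i, lmNorm m g * |v i| :=
          Finset.sum_le_sum fun i _ =>
            mul_le_mul_of_nonneg_right (abs_apply_le_lmNorm hm0 g i) (abs_nonneg _)
      _ = 1 * lmNorm m g * lpNorm p v := by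
          rw [← Finset.mul_sum, ← lmNorm_one, lpNorm_eq_lmNorm hp1 hp2, ← h1]; simp
      _ ≤ _ := by
          gcongr
          · exact lpNorm_nonneg hp1 v
          · exact lmNorm_nonneg _ _
          · exact le_max_left _ _
  · have hpt : p ≠ ⊤ := (hp2.trans_lt (by simp)).ne
    have hp1' : 1 < p.toReal := by
      rw [← ENNReal.toReal_one]; exact (ENNReal.toReal_lt_toReal (by simp) hpt).2 h1
    have hc : p.toReal.HolderConjugate q.toReal := ENNReal.HolderConjugate.toReal hp1'
    have hq1 : 1 < q.toReal := hc.symm.lt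
    have hH := Real.inner_le_Lp_mul_Lq Finset.univ (fun i => |g i|) (fun i => |v i|) hc.symm
    simp only [abs_abs] at hH
    have hq : (1 / q).toReal = 1 / q.toReal := by simp
    calc ∑ i, |g i| * |v i| ≤ lmNorm q.toReal g * lpNorm p v := by
          rw [lpNorm_eq_lmNorm hp1 hp2]; exact hH
      _ ≤ _ := by
          refine mul_le_mul_of_nonneg_right ?_ (lpNorm_nonneg hp1 v)
          rcases le_total m q.toReal with h | h
          · calc lmNorm q.toReal g ≤ 1 * lmNorm m g := by
                  rw [one_mul]; exact lmNorm_antitone hm0 h g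
              _ ≤ _ := mul_le_mul_of_nonneg_right (le_max_left _ _) (lmNorm_nonneg _ _)
          · rw [hq]
            exact (lmNorm_le_card_rpow_mul (by linarith) h g).trans
              (mul_le_mul_of_nonneg_right (le_max_right _ _) (lmNorm_nonneg _ _))

lemma log_lower {d : ℕ} (hd : 2 ≤ d) : 0.69 ≤ Real.log d := by
  have h1 : Real.log 2 ≤ Real.log d := Real.log_le_log (by norm_num) (by exact_mod_cast hd)
  linarith [Real.log_two_gt_d9]

lemma two_le_toReal_of_holderConjugate {p q : ENNReal} (hp1 : 1 ≤ p) (hp2 : p ≤ 2)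
    (hpq : p.HolderConjugate q) (hq : q ≠ ⊤) : 2 ≤ q.toReal := by
  have hpr := toReal_mem_Icc hp1 hp2
  have hpt : p ≠ ⊤ := (hp2.trans_lt (by simp)).ne
  have hc : p.toReal.HolderConjugate q.toReal := ENNReal.HolderConjugate.toReal_of_ne_top hpt hq
  have hq1 : 1 < q.toReal := hc.symm.lt
  have := hc.mul_eq_add
  nlinarith

/-- The squared second factor of `a_q`. -/
lemma exists_aq_eq {p q : ENNReal} (hd : 2 ≤ d) (hp1 : 1 ≤ p) (hp2 : p ≤ 2)
    (hpq : p.HolderConjugate q) :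
    ∃ b : ℝ, 3 ≤ b ∧ aq d q = (d : ℝ) ^ ((1 / q).toReal - 1 / 2) * √b ∧
      ((q ≠ ⊤ ∧ b = 2 * q.toReal - 1) ∨ b = 32 * Real.log d - 8) := by
  have hlog := log_lower hd
  by_cases hq : q = ⊤
  · exact ⟨32 * Real.log d - 8, by linarith, by simp [aq, hq], Or.inr rfl⟩
  · have hq2 := two_le_toReal_of_holderConjugate hp1 hp2 hpq hq
    rcases le_total (32 * Real.log d - 8) (2 * q.toReal - 1) with h | h
    · refine ⟨32 * Real.log d - 8, by linarith, ?_, Or.inr rfl⟩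
      rw [aq, if_neg hq, min_eq_left (Real.sqrt_le_sqrt h)]
    · refine ⟨2 * q.toReal - 1, by linarith, ?_, Or.inl ⟨hq, rfl⟩⟩
      rw [aq, if_neg hq, min_eq_right (Real.sqrt_le_sqrt h)]

lemma aq_pos {p q : ENNReal} (hd : 2 ≤ d) (hp1 : 1 ≤ p) (hp2 : p ≤ 2)
    (hpq : p.HolderConjugate q) : 0 < aq d q := by
  obtain ⟨b, hb, h, -⟩ := exists_aq_eq hd hp1 hp2 hpq
  have : (0 : ℝ) < d := by positivity
  rw [h]
  positivity

/-- The powers of `d` combine to `d^(1/q) ≥ 1`. The bound keeps the noiseless part of `σ` above `M₂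
/ 2`, so that the prescribed number of steps is at least one. -/
lemma one_le_sqrt_mul_aq {p q : ENNReal} (hd : 2 ≤ d) (hp1 : 1 ≤ p) (hp2 : p ≤ 2)
    (hpq : p.HolderConjugate q) : 1 ≤ √d * aq d q := by
  obtain ⟨b, hb, h, -⟩ := exists_aq_eq hd hp1 hp2 hpq
  have hd1 : (1 : ℝ) ≤ d := by exact_mod_cast (by omega : 1 ≤ d)
  have h1 : √d * aq d q = (d : ℝ) ^ ((1 / q).toReal) * √b := by
    rw [h, ← mul_assoc, Real.sqrt_eq_rpow, ← Real.rpow_add (by linarith)]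
    congr 2; ring
  rw [h1]
  have h2 : 1 ≤ √b := Real.one_le_sqrt.2 (by linarith)
  have h3 : 1 ≤ (d : ℝ) ^ ((1 / q).toReal) := Real.one_le_rpow hd1 ENNReal.toReal_nonneg
  nlinarith

/-- A norm dual to `‖·‖_p` up to constants, with fourth moment of order `a_q⁴` on the sphere. -/
lemma exists_dual_lmNorm {p q : ENNReal} (hd : 2 ≤ d) (hp1 : 1 ≤ p) (hp2 : p ≤ 2)
    (hpq : p.HolderConjugate q) :
    ∃ m C : ℝ, 0 < m ∧ 0 < C ∧
      (∀ g v : Vec d, |inner ℝ g v| ≤ C * lmNorm m g * lpNorm p v) ∧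
      ∫ e, (C * lmNorm m e) ^ 4 ∂(uniformSphere d) ≤ 64 * aq d q ^ 4 := by
  obtain ⟨b, hb3, hb, hcase⟩ := exists_aq_eq hd hp1 hp2 hpq
  have hd1 : (1 : ℝ) ≤ d := by exact_mod_cast (by omega : 1 ≤ d)
  have hd0 : (0 : ℝ) < d := by linarith
  have hlog := log_lower hd
  set θ := (1 / q).toReal with hθ
  have hθ0 : 0 ≤ θ := ENNReal.toReal_nonneg
  have haq4 : aq d q ^ 4 = (d : ℝ) ^ (4 * θ) / d ^ 2 * b ^ 2 := by
    rw [hb, mul_pow, ← Real.rpow_mul_natCast hd0.le, show √b ^ 4 = (√b ^ 2) ^ 2 by ring,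
      Real.sq_sqrt (by linarith), ← Real.rpow_natCast (d : ℝ) 2, ← Real.rpow_sub hd0]
    congr 2; push_cast; ring
  -- If `b = 2q - 1`, take `m = max 4 q`; the factor `2` in `m² ≤ 2 b²` covers `m = 4`, `b = 3`. If
  -- `b` is the logarithmic term, take `m = b`: then `d^(4/m) ≤ e^(1/2) ≤ 2`, so exponents beyond
  -- the order of `log d` cost only a constant.
  obtain ⟨m, hm4, hmb, hmd⟩ : ∃ m : ℝ, 4 ≤ m ∧ m ^ 2 ≤ 2 * b ^ 2 ∧
      max 1 ((d : ℝ) ^ (θ - 1 / m)) ^ 4 * (d : ℝ) ^ (4 / m) ≤ 2 * (d : ℝ) ^ (4 * θ) := by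
    have hpow : ∀ m : ℝ, 0 < m → ((d : ℝ) ^ (θ - 1 / m)) ^ 4 * (d : ℝ) ^ (4 / m) =
        (d : ℝ) ^ (4 * θ) := by
      intro m hm
      rw [← Real.rpow_mul_natCast hd0.le, ← Real.rpow_add hd0]
      congr 1; push_cast; ring
    rcases hcase with ⟨hq, hbq⟩ | hbl
    · have hq2 := two_le_toReal_of_holderConjugate hp1 hp2 hpq hq
      refine ⟨max 4 q.toReal, le_max_left _ _, ?_, ?_⟩
      · rcases max_choice 4 q.toReal with h | h
        · rw [h]; nlinarith
        · rw [h]; nlinarith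
      · have hq0 : θ = 1 / q.toReal := by simp [hθ]
        have h1 : 1 ≤ (d : ℝ) ^ (θ - 1 / max 4 q.toReal) := by
          refine Real.one_le_rpow hd1 ?_
          rw [hq0, sub_nonneg]
          exact one_div_le_one_div_of_le (by linarith) (le_max_right _ _)
        rw [max_eq_right h1, hpow _ (by positivity)]
        have : 0 < (d : ℝ) ^ (4 * θ) := by positivity
        linarith
    · refine ⟨b, by linarith, by nlinarith, ?_⟩
      rcases max_choice 1 ((d : ℝ) ^ (θ - 1 / b)) with h | h
      · rw [h, one_pow, one_mul]
        have h1 : (d : ℝ) ^ (4 / b) ≤ 2 := by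
          rw [Real.rpow_def_of_pos hd0]
          have h2 : Real.log d * (4 / b) ≤ 1 / 2 := by
            rw [mul_div_assoc', div_le_iff₀ (by linarith)]; linarith
          calc Real.exp (Real.log d * (4 / b)) ≤ Real.exp (1 / 2) := Real.exp_le_exp.2 h2
            _ ≤ 2 := by
                have h3 : Real.exp (1 / 2) ^ 2 ≤ 2 ^ 2 := by
                  rw [← Real.exp_nat_mul]
                  have := Real.exp_one_lt_d9
                  norm_num
                  linarith
                exact (pow_le_pow_iff_left₀ (Real.exp_pos _).le (by norm_num) two_ne_zero).1 h3
        have h2 : 1 ≤ (d : ℝ) ^ (4 * θ) := Real.one_le_rpow hd1 (by positivity)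
        linarith
      · rw [h, hpow _ (by linarith)]
        have : 0 < (d : ℝ) ^ (4 * θ) := by positivity
        linarith
  set C := max 1 ((d : ℝ) ^ (θ - 1 / m)) with hC
  refine ⟨m, C, by linarith, lt_of_lt_of_le one_pos (le_max_left _ _),
    abs_inner_le_lmNorm_mul_lpNorm hp1 hp2 hpq (by linarith), ?_⟩
  simp_rw [mul_pow]
  rw [integral_const_mul, haq4]
  have h := integral_lmNorm_pow_four_uniformSphere_le (d := d) (by omega) hm4
  calc C ^ 4 * ∫ e, lmNorm m e ^ 4 ∂(uniformSphere d)
      ≤ C ^ 4 * (16 * m ^ 2 * (d : ℝ) ^ (4 / m) / d ^ 2) :=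
        mul_le_mul_of_nonneg_left h (by positivity)
    _ = 16 * m ^ 2 * (C ^ 4 * (d : ℝ) ^ (4 / m)) / d ^ 2 := by ring
    _ ≤ 16 * (2 * b ^ 2) * (2 * (d : ℝ) ^ (4 * θ)) / d ^ 2 := by gcongr
    _ = _ := by ring

end Norms

end ZORestart

/-! ### Bias and moments of the noisy two-point estimator. -/

namespace ZORestart

section Estimator

variable {d : ℕ}

lemma integrable_uniformSphere_of_continuous (hd : 0 < d) {g : Vec d → ℝ} (hg : Continuous g) :
    Integrable g (uniformSphere d) := by
  have := isProbabilityMeasure_uniformSphere hd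
  obtain ⟨C, hC⟩ := (isCompact_sphere (0 : Vec d) 1).exists_bound_of_continuousOn hg.continuousOn
  refine (integrable_const C).mono' hg.aestronglyMeasurable ?_
  filter_upwards [ae_norm_eq_one_uniformSphere] with e he
  exact hC e (by simpa using he)

lemma convexOn_comp_affine {h : Vec d → ℝ} {S : Set (Vec d)} (hS : ConvexOn ℝ S h) (x : Vec d)
    (c : ℝ) : ConvexOn ℝ {y | x + c • y ∈ S} fun y => h (x + c • y) := by
  have key : ∀ (y z : Vec d) (a b : ℝ), a + b = 1 →
      x + c • (a • y + b • z) = a • (x + c • y) + b • (x + c • z) := by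
    intro y z a b hab
    have : x = (a + b) • x := by rw [hab, one_smul]
    nth_rewrite 1 [this]
    module
  refine ⟨fun y hy z hz a b ha hb hab => ?_, fun y hy z hz a b ha hb hab => ?_⟩
  · rw [Set.mem_ofPred_eq, key y z a b hab]
    exact hS.1 hy hz ha hb hab
  · simp only
    rw [key y z a b hab]
    exact hS.2 hy hz ha hb hab

/-- The subgradient estimate for `y ↦ h (x + c y)` with `v = (x - u) / c`, which places `-v` at `u`.
The scale `c` may have either sign, so that both halves of the two-point estimate are covered. -/
lemma sub_le_integral_shift (hd : 0 < d) {h : Vec d → ℝ} {S : Set (Vec d)} (hS : ConvexOn ℝ S h)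
    {K : ℝ} (hK : 0 ≤ K) (hlip : ∀ x y, |h x - h y| ≤ K * ‖x - y‖) {x u : Vec d} {c : ℝ}
    (hc : c ≠ 0) (hx : ∀ b : Vec d, ‖b‖ ≤ 1 → x + c • b ∈ S)
    (hu : ∀ b : Vec d, ‖b‖ ≤ 1 → u + c • b ∈ S) :
    h x - h u - 2 * (K * |c|) ≤
      d * ∫ e, h (x + c • e) * inner ℝ (c⁻¹ • (x - u)) e ∂(uniformSphere d) := by
  have hL : LipschitzWith (Real.toNNReal (K * |c|)) fun y => h (x + c • y) := by
    refine LipschitzWith.of_dist_le_mul fun y z => ?_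
    rw [Real.dist_eq, Real.coe_toNNReal _ (by positivity), dist_eq_norm, mul_assoc,
      ← Real.norm_eq_abs c, ← norm_smul]
    refine (hlip _ _).trans_eq ?_
    congr 2; module
  have := sub_le_integral_mul_inner_uniformSphere hd hL (convexOn_comp_affine hS x c)
    (v := c⁻¹ • (x - u)) (fun y hy => hx y (by simpa using hy)) (fun y hy => by
      rw [Set.mem_ofPred_eq, smul_sub, smul_smul, mul_inv_cancel₀ hc, one_smul,
        show x + (c • y - (x - u)) = u + c • y by abel]
      exact hu y (by simpa using hy))
  rw [Real.coe_toNNReal _ (by positivity), smul_neg, smul_smul, mul_inv_cancel₀ hc, one_smul,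
    smul_zero, add_zero, show x + -(x - u) = u by abel] at this
  exact this

/-- A noisy two-point estimate is an approximate subgradient in expectation. -/
lemma sub_le_integral_inner_gradEst (hd : 0 < d) {h δ : Vec d → ℝ} {S : Set (Vec d)}
    (hS : ConvexOn ℝ S h) {K Δ τ : ℝ} (hK : 0 ≤ K) (hτ : 0 < τ) (hΔ : 0 ≤ Δ)
    (hlip : ∀ x y, |h x - h y| ≤ K * ‖x - y‖) {x u : Vec d}
    (hx : ∀ b : Vec d, ‖b‖ ≤ 1 → x + τ • b ∈ S) (hu : ∀ b : Vec d, ‖b‖ ≤ 1 → u + τ • b ∈ S)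
    (hδm : Measurable δ) (hδ : ∀ b : Vec d, ‖b‖ ≤ 1 → |δ (x + τ • b)| ≤ Δ) :
    h x - h u - 2 * K * τ - 2 * √d * Δ / τ * ‖x - u‖ ≤
      ∫ e, inner ℝ (gradEst (fun y => h y + δ y) τ x e) (x - u) ∂(uniformSphere d) := by
  have hprob := isProbabilityMeasure_uniformSphere hd
  have hd0 : (0 : ℝ) < d := by exact_mod_cast hd
  set v := x - u with hv
  have hcont : Continuous h := by
    have : LipschitzWith (Real.toNNReal K) h := LipschitzWith.of_dist_le_mul fun y z => by
      rw [Real.dist_eq, dist_eq_norm, Real.coe_toNNReal _ hK]; exact hlip y z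
    exact this.continuous
  have h1 := sub_le_integral_shift hd hS hK hlip hτ.ne' hx hu
  have h2 := sub_le_integral_shift hd hS hK hlip (neg_ne_zero.2 hτ.ne')
    (x := x) (u := u) (fun b hb => by simpa using hx (-b) (by simpa using hb))
    (fun b hb => by simpa using hu (-b) (by simpa using hb))
  rw [abs_of_pos hτ] at h1
  rw [abs_neg, abs_of_pos hτ] at h2
  have hi1 : Integrable (fun e => h (x + τ • e) * inner ℝ (τ⁻¹ • v) e) (uniformSphere d) :=
    integrable_uniformSphere_of_continuous hd (by fun_prop)
  have hi2 : Integrable (fun e => h (x + (-τ) • e) * inner ℝ ((-τ)⁻¹ • v) e) (uniformSphere d) :=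
    integrable_uniformSphere_of_continuous hd (by fun_prop)
  set nz : Vec d → ℝ := fun e =>
    (d : ℝ) / (2 * τ) * (δ (x + τ • e) - δ (x - τ • e)) * inner ℝ e v with hnz
  have hnzm : Measurable nz := by
    have a1 : Measurable fun e : Vec d => δ (x + τ • e) := hδm.comp (by fun_prop)
    have a2 : Measurable fun e : Vec d => δ (x - τ • e) := hδm.comp (by fun_prop)
    exact ((a1.sub a2).const_mul _).mul (by fun_prop)
  have hnzb : ∀ᵐ e ∂(uniformSphere d), |nz e| ≤ d * Δ / τ * |inner ℝ v e| := by
    filter_upwards [ae_norm_eq_one_uniformSphere] with e he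
    have b1 := abs_le.1 (hδ e he.le)
    have b2 := abs_le.1 (hδ (-e) (by simpa using he.le))
    rw [smul_neg, ← sub_eq_add_neg] at b2
    rw [hnz]
    simp only
    rw [abs_mul, abs_mul, real_inner_comm, abs_of_nonneg (by positivity : 0 ≤ (d : ℝ) / (2 * τ))]
    refine mul_le_mul_of_nonneg_right ?_ (abs_nonneg _)
    calc (d : ℝ) / (2 * τ) * |δ (x + τ • e) - δ (x - τ • e)| ≤ (d : ℝ) / (2 * τ) * (2 * Δ) := by
          refine mul_le_mul_of_nonneg_left ?_ (by positivity)
          rw [abs_le]; constructor <;> linarith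
      _ = _ := by field_simp
  have habsI : Integrable (fun e => |inner ℝ v e|) (uniformSphere d) :=
    integrable_uniformSphere_of_continuous hd (by fun_prop)
  have hnzI : Integrable nz (uniformSphere d) :=
    (habsI.const_mul (d * Δ / τ)).mono' hnzm.aestronglyMeasurable hnzb
  -- The two-point estimate is the mean of the one-point estimates with steps `τ` and `-τ`, plus the
  -- contribution `nz` of the noise.
  have hsplit : ∀ e, inner ℝ (gradEst (fun y => h y + δ y) τ x e) v =
      (d / 2 * (h (x + τ • e) * inner ℝ (τ⁻¹ • v) e) +
        d / 2 * (h (x + (-τ) • e) * inner ℝ ((-τ)⁻¹ • v) e)) + nz e := by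
    intro e
    simp only [gradEst, hnz, real_inner_smul_left, neg_smul, ← sub_eq_add_neg,
      real_inner_comm v e, inv_neg, inner_neg_left]
    field_simp
    ring
  -- Replaces Cauchy–Schwarz by `|y| ≤ a + y² / a` at the root mean square `a = ‖v‖ / √d`. Pairing
  -- the noise with a fixed vector costs `√d`, not `d`.
  have habs : ∫ e, |inner ℝ v e| ∂(uniformSphere d) ≤ 2 * (‖v‖ / √d) := by
    rcases eq_or_ne v 0 with h0 | h0
    · simp [h0]
    have hvn : 0 < ‖v‖ := norm_pos_iff.2 h0
    set a := ‖v‖ / √d with ha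
    have hapos : 0 < a := by positivity
    have hsqI : Integrable (fun e => (inner ℝ v e) ^ 2) (uniformSphere d) :=
      integrable_uniformSphere_of_continuous hd (by fun_prop)
    calc ∫ e, |inner ℝ v e| ∂(uniformSphere d)
        ≤ ∫ e, (a + (inner ℝ v e) ^ 2 / a) ∂(uniformSphere d) := by
          refine integral_mono habsI ((integrable_const a).add (hsqI.div_const a)) fun e => ?_
          have : |inner ℝ v e| ≤ a + |inner ℝ v e| ^ 2 / a := by
            rw [← sub_le_iff_le_add', le_div_iff₀ hapos]
            nlinarith [sq_nonneg (|inner ℝ v e| - a), sq_nonneg (|inner ℝ v e|), sq_nonneg a]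
          simpa using this
      _ = a + ‖v‖ ^ 2 / d / a := by
          rw [integral_add (integrable_const a) (hsqI.div_const a), integral_div a,
            integral_inner_sq_uniformSphere hd]
          simp
      _ = 2 * a := by
          have hs : √(d : ℝ) ^ 2 = d := Real.sq_sqrt hd0.le
          rw [ha, ← hs, Real.sqrt_sq (Real.sqrt_nonneg _)]
          have : √(d : ℝ) ≠ 0 := by positivity
          field_simp; ring
  have hnzint : -(2 * √d * Δ / τ * ‖v‖) ≤ ∫ e, nz e ∂(uniformSphere d) := by
    have h3 : |∫ e, nz e ∂(uniformSphere d)| ≤ d * Δ / τ * (2 * (‖v‖ / √d)) := by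
      refine (abs_integral_le_integral_abs).trans ?_
      refine (integral_mono_ae hnzI.abs (habsI.const_mul _) hnzb).trans ?_
      rw [integral_const_mul]
      exact mul_le_mul_of_nonneg_left habs (by positivity)
    have h4 : d * Δ / τ * (2 * (‖v‖ / √d)) = 2 * √d * Δ / τ * ‖v‖ := by
      have hs : √(d : ℝ) ^ 2 = d := Real.sq_sqrt hd0.le
      have : √(d : ℝ) ≠ 0 := by positivity
      field_simp
      rw [hs]
      ring
    rw [h4] at h3
    exact (abs_le.1 h3).1
  simp_rw [hsplit]
  have hi12 : Integrable (fun e => d / 2 * (h (x + τ • e) * inner ℝ (τ⁻¹ • v) e) +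
      d / 2 * (h (x + (-τ) • e) * inner ℝ ((-τ)⁻¹ • v) e)) (uniformSphere d) :=
    (hi1.const_mul _).add (hi2.const_mul _)
  rw [integral_add hi12 hnzI, integral_add (hi1.const_mul _) (hi2.const_mul _), integral_const_mul, integral_const_mul]
  linarith

lemma rpow_le_one_add_pow_four {y θ : ℝ} (hy : 0 ≤ y) (hθ0 : 0 ≤ θ) (hθ : θ ≤ 4) :
    y ^ θ ≤ 1 + y ^ 4 := by
  rcases le_total y 1 with h | h
  · have := Real.rpow_le_one hy h hθ0
    have : 0 ≤ y ^ 4 := by positivity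
    linarith
  · have h1 := Real.rpow_le_rpow_of_exponent_le h hθ
    rw [show (4 : ℝ) = (4 : ℕ) by norm_num, Real.rpow_natCast] at h1
    linarith

/-- A pointwise substitute for Cauchy–Schwarz: the moment of a product is reduced to the fourth
moments of its factors. -/
lemma rpow_mul_le_one_add {y z θ : ℝ} (hy : 0 ≤ y) (hz : 0 ≤ z) (hθ0 : 0 ≤ θ) (hθ : θ ≤ 2) :
    (y * z) ^ θ ≤ 1 + (y ^ 4 / 2 + z ^ 4 / 2) := by
  have h2 : (y * z) ^ 2 ≤ y ^ 4 / 2 + z ^ 4 / 2 := by nlinarith [sq_nonneg (y ^ 2 - z ^ 2)]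
  have hyz : 0 ≤ y * z := by positivity
  rcases le_total (y * z) 1 with h | h
  · have := Real.rpow_le_one hyz h hθ0
    nlinarith [sq_nonneg (y * z)]
  · have h1 := Real.rpow_le_rpow_of_exponent_le h hθ
    rw [show (2 : ℝ) = (2 : ℕ) by norm_num, Real.rpow_natCast] at h1
    linarith

lemma rpow_add_le_two_mul {a b θ : ℝ} (ha : 0 ≤ a) (hb : 0 ≤ b) (hθ1 : 1 ≤ θ) (hθ : θ ≤ 2) :
    (a + b) ^ θ ≤ 2 * (a ^ θ + b ^ θ) := by
  have h : (a + b) ^ θ ≤ (2 : ℝ) ^ (θ - 1) * (a ^ θ + b ^ θ) := by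
    lift a to NNReal using ha
    lift b to NNReal using hb
    exact_mod_cast NNReal.rpow_add_le_mul_rpow_add_rpow a b hθ1
  refine h.trans (mul_le_mul_of_nonneg_right ?_ (by positivity))
  calc (2 : ℝ) ^ (θ - 1) ≤ 2 ^ (1 : ℝ) :=
        Real.rpow_le_rpow_of_exponent_le (by norm_num) (by linarith)
    _ = 2 := Real.rpow_one 2

lemma mul_rpow_le_sq_mul {c x θ : ℝ} (hc : 1 ≤ c) (hx : 0 ≤ x) (hθ : θ ≤ 2) :
    (c * x) ^ θ ≤ c ^ 2 * x ^ θ := by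
  rw [Real.mul_rpow (by linarith) hx]
  refine mul_le_mul_of_nonneg_right ?_ (by positivity)
  have := Real.rpow_le_rpow_of_exponent_le hc hθ
  rwa [show (2 : ℝ) = (2 : ℕ) by norm_num, Real.rpow_natCast] at this

/-- The `(1 + κ)`-th moment of the noisy two-point estimate, in a norm with fourth moment of order
`a⁴` on the sphere. -/
lemma integral_gradEst_rpow_le (hd : 0 < d) {h δ : Vec d → ℝ} {K Δ τ θ a m C : ℝ}
    (hK : 0 < K) (hτ : 0 < τ) (hΔ : 0 ≤ Δ) (hθ1 : 1 ≤ θ) (hθ2 : θ ≤ 2) (ha : 0 < a)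
    (hm : 0 < m) (hC : 0 < C) (hNa : ∫ e, (C * lmNorm m e) ^ 4 ∂(uniformSphere d) ≤ 64 * a ^ 4)
    (hlip : ∀ x y, |h x - h y| ≤ K * ‖x - y‖) {x : Vec d}
    (hδ : ∀ b : Vec d, ‖b‖ ≤ 1 → |δ (x + τ • b)| ≤ Δ) :
    ∫ e, (C * lmNorm m (gradEst (fun y => h y + δ y) τ x e)) ^ θ ∂(uniformSphere d) ≤
      10000 * ((√d * a * K) ^ θ + (d * a * Δ / τ) ^ θ) := by
  have hprob := isProbabilityMeasure_uniformSphere hd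
  have hd0 : (0 : ℝ) < d := by exact_mod_cast hd
  have hsd : 0 < √(d : ℝ) := by positivity
  have hlipW : LipschitzWith (Real.toNNReal (K * τ)) fun y => h (x + τ • y) := by
    refine LipschitzWith.of_dist_le_mul fun y z => ?_
    rw [Real.dist_eq, Real.coe_toNNReal _ (by positivity), dist_eq_norm, mul_assoc]
    refine (hlip _ _).trans_eq ?_
    rw [show x + τ • y - (x + τ • z) = τ • (y - z) by module, norm_smul, Real.norm_of_nonneg hτ.le]
  have hconc := integral_sub_neg_pow_four_uniformSphere_le hd hlipW
  rw [Real.coe_toNNReal _ (by positivity)] at hconc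
  set Dh : Vec d → ℝ := fun e => h (x + τ • e) - h (x + τ • (-e)) with hDh
  set N : Vec d → ℝ := fun e => C * lmNorm m e with hN
  have hNc : Continuous N := (continuous_lmNorm hm).const_smul C
  have hN0 : ∀ e, 0 ≤ N e := fun e => mul_nonneg hC.le (lmNorm_nonneg _ _)
  have hDc : Continuous Dh :=
    hlipW.continuous.sub (hlipW.continuous.comp continuous_neg)
  -- `β` and `3 a` normalize the two factors to fourth moment at most one, since `128 (3π)⁴ ≤ 32⁴`
  -- and `64 ≤ 3⁴`. With the prefactor `d / (2τ)` of the estimate they produce `48 = 32 · 3 / 2`.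
  set β := 32 * (K * τ) / √d with hβ
  have hβ0 : 0 < β := by positivity
  have hβ4 : ∫ e, (Dh e / β) ^ 4 ∂(uniformSphere d) ≤ 1 := by
    simp_rw [div_pow]
    rw [integral_div, div_le_one (by positivity)]
    refine hconc.trans ?_
    rw [hβ, div_pow, show √(d : ℝ) ^ 4 = (√d ^ 2) ^ 2 by ring, Real.sq_sqrt hd0.le, mul_pow 32]
    have hpi : (3 * Real.pi) ^ 4 ≤ 8000 := by
      have h1 : 3 * Real.pi ≤ 9.43 := by linarith [Real.pi_lt_d2, Real.pi_lt_d4]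
      calc (3 * Real.pi) ^ 4 ≤ 9.43 ^ 4 := by gcongr
        _ ≤ 8000 := by norm_num
    refine div_le_div_of_nonneg_right ?_ (by positivity)
    refine mul_le_mul_of_nonneg_right ?_ (by positivity)
    norm_num at hpi ⊢
    linarith
  have hc4 : ∫ e, (N e / (3 * a)) ^ 4 ∂(uniformSphere d) ≤ 1 := by
    simp_rw [div_pow]
    rw [integral_div, div_le_one (by positivity)]
    refine hNa.trans ?_
    nlinarith [pow_pos ha 4]
  have hβI : Integrable (fun e => (Dh e / β) ^ 4) (uniformSphere d) :=
    integrable_uniformSphere_of_continuous hd (by fun_prop)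
  have hcI : Integrable (fun e => (N e / (3 * a)) ^ 4) (uniformSphere d) :=
    integrable_uniformSphere_of_continuous hd (by fun_prop)
  set P := (48 * (√d * a * K)) ^ θ with hP
  set Q := (3 * (d * a * Δ / τ)) ^ θ with hQ
  have hP0 : 0 ≤ P := by positivity
  have hQ0 : 0 ≤ Q := by positivity
  have hpt : ∀ᵐ e ∂(uniformSphere d),
      (C * lmNorm m (gradEst (fun y => h y + δ y) τ x e)) ^ θ ≤
        2 * (P * (1 + ((Dh e / β) ^ 4 / 2 + (N e / (3 * a)) ^ 4 / 2)) +
          Q * (1 + (N e / (3 * a)) ^ 4)) := by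
    filter_upwards [ae_norm_eq_one_uniformSphere] with e he
    have b1 := abs_le.1 (hδ e he.le)
    have b2 := abs_le.1 (hδ (-e) (by simpa using he.le))
    have hle : C * lmNorm m (gradEst (fun y => h y + δ y) τ x e) ≤
        d / (2 * τ) * |Dh e| * N e + d * Δ / τ * N e := by
      rw [gradEst, lmNorm_smul hm, show x - τ • e = x + τ • (-e) by rw [smul_neg]; abel]
      have hsum : |h (x + τ • e) + δ (x + τ • e) - (h (x + τ • -e) + δ (x + τ • -e))| ≤
          |Dh e| + 2 * Δ := by
        have : h (x + τ • e) + δ (x + τ • e) - (h (x + τ • -e) + δ (x + τ • -e)) =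
            Dh e + (δ (x + τ • e) - δ (x + τ • -e)) := by rw [hDh]; ring
        rw [this]
        refine (abs_add_le _ _).trans (add_le_add_right ?_ _)
        rw [abs_le]; constructor <;> linarith
      rw [abs_mul, abs_of_nonneg (by positivity : 0 ≤ (d : ℝ) / (2 * τ))]
      calc C * ((d : ℝ) / (2 * τ) * |h (x + τ • e) + δ (x + τ • e) -
            (h (x + τ • -e) + δ (x + τ • -e))| * lmNorm m e)
          = (d : ℝ) / (2 * τ) * |h (x + τ • e) + δ (x + τ • e) -
            (h (x + τ • -e) + δ (x + τ • -e))| * N e := by rw [hN]; ring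
        _ ≤ (d : ℝ) / (2 * τ) * (|Dh e| + 2 * Δ) * N e :=
            mul_le_mul_of_nonneg_right (mul_le_mul_of_nonneg_left hsum (by positivity)) (hN0 e)
        _ = _ := by field_simp
    have hA : (d / (2 * τ) * |Dh e| * N e) ^ θ ≤
        P * (1 + ((Dh e / β) ^ 4 / 2 + (N e / (3 * a)) ^ 4 / 2)) := by
      have e1 : d / (2 * τ) * |Dh e| * N e =
          (48 * (√d * a * K)) * ((|Dh e| / β) * (N e / (3 * a))) := by
        rw [hβ]
        have hs : (d : ℝ) = √d * √d := (Real.mul_self_sqrt hd0.le).symm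
        field_simp
        rw [sq, ← hs]
        ring
      rw [e1, Real.mul_rpow (by positivity)
        (mul_nonneg (by positivity) (div_nonneg (hN0 e) (by positivity)))]
      refine mul_le_mul_of_nonneg_left ?_ hP0
      have := rpow_mul_le_one_add (y := |Dh e| / β) (z := N e / (3 * a)) (θ := θ) (by positivity)
        (div_nonneg (hN0 e) (by positivity)) (by linarith) hθ2
      rwa [div_pow |Dh e|, Even.pow_abs (by decide), ← div_pow] at this
    have hB : (d * Δ / τ * N e) ^ θ ≤ Q * (1 + (N e / (3 * a)) ^ 4) := by
      have e1 : d * Δ / τ * N e = (3 * (d * a * Δ / τ)) * (N e / (3 * a)) := by field_simp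
      rw [e1, Real.mul_rpow (by positivity) (div_nonneg (hN0 e) (by positivity))]
      refine mul_le_mul_of_nonneg_left ?_ hQ0
      exact rpow_le_one_add_pow_four (div_nonneg (hN0 e) (by positivity)) (by linarith)
        (by linarith)
    have hgn : 0 ≤ C * lmNorm m (gradEst (fun y => h y + δ y) τ x e) :=
      mul_nonneg hC.le (lmNorm_nonneg _ _)
    refine (Real.rpow_le_rpow hgn hle (by linarith)).trans ?_
    refine (rpow_add_le_two_mul (mul_nonneg (by positivity) (hN0 e))
      (mul_nonneg (by positivity) (hN0 e)) hθ1 hθ2).trans ?_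
    linarith
  have hI0 : Integrable (fun e => (Dh e / β) ^ 4 / 2 + (N e / (3 * a)) ^ 4 / 2)
      (uniformSphere d) := (hβI.div_const 2).add (hcI.div_const 2)
  have hI1 : Integrable (fun e => P * (1 + ((Dh e / β) ^ 4 / 2 + (N e / (3 * a)) ^ 4 / 2)))
      (uniformSphere d) :=
    ((integrable_const 1).add hI0).const_mul P
  have hI2 : Integrable (fun e => Q * (1 + (N e / (3 * a)) ^ 4)) (uniformSphere d) :=
    ((integrable_const 1).add hcI).const_mul Q
  calc ∫ e, (C * lmNorm m (gradEst (fun y => h y + δ y) τ x e)) ^ θ ∂(uniformSphere d)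
      ≤ ∫ e, 2 * (P * (1 + ((Dh e / β) ^ 4 / 2 + (N e / (3 * a)) ^ 4 / 2)) +
          Q * (1 + (N e / (3 * a)) ^ 4)) ∂(uniformSphere d) := by
        refine integral_mono_of_nonneg (Filter.Eventually.of_forall fun e => ?_)
          ((hI1.add hI2).const_mul 2) hpt
        exact Real.rpow_nonneg (mul_nonneg hC.le (lmNorm_nonneg _ _)) _
    _ = 2 * (P * (1 + ((∫ e, (Dh e / β) ^ 4 ∂(uniformSphere d)) / 2 +
          (∫ e, (N e / (3 * a)) ^ 4 ∂(uniformSphere d)) / 2)) +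
          Q * (1 + ∫ e, (N e / (3 * a)) ^ 4 ∂(uniformSphere d))) := by
        rw [integral_const_mul, integral_add hI1 hI2, integral_const_mul, integral_const_mul,
          integral_add (integrable_const 1) hI0,
          integral_add (hβI.div_const 2) (hcI.div_const 2),
          integral_add (integrable_const 1) hcI, integral_div, integral_div]
        simp
    _ ≤ 2 * (P * 2 + Q * 2) := by
        have : P * (1 + ((∫ e, (Dh e / β) ^ 4 ∂(uniformSphere d)) / 2 +
          (∫ e, (N e / (3 * a)) ^ 4 ∂(uniformSphere d)) / 2)) ≤ P * 2 :=
          mul_le_mul_of_nonneg_left (by linarith) hP0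
        have : Q * (1 + ∫ e, (N e / (3 * a)) ^ 4 ∂(uniformSphere d)) ≤ Q * 2 :=
          mul_le_mul_of_nonneg_left (by linarith) hQ0
        linarith
    _ ≤ 10000 * ((√d * a * K) ^ θ + (d * a * Δ / τ) ^ θ) := by
        have p1 := mul_rpow_le_sq_mul (c := 48) (x := √d * a * K) (θ := θ) (by norm_num)
          (by positivity) hθ2
        have p2 := mul_rpow_le_sq_mul (c := 3) (x := d * a * Δ / τ) (θ := θ) (by norm_num)
          (by positivity) hθ2
        have p3 : 0 ≤ (√d * a * K) ^ θ := by positivity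
        have p4 : 0 ≤ (d * a * Δ / τ) ^ θ := by positivity
        rw [hP, hQ]
        linarith

end Estimator

end ZORestart

/-! ### Bregman divergences and the mirror descent step. -/

namespace ZORestart

section Prox

variable {d : ℕ}

open scoped Topology

lemma gradient_translate (Ψ : Vec d → ℝ) (c x : Vec d) :
    gradient (fun y => Ψ (y + c)) x = gradient Ψ (x + c) := by
  simp only [gradient]
  rw [fderiv_comp_add_right]

lemma recentre_eq (Ψ : Vec d → ℝ) (x₀ w : Vec d) :
    recentre Ψ x₀ w = fun y => Ψ (y + (x₀ - w)) := by
  ext y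
  rw [recentre]
  congr 1; abel

lemma gradient_recentre (Ψ : Vec d → ℝ) (x₀ w x : Vec d) :
    gradient (recentre Ψ x₀ w) x = gradient Ψ (x - w + x₀) := by
  rw [recentre_eq, gradient_translate]
  congr 1; abel

lemma bregman_recentre (Ψ : Vec d → ℝ) (x₀ w y x : Vec d) :
    bregman (recentre Ψ x₀ w) y x = bregman Ψ (y - w + x₀) (x - w + x₀) := by
  rw [bregman, bregman, gradient_recentre]
  simp only [recentre]
  congr 2; abel

lemma UniformlyConvex.recentre {p : ENNReal} {K s : ℝ} {Ψ : Vec d → ℝ}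
    (h : UniformlyConvex p K s Ψ) (x₀ w : Vec d) :
    UniformlyConvex p K s (ZORestart.recentre Ψ x₀ w) where
  differentiable := by
    rw [recentre_eq]
    exact h.differentiable.comp (differentiable_id.add_const _)
  convex := by
    rw [recentre_eq]
    have := h.convex.translate_left (x₀ - w)
    simpa [Function.comp_def] using this
  lower x y := by
    rw [bregman_recentre]
    have := h.lower (x - w + x₀) (y - w + x₀)
    rwa [show x - w + x₀ - (y - w + x₀) = x - y by abel] at this

/-- The three-point identity for Bregman divergences. -/
lemma bregman_three_point (Φ : Vec d → ℝ) (u x z : Vec d) :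
    bregman Φ u x - bregman Φ u z - bregman Φ z x =
      inner ℝ (gradient Φ z - gradient Φ x) (u - z) := by
  simp only [bregman, inner_sub_left, inner_sub_right]
  ring

lemma bregman_sub_eq (Φ : Vec d → ℝ) (u z y : Vec d) :
    bregman Φ u y - bregman Φ z y =
      (Φ u - inner ℝ (gradient Φ y) u) - (Φ z - inner ℝ (gradient Φ y) z) := by
  simp only [bregman, inner_sub_right]
  ring

variable {p : ENNReal} {κ : ℝ}

lemma one_lt_sExp (hκ : 0 < κ) : 1 < (1 + κ) / κ := by
  rw [lt_div_iff₀ hκ]; linarith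

lemma two_le_sExp (hκ : 0 < κ) (hκ1 : κ ≤ 1) : 2 ≤ (1 + κ) / κ := by
  rw [le_div_iff₀ hκ]; linarith

lemma holderConjugate_sExp (hκ : 0 < κ) : ((1 + κ) / κ).HolderConjugate (1 + κ) := by
  rw [Real.holderConjugate_iff]
  refine ⟨one_lt_sExp hκ, ?_⟩
  have : 1 + κ ≠ 0 := by positivity
  field_simp
  ring

lemma UniformlyConvex.norm_rpow_le_bregman {s : ℝ} (hs : 0 < s) (hp1 : 1 ≤ p) (hp2 : p ≤ 2)
    {Φ : Vec d → ℝ} (h : UniformlyConvex p 1 s Φ) (x y : Vec d) :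
    1 / s * ‖x - y‖ ^ s ≤ bregman Φ y x :=
  le_trans (mul_le_mul_of_nonneg_left
    (Real.rpow_le_rpow (norm_nonneg _) (norm_le_lpNorm hp1 hp2 _) hs.le) (by positivity))
    (h.lower x y)

/-- Uniform convexity of order at least `2` makes `Φ - ⟨v, ·⟩` coercive, and `Φ` has gradient `v` at
its minimizer. -/
lemma exists_gradient_eq (hκ : 0 < κ) (hκ1 : κ ≤ 1) (hp1 : 1 ≤ p) (hp2 : p ≤ 2) {Φ : Vec d → ℝ}
    (h : UniformlyConvex p 1 ((1 + κ) / κ) Φ) (v : Vec d) : ∃ y, gradient Φ y = v := by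
  set s := (1 + κ) / κ with hs
  have hs2 : 2 ≤ s := two_le_sExp hκ hκ1
  have hs0 : 0 < s := by linarith
  set G : Vec d → ℝ := fun x => Φ x - inner ℝ v x with hG
  have hGd : Differentiable ℝ G := h.differentiable.sub (innerSL ℝ v).differentiable
  set c := ‖gradient Φ 0 - v‖ with hc
  have hlow : ∀ x, (Φ 0 - 1 / s) + ‖x‖ * (1 / s * ‖x‖ - c) ≤ G x := by
    intro x
    have h1 := h.norm_rpow_le_bregman hs0 hp1 hp2 0 x
    rw [zero_sub, norm_neg, bregman, sub_zero] at h1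
    have h2 : ‖x‖ ^ 2 - 1 ≤ ‖x‖ ^ s := by
      rcases le_total ‖x‖ 1 with hx | hx
      · have : 0 ≤ ‖x‖ ^ s := by positivity
        nlinarith [norm_nonneg x]
      · have := Real.rpow_le_rpow_of_exponent_le hx hs2
        rw [show (2 : ℝ) = (2 : ℕ) by norm_num, Real.rpow_natCast] at this
        linarith
    have h3 : -(c * ‖x‖) ≤ inner ℝ (gradient Φ 0 - v) x := by
      have := abs_real_inner_le_norm (gradient Φ 0 - v) x
      exact (abs_le.1 this).1
    rw [inner_sub_left] at h3
    have h4 := mul_le_mul_of_nonneg_left h2 (by positivity : 0 ≤ 1 / s)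
    rw [hG]
    simp only
    nlinarith
  have htend : Filter.Tendsto G (Filter.cocompact (Vec d)) Filter.atTop := by
    refine Filter.tendsto_atTop_mono hlow ?_
    have hn := tendsto_norm_cocompact_atTop (E := Vec d)
    refine Filter.tendsto_atTop_add_const_left _ _ (hn.atTop_mul_atTop₀ ?_)
    exact Filter.tendsto_atTop_add_const_right _ _ (hn.const_mul_atTop (by positivity))
  obtain ⟨y, hy⟩ := hGd.continuous.exists_forall_le htend
  refine ⟨y, ?_⟩
  have hmin : IsLocalMin G y := Filter.Eventually.of_forall hy
  have hz := hmin.fderiv_eq_zero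
  have hd2 : fderiv ℝ G y = fderiv ℝ Φ y - innerSL ℝ v := by
    have := (h.differentiable y).hasFDerivAt.sub (innerSL ℝ v).hasFDerivAt
    exact this.fderiv
  rw [hd2, sub_eq_zero] at hz
  rw [gradient, hz]
  exact (InnerProductSpace.toDual ℝ (Vec d)).symm_apply_apply v

/-- By Young's inequality the conjugate lies between an affine function of slope `y` and the same
function plus `‖w - v‖^(1+κ) / (1+κ)`; as `κ > 0`, it is differentiable at `v`. The upper bound also
ensures that the real supremum is a genuine one. -/
lemma gradient_fenchel (hκ : 0 < κ) (hp1 : 1 ≤ p) (hp2 : p ≤ 2) {Φ : Vec d → ℝ}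
    (h : UniformlyConvex p 1 ((1 + κ) / κ) Φ) {y v : Vec d} (hy : gradient Φ y = v) :
    gradient (fenchel Φ) v = y := by
  set s := (1 + κ) / κ with hs
  have hs1 : 1 < s := one_lt_sExp hκ
  have hs0 : 0 < s := by linarith
  have hconj := holderConjugate_sExp hκ
  have hpt : ∀ w x : Vec d, inner ℝ x w - Φ x ≤
      (inner ℝ y v - Φ y) + inner ℝ y (w - v) + ‖w - v‖ ^ (1 + κ) / (1 + κ) := by
    intro w x
    have h1 := h.norm_rpow_le_bregman hs0 hp1 hp2 y x
    rw [bregman, hy] at h1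
    have h2 := Real.young_inequality_of_nonneg (norm_nonneg (y - x)) (norm_nonneg (w - v)) hconj
    have h3 : inner ℝ (x - y) (w - v) ≤ ‖y - x‖ * ‖w - v‖ := by
      rw [norm_sub_rev]
      exact real_inner_le_norm _ _
    rw [← hs] at h2
    have h4 : inner ℝ x w - Φ x = (inner ℝ y v - Φ y) + inner ℝ y (w - v) +
        inner ℝ (x - y) (w - v) - (Φ x - Φ y - inner ℝ v (x - y)) := by
      simp only [inner_sub_left, inner_sub_right, real_inner_comm v]
      ring
    have h5 : 1 / s * ‖y - x‖ ^ s = ‖y - x‖ ^ s / s := by ring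
    linarith
  have hbdd : ∀ w : Vec d, BddAbove (Set.range fun x : Vec d => inner ℝ x w - Φ x) := fun w =>
    ⟨_, by rintro _ ⟨x, rfl⟩; exact hpt w x⟩
  have hup : ∀ w, fenchel Φ w ≤
      (inner ℝ y v - Φ y) + inner ℝ y (w - v) + ‖w - v‖ ^ (1 + κ) / (1 + κ) := fun w =>
    ciSup_le (hpt w)
  have hlo : ∀ w : Vec d, (inner ℝ y v - Φ y) + inner ℝ y (w - v) ≤ fenchel Φ w := by
    intro w
    refine le_trans (le_of_eq ?_) (le_ciSup (hbdd w) y)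
    rw [inner_sub_right]; ring
  have hval : fenchel Φ v = inner ℝ y v - Φ y := by
    refine le_antisymm ?_ ?_
    · have := hup v
      simpa [Real.zero_rpow (by positivity : 1 + κ ≠ 0)] using this
    · simpa using hlo v
  have hder : HasGradientAt (fenchel Φ) y v := by
    rw [hasGradientAt_iff_isLittleO]
    have hbig : (fun w => fenchel Φ w - fenchel Φ v - inner ℝ y (w - v)) =O[𝓝 v]
        fun w => ‖w - v‖ ^ κ * ‖w - v‖ := by
      refine Asymptotics.IsBigO.of_bound 1 (Filter.Eventually.of_forall fun w => ?_)
      have h1 := hup w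
      have h2 := hlo w
      have h3 : ‖w - v‖ ^ κ * ‖w - v‖ = ‖w - v‖ ^ (1 + κ) := by
        rw [add_comm, Real.rpow_add_one' (norm_nonneg _) (by positivity)]
      have h4 : ‖w - v‖ ^ (1 + κ) / (1 + κ) ≤ ‖w - v‖ ^ (1 + κ) :=
        div_le_self (by positivity) (by linarith)
      rw [h3, hval, Real.norm_eq_abs, Real.norm_of_nonneg (by positivity : 0 ≤ ‖w - v‖ ^ (1 + κ)),
        one_mul, abs_le]
      have h5 : 0 ≤ ‖w - v‖ ^ (1 + κ) := by positivity
      constructor <;> linarith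
    refine hbig.trans_isLittleO ?_
    have hlit : (fun w : Vec d => ‖w - v‖ ^ κ) =o[𝓝 v] fun _ => (1 : ℝ) := by
      rw [Asymptotics.isLittleO_one_iff]
      have : Filter.Tendsto (fun w : Vec d => ‖w - v‖ ^ κ) (𝓝 v) (𝓝 (‖v - v‖ ^ κ)) :=
        (Continuous.rpow_const (by fun_prop) fun _ => Or.inr hκ.le).tendsto v
      simpa [Real.zero_rpow hκ.ne'] using this
    have := hlit.mul_isBigO (Asymptotics.isBigO_refl (fun w : Vec d => ‖w - v‖) (𝓝 v))
    simp only [one_mul] at this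
    exact this.of_norm_right
  exact hder.gradient

/-- `x` is a Bregman-type minimizer: it minimizes `Φ - ⟨v, ·⟩` over `X`. -/
def IsLinMin (X : Set (Vec d)) (Φ : Vec d → ℝ) (v x : Vec d) : Prop :=
  x ∈ X ∧ ∀ u ∈ X, Φ x - inner ℝ v x ≤ Φ u - inner ℝ v u

lemma IsLinMin.inner_nonneg {X : Set (Vec d)} (hX : Convex ℝ X) {Φ : Vec d → ℝ}
    (hΦ : Differentiable ℝ Φ) {v x u : Vec d} (h : IsLinMin X Φ v x) (hu : u ∈ X) :
    0 ≤ inner ℝ (gradient Φ x - v) (u - x) := by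
  have hmin : IsLocalMinOn (fun z => Φ z - inner ℝ v z) X x :=
    IsMinOn.localize fun z hz => h.2 z hz
  have hder : HasFDerivWithinAt (fun z => Φ z - inner ℝ v z) (fderiv ℝ Φ x - innerSL ℝ v) X x :=
    ((hΦ x).hasFDerivAt.sub (innerSL ℝ v).hasFDerivAt).hasFDerivWithinAt
  have := hmin.hasFDerivWithinAt_nonneg hder
    (sub_mem_posTangentConeAt_of_segment_subset (hX.segment_subset h.1 hu))
  simpa [gradient, inner_sub_left] using this

lemma IsLinMin.add_rpow_le {X : Set (Vec d)} (hX : Convex ℝ X) {s : ℝ} (hs : 0 < s)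
    (hp1 : 1 ≤ p) (hp2 : p ≤ 2) {Φ : Vec d → ℝ} (hΦ : UniformlyConvex p 1 s Φ) {v x u : Vec d}
    (h : IsLinMin X Φ v x) (hu : u ∈ X) :
    Φ x - inner ℝ v x + 1 / s * ‖x - u‖ ^ s ≤ Φ u - inner ℝ v u := by
  have h1 := h.inner_nonneg hX hΦ.differentiable hu
  have h2 := hΦ.norm_rpow_le_bregman hs hp1 hp2 x u
  rw [bregman] at h2
  rw [inner_sub_left, inner_sub_right v] at h1
  linarith

lemma IsLinMin.unique {X : Set (Vec d)} (hX : Convex ℝ X) {s : ℝ} (hs : 0 < s)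
    (hp1 : 1 ≤ p) (hp2 : p ≤ 2) {Φ : Vec d → ℝ} (hΦ : UniformlyConvex p 1 s Φ) {v x u : Vec d}
    (h : IsLinMin X Φ v x) (h' : IsLinMin X Φ v u) : x = u := by
  have h1 := h.add_rpow_le hX hs hp1 hp2 hΦ h'.1
  have h2 := h'.2 x h.1
  by_contra hne
  have : 0 < ‖x - u‖ := norm_pos_iff.2 (sub_ne_zero.2 hne)
  have : 0 < 1 / s * ‖x - u‖ ^ s := by positivity
  linarith

lemma exists_isLinMin {X : Set (Vec d)} (hXc : IsCompact X) (hXn : X.Nonempty) {Φ : Vec d → ℝ}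
    (hΦ : Continuous Φ) (v : Vec d) : ∃ x, IsLinMin X Φ v x := by
  obtain ⟨x, hx, hmin⟩ := hXc.exists_isMinOn hXn
    (f := fun z => Φ z - inner ℝ v z) (by fun_prop)
  exact ⟨x, hx, fun u hu => hmin hu⟩

/-- A mirror descent step minimizes the linearized objective. -/
lemma isLinMin_mirrorStep (hκ : 0 < κ) (hκ1 : κ ≤ 1) (hp1 : 1 ≤ p) (hp2 : p ≤ 2)
    {X : Set (Vec d)} (hXc : IsCompact X) (hXn : X.Nonempty) {Φ : Vec d → ℝ}
    (h : UniformlyConvex p 1 ((1 + κ) / κ) Φ) (ν : ℝ) (x g : Vec d) :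
    IsLinMin X Φ (gradient Φ x - ν • g) (mirrorStep X Φ ν x g) := by
  obtain ⟨y, hy⟩ := exists_gradient_eq hκ hκ1 hp1 hp2 h (gradient Φ x - ν • g)
  rw [mirrorStep, gradient_fenchel hκ hp1 hp2 h hy]
  obtain ⟨z, hz, hzmin⟩ := exists_isLinMin hXc hXn h.differentiable.continuous
    (gradient Φ x - ν • g)
  have hex : ∃ x, x ∈ X ∧ IsMinOn (fun z => bregman Φ z y) X x := by
    refine ⟨z, hz, fun u hu => ?_⟩
    have h1 := bregman_sub_eq Φ u z y
    have h2 := hzmin u hu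
    rw [hy] at h1
    rw [Set.mem_ofPred_eq]
    linarith
  have hspec : bregmanProj X Φ y ∈ X ∧ IsMinOn (fun z => bregman Φ z y) X (bregmanProj X Φ y) :=
    Classical.epsilon_spec hex
  refine ⟨hspec.1, fun u hu => ?_⟩
  have h1 := bregman_sub_eq Φ u (bregmanProj X Φ y) y
  have h2 := hspec.2 hu
  rw [Set.mem_ofPred_eq] at h2
  rw [hy] at h1
  linarith

/-- The one-step inequality of mirror descent. -/
lemma mirrorStep_inequality (hκ : 0 < κ) (hκ1 : κ ≤ 1) (hp1 : 1 ≤ p) (hp2 : p ≤ 2)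
    {X : Set (Vec d)} (hXc : IsCompact X) (hX : Convex ℝ X) {Φ : Vec d → ℝ}
    (h : UniformlyConvex p 1 ((1 + κ) / κ) Φ) {ν : ℝ} (hν : 0 ≤ ν) (x g : Vec d) {u : Vec d}
    (hu : u ∈ X) {G : ℝ} (hG0 : 0 ≤ G) (hG : ∀ v, |inner ℝ g v| ≤ G * lpNorm p v) :
    ν * inner ℝ g (x - u) ≤ bregman Φ u x - bregman Φ u (mirrorStep X Φ ν x g) +
      ν ^ (1 + κ) * G ^ (1 + κ) := by
  have hmin := isLinMin_mirrorStep hκ hκ1 hp1 hp2 hXc ⟨u, hu⟩ h ν x g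
  set z := mirrorStep X Φ ν x g with hz
  have h1 := hmin.inner_nonneg hX h.differentiable hu
  have h2 := bregman_three_point Φ u x z
  have h3 := h.lower x z
  -- Young with the conjugate exponents `s` and `1 + κ`: the resulting `‖x - z‖_p^s / s` is paid for
  -- by the divergence of `z` from `x`.
  have h4 := Real.young_inequality_of_nonneg (lpNorm_nonneg hp1 (x - z))
    (mul_nonneg hν hG0) (holderConjugate_sExp hκ)
  have h5 : inner ℝ g (x - z) ≤ G * lpNorm p (x - z) := (le_abs_self _).trans (hG _)
  have h6 := mul_le_mul_of_nonneg_left h5 hν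
  have h7 : (ν * G) ^ (1 + κ) / (1 + κ) ≤ ν ^ (1 + κ) * G ^ (1 + κ) := by
    rw [← Real.mul_rpow hν hG0]
    exact div_le_self (by positivity) (by linarith)
  have h8 : inner ℝ (gradient Φ z - (gradient Φ x - ν • g)) (u - z) =
      inner ℝ (gradient Φ z - gradient Φ x) (u - z) + ν * inner ℝ g (u - z) := by
    rw [sub_sub_eq_add_sub, add_sub_right_comm, inner_add_left, real_inner_smul_left]
  rw [h8] at h1
  have h9 : inner ℝ g (x - u) = inner ℝ g (x - z) - inner ℝ g (u - z) := by
    simp only [inner_sub_right]; ring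
  rw [h9]
  have h10 : 1 / ((1 + κ) / κ) * lpNorm p (x - z) ^ ((1 + κ) / κ) =
      lpNorm p (x - z) ^ ((1 + κ) / κ) / ((1 + κ) / κ) := by ring
  nlinarith

lemma measurable_gradient (Ψ : Vec d → ℝ) : Measurable (gradient Ψ) :=
  (InnerProductSpace.toDual ℝ (Vec d)).symm.continuous.measurable.comp (measurable_fderiv ℝ Ψ)

/-- The mirror descent step with a recentred prox-function depends measurably on everything. -/
lemma measurable_mirrorStep_recentre (hκ : 0 < κ) (hκ1 : κ ≤ 1) (hp1 : 1 ≤ p) (hp2 : p ≤ 2)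
    {X : Set (Vec d)} (hXc : IsCompact X) (hXn : X.Nonempty) (hX : Convex ℝ X) {Ψ : Vec d → ℝ}
    (h : UniformlyConvex p 1 ((1 + κ) / κ) Ψ) (x₀ : Vec d) (ν : ℝ) :
    Measurable fun q : Vec d × Vec d × Vec d =>
      mirrorStep X (recentre Ψ x₀ q.1) ν q.2.1 q.2.2 := by
  have hs0 : 0 < (1 + κ) / κ := by positivity
  have hcompX : CompactSpace X := isCompact_iff_compactSpace.1 hXc
  have hex : ∀ q : Vec d × Vec d, ∃ x : X, IsLinMin X (recentre Ψ x₀ q.1) q.2 x := fun q => by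
    obtain ⟨x, hx⟩ := exists_isLinMin hXc hXn
      (h.recentre x₀ q.1).differentiable.continuous q.2
    exact ⟨⟨x, hx.1⟩, hx⟩
  choose S hS using hex
  have hΨc := h.differentiable.continuous
  -- The minimizer is unique and ranges in a compact space, and minimality is a closed condition; a
  -- map with closed graph into a compact space is continuous. Measurability of the step then only
  -- needs measurability of the gradient.
  have hSc : Continuous S := by
    rw [continuous_iff_isClosed]
    intro C hC
    have hgraph : IsClosed {a : (Vec d × Vec d) × X | ∀ u ∈ X,
        Ψ (a.2 - a.1.1 + x₀) - inner ℝ a.1.2 a.2 ≤ Ψ (u - a.1.1 + x₀) - inner ℝ a.1.2 u} := by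
      simp only [Set.ofPred_forall]
      refine isClosed_iInter fun u => isClosed_iInter fun _ => ?_
      exact isClosed_le (by fun_prop) (by fun_prop)
    have hpre : S ⁻¹' C = Prod.fst '' ({a : (Vec d × Vec d) × X | ∀ u ∈ X,
        Ψ (a.2 - a.1.1 + x₀) - inner ℝ a.1.2 a.2 ≤ Ψ (u - a.1.1 + x₀) - inner ℝ a.1.2 u} ∩
          Prod.snd ⁻¹' C) := by
      ext q
      constructor
      · intro hq
        exact ⟨(q, S q), ⟨fun u hu => (hS q).2 u hu, hq⟩, rfl⟩
      · rintro ⟨⟨q', x⟩, ⟨h1, h2⟩, rfl⟩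
        have h3 : IsLinMin X (recentre Ψ x₀ q'.1) q'.2 x := ⟨x.2, fun u hu => h1 u hu⟩
        have h4 : (S q' : Vec d) = x := (hS q').unique hX hs0 hp1 hp2 (h.recentre x₀ q'.1) h3
        have h5 : S q' = x := Subtype.ext h4
        rw [Set.mem_preimage, h5]
        exact h2
    rw [hpre]
    exact isClosedMap_fst_of_compactSpace _ (hgraph.inter (hC.preimage continuous_snd))
  have heq : ∀ q : Vec d × Vec d × Vec d, mirrorStep X (recentre Ψ x₀ q.1) ν q.2.1 q.2.2 =
      S (q.1, gradient Ψ (q.2.1 - q.1 + x₀) - ν • q.2.2) := by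
    intro q
    have h1 := isLinMin_mirrorStep hκ hκ1 hp1 hp2 hXc hXn (h.recentre x₀ q.1) ν q.2.1 q.2.2
    rw [gradient_recentre] at h1
    exact h1.unique hX hs0 hp1 hp2 (h.recentre x₀ q.1) (hS _)
  simp_rw [heq]
  have hg : Measurable fun q : Vec d × Vec d × Vec d => gradient Ψ (q.2.1 - q.1 + x₀) :=
    (measurable_gradient Ψ).comp (by fun_prop)
  exact measurable_subtype_coe.comp (hSc.measurable.comp
    (measurable_fst.prodMk (hg.sub (by fun_prop))))

lemma UniformlyConvex.bregman_nonneg {s : ℝ} (hs : 0 < s) (hp1 : 1 ≤ p) {Ψ : Vec d → ℝ}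
    (h : UniformlyConvex p 1 s Ψ) (x y : Vec d) : 0 ≤ bregman Ψ y x :=
  le_trans (mul_nonneg (by positivity) (Real.rpow_nonneg (lpNorm_nonneg hp1 _) _)) (h.lower x y)

/-- Growth at one point bounds all Bregman divergences. -/
lemma bregman_le_of_hasProxGrowth {s L : ℝ} (hs : 0 < s) (hp1 : 1 ≤ p) {Ψ : Vec d → ℝ}
    (h : UniformlyConvex p 1 s Ψ) {x₀ : Vec d} (hL : HasProxGrowth p s L x₀ Ψ) (x y : Vec d) :
    bregman Ψ x y ≤ L / s * lpNorm p (x - x₀) ^ s +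
      L / s * lpNorm p ((2 : ℝ) • y - x - x₀) ^ s := by
  have h1 := hL x
  have h2 := hL ((2 : ℝ) • y - x)
  have h3 := h.bregman_nonneg hs hp1 y ((2 : ℝ) • y - x)
  have h4 := h.bregman_nonneg hs hp1 x₀ y
  -- Adding the divergence of the reflected point `2y - x` leaves a symmetric second difference at
  -- `y`. The gradient at `y`, about which nothing is known, cancels.
  have h5 : bregman Ψ x y + bregman Ψ ((2 : ℝ) • y - x) y =
      bregman Ψ x x₀ + bregman Ψ ((2 : ℝ) • y - x) x₀ - 2 * bregman Ψ y x₀ := by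
    simp only [bregman, inner_sub_right, real_inner_smul_right]
    ring
  linarith

lemma one_le_of_hasProxGrowth {s L : ℝ} (hd : 0 < d) (hs : 0 < s) (hp1 : 1 ≤ p) (hp2 : p ≤ 2)
    {Ψ : Vec d → ℝ} (h : UniformlyConvex p 1 s Ψ) {x₀ : Vec d} (hL : HasProxGrowth p s L x₀ Ψ) :
    1 ≤ L := by
  have := nontrivial_vec hd
  obtain ⟨e, he⟩ := exists_ne (0 : Vec d)
  have h1 := hL (x₀ + e)
  have h2 := h.lower x₀ (x₀ + e)
  rw [lpNorm_sub_comm hp1] at h2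
  rw [add_sub_cancel_left] at h1 h2
  have hpos : 0 < lpNorm p e ^ s := by
    have : 0 < lpNorm p e := (norm_pos_iff.2 he).trans_le (norm_le_lpNorm hp1 hp2 e)
    positivity
  have h3 := le_of_mul_le_mul_right (h2.trans h1) hpos
  exact (div_le_div_iff_of_pos_right hs).1 h3

end Prox

end ZORestart

/-! ### Uniform convexity of powers of `ℓ_p`-norms. -/

namespace ZORestart

section PowerProx

/-- Bernoulli handles `(1 - t)^π` and the left side. In `(1 + t)^π = (1 + t) exp ((π - 1) log (1 +
t))` the exponential is expanded to second order and `log (1 + t) ≥ 2t / (t + 2)` is used. The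
surplus `(π - 1) t² / 3 + 2 (π - 1)² t² / 9` exceeds the required `π (π - 1) t² / 5`. -/
lemma two_point_rpow_aux {π t : ℝ} (h1 : 1 < π) (h2 : π ≤ 2) (ht0 : 0 ≤ t) (ht1 : t ≤ 1) :
    2 * (1 + (π - 1) / 5 * t ^ 2) ^ (π / 2) ≤ (1 + t) ^ π + (1 - t) ^ π := by
  have hB : 1 - π * t ≤ (1 - t) ^ π := by
    have := one_add_mul_self_le_rpow_one_add (s := -t) (by linarith) h1.le
    rw [← sub_eq_add_neg] at this
    linarith
  have hR : (1 + (π - 1) / 5 * t ^ 2) ^ (π / 2) ≤ 1 + π / 2 * ((π - 1) / 5 * t ^ 2) :=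
    rpow_one_add_le_one_add_mul_self (by nlinarith [mul_nonneg (sub_nonneg.2 h1.le) (sq_nonneg t)])
      (by linarith) (by linarith)
  have hlog := Real.le_log_one_add_of_nonneg ht0
  have hlog0 : 0 ≤ 2 * t / (t + 2) := by positivity
  have hθ : 0 < π - 1 := by linarith
  have hexp : 1 + (π - 1) * Real.log (1 + t) + ((π - 1) * Real.log (1 + t)) ^ 2 / 2 ≤
      (1 + t) ^ (π - 1) := by
    rw [Real.rpow_def_of_pos (by linarith), mul_comm (Real.log _)]
    exact Real.quadratic_le_exp_of_nonneg (mul_nonneg hθ.le (hlog0.trans hlog))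
  have hl3 : 2 * t / 3 ≤ 2 * t / (t + 2) := by
    apply div_le_div_of_nonneg_left <;> linarith
  have hl1 : t + t ^ 2 / 3 ≤ (1 + t) * (2 * t / (t + 2)) := by
    rw [mul_div_assoc', le_div_iff₀ (by linarith)]
    nlinarith [mul_nonneg ht0 ht0, mul_nonneg (mul_nonneg ht0 ht0) (sub_nonneg.2 ht1)]
  have hl2 : t + t ^ 2 / 3 ≤ (1 + t) * Real.log (1 + t) :=
    hl1.trans (mul_le_mul_of_nonneg_left hlog (by linarith))
  have hsq : (2 * t / 3) ^ 2 ≤ Real.log (1 + t) ^ 2 :=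
    pow_le_pow_left₀ (by positivity) (hl3.trans hlog) 2
  have hA : 1 + t + (π - 1) * (t + t ^ 2 / 3) + (π - 1) ^ 2 * (2 * t ^ 2 / 9) ≤ (1 + t) ^ π := by
    have e1 : (1 + t) ^ π = (1 + t) * (1 + t) ^ (π - 1) := by
      rw [mul_comm, ← Real.rpow_add_one (by linarith)]
      congr 1; ring
    rw [e1]
    refine le_trans ?_ (mul_le_mul_of_nonneg_left hexp (by linarith))
    have k1 := mul_le_mul_of_nonneg_left hl2 hθ.le
    have k2 : (π - 1) ^ 2 * (2 * t ^ 2 / 9) ≤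
        (1 + t) * (((π - 1) * Real.log (1 + t)) ^ 2 / 2) := by
      have := mul_le_mul_of_nonneg_left hsq (sq_nonneg (π - 1))
      have h0 : 0 ≤ ((π - 1) * Real.log (1 + t)) ^ 2 / 2 * t := by positivity
      nlinarith
    nlinarith
  have hq : 0 ≤ (π - 1) * (2 - π) * t ^ 2 := by
    have := mul_nonneg hθ.le (sub_nonneg.2 h2)
    positivity
  nlinarith [mul_nonneg hθ.le (sq_nonneg t), mul_nonneg (sq_nonneg (π - 1)) (sq_nonneg t)]

/-- A two-point inequality expressing the uniform convexity of `|·| ^ π`. -/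
lemma two_point_rpow {π : ℝ} (h1 : 1 < π) (h2 : π ≤ 2) (a b : ℝ) :
    2 * (a ^ 2 + (π - 1) / 5 * b ^ 2) ^ (π / 2) ≤ |a + b| ^ π + |a - b| ^ π := by
  have key : ∀ a b : ℝ, 0 ≤ b → b ≤ a →
      2 * (a ^ 2 + (π - 1) / 5 * b ^ 2) ^ (π / 2) ≤ (a + b) ^ π + (a - b) ^ π := by
    intro a b hb hba
    rcases hb.eq_or_lt with rfl | hb'
    · rw [add_zero, sub_zero]
      simp only [ne_eq, OfNat.ofNat_ne_zero, not_false_eq_true, zero_pow, mul_zero, add_zero]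
      rw [← Real.rpow_natCast, ← Real.rpow_mul hba]
      apply le_of_eq
      rw [show ((2 : ℕ) : ℝ) * (π / 2) = π by push_cast; ring]
      ring
    have ha : 0 < a := hb'.trans_le hba
    have := mul_le_mul_of_nonneg_left (two_point_rpow_aux h1 h2 (t := b / a) (by positivity)
      ((div_le_one ha).2 hba)) (by positivity : 0 ≤ a ^ π)
    have e1 : a ^ π * (1 + b / a) ^ π = (a + b) ^ π := by
      rw [← Real.mul_rpow ha.le (by positivity)]
      congr 1; field_simp
    have e2 : a ^ π * (1 - b / a) ^ π = (a - b) ^ π := by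
      rw [← Real.mul_rpow ha.le (sub_nonneg.2 ((div_le_one ha).2 hba))]
      congr 1; field_simp
    have e3 : a ^ π * (1 + (π - 1) / 5 * (b / a) ^ 2) ^ (π / 2) =
        (a ^ 2 + (π - 1) / 5 * b ^ 2) ^ (π / 2) := by
      have : a ^ π = (a ^ 2) ^ (π / 2) := by
        rw [← Real.rpow_natCast, ← Real.rpow_mul ha.le]
        congr 1; push_cast; ring
      have h0 : 0 ≤ (π - 1) / 5 := by linarith
      rw [this, ← Real.mul_rpow (by positivity) (by positivity)]
      congr 1; field_simp
    rw [mul_add, e1, e2, mul_left_comm, e3] at this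
    exact this
  -- If `a < b`, exchanging the two only increases the left side, because the coefficient `(π - 1) /
  -- 5` is at most one.
  have key2 : ∀ a b : ℝ, 0 ≤ a → 0 ≤ b →
      2 * (a ^ 2 + (π - 1) / 5 * b ^ 2) ^ (π / 2) ≤ |a + b| ^ π + |a - b| ^ π := by
    intro a b ha hb
    rw [abs_of_nonneg (add_nonneg ha hb)]
    rcases le_total b a with h | h
    · rw [abs_of_nonneg (sub_nonneg.2 h)]
      exact key a b hb h
    · rw [abs_sub_comm, abs_of_nonneg (sub_nonneg.2 h), add_comm a b]
      refine le_trans ?_ (key b a ha h)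
      have hab : a ^ 2 ≤ b ^ 2 := pow_le_pow_left₀ ha h 2
      have h0 : 0 ≤ (π - 1) / 5 := by linarith
      refine mul_le_mul_of_nonneg_left (Real.rpow_le_rpow (by positivity) ?_ (by linarith))
        (by norm_num)
      nlinarith
  have h3 := key2 |a| |b| (abs_nonneg a) (abs_nonneg b)
  rw [sq_abs, sq_abs] at h3
  refine h3.trans (le_of_eq ?_)
  rcases le_total 0 a with ha | ha <;> rcases le_total 0 b with hb | hb <;>
    simp only [abs_of_nonneg, abs_of_nonpos, ha, hb]
  · rw [sub_neg_eq_add, ← sub_eq_add_neg, add_comm]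
  · rw [show -a + b = -(a - b) by ring, show -a - b = -(a + b) by ring, abs_neg, abs_neg, add_comm]
  · rw [show -a + -b = -(a + b) by ring, show -a - -b = -(a - b) by ring, abs_neg, abs_neg]

/-- The triangle inequality for the vectors `(A i, B i)` in the plane with the `ℓ_α`-norm, summed up
by induction. -/
lemma minkowski_sum {ι : Type*} (S : Finset ι) {α : ℝ} (hα : 1 ≤ α) (A B : ι → ℝ)
    (hA : ∀ i, 0 ≤ A i) (hB : ∀ i, 0 ≤ B i) :
    ((∑ i ∈ S, A i) ^ α + (∑ i ∈ S, B i) ^ α) ^ (1 / α) ≤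
      ∑ i ∈ S, (A i ^ α + B i ^ α) ^ (1 / α) := by
  classical
  have hα0 : α ≠ 0 := by linarith
  induction S using Finset.induction_on with
  | empty => simp [Real.zero_rpow hα0, Real.zero_rpow (inv_ne_zero hα0)]
  | insert i S hi ih =>
    rw [Finset.sum_insert hi, Finset.sum_insert hi, Finset.sum_insert hi]
    refine le_trans ?_ (add_le_add le_rfl ih)
    have h0A := Finset.sum_nonneg fun j (_ : j ∈ S) => hA j
    have h0B := Finset.sum_nonneg fun j (_ : j ∈ S) => hB j
    have := Real.Lp_add_le_of_nonneg (Finset.univ : Finset (Fin 2)) (f := ![A i, B i])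
      (g := ![∑ j ∈ S, A j, ∑ j ∈ S, B j]) hα
      (fun j _ => by fin_cases j <;> simp [hA, hB])
      (fun j _ => by fin_cases j <;> simp [h0A, h0B])
    simpa [Fin.sum_univ_two] using this

lemma add_rpow_le_rpow_add' {a b β : ℝ} (ha : 0 ≤ a) (hb : 0 ≤ b) (hβ : 1 ≤ β) :
    a ^ β + b ^ β ≤ (a + b) ^ β := by
  have := NNReal.add_rpow_le_rpow_add ⟨a, ha⟩ ⟨b, hb⟩ hβ
  exact_mod_cast this

lemma midpoint_rpow_le {a b β : ℝ} (ha : 0 ≤ a) (hb : 0 ≤ b) (hβ : 1 ≤ β) :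
    ((a + b) / 2) ^ β ≤ (a ^ β + b ^ β) / 2 := by
  have := (convexOn_rpow hβ).2 (Set.mem_Ici.2 ha) (Set.mem_Ici.2 hb)
    (by norm_num : (0 : ℝ) ≤ 1 / 2) (by norm_num : (0 : ℝ) ≤ 1 / 2) (by norm_num)
  simp only [smul_eq_mul] at this
  rw [show (a + b) / 2 = 1 / 2 * a + 1 / 2 * b by ring]
  linarith

variable {d : ℕ}

lemma lmNorm_rpow (π s : ℝ) (x : Vec d) : lmNorm π x ^ s = (∑ i, |x i| ^ π) ^ (s / π) := by
  rw [lmNorm, ← Real.rpow_mul (Finset.sum_nonneg fun i _ => by positivity)]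
  congr 1; ring

/-- Midpoint uniform convexity of powers of the `ℓ_π`-norm. -/
lemma lmNorm_midpoint {π s : ℝ} (h1 : 1 < π) (h2 : π ≤ 2) (hs : 2 ≤ s) (m h : Vec d) :
    lmNorm π m ^ s + ((π - 1) / 5) ^ (s / 2) * lmNorm π h ^ s ≤
      (lmNorm π (m + h) ^ s + lmNorm π (m - h) ^ s) / 2 := by
  have hπ0 : 0 < π := by linarith
  have hδ : 0 ≤ (π - 1) / 5 := by linarith
  simp only [lmNorm_rpow]
  -- Chosen so that `A i ^ (2/π)` and `B i ^ (2/π)` are the two squares of the two-point inequality.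
  -- That inequality holds in each coordinate, Minkowski with exponent `2/π` sums it, and
  -- superadditivity of the power `s/2` separates the two terms.
  set A : Fin d → ℝ := fun i => |m i| ^ π with hA
  set B : Fin d → ℝ := fun i => ((π - 1) / 5) ^ (π / 2) * |h i| ^ π with hB
  have hA0 : ∀ i, 0 ≤ A i := fun i => by positivity
  have hB0 : ∀ i, 0 ≤ B i := fun i => by positivity
  have hSA : 0 ≤ ∑ i, A i := Finset.sum_nonneg fun i _ => hA0 i
  have hSB : 0 ≤ ∑ i, B i := Finset.sum_nonneg fun i _ => hB0 i
  have hα : 1 ≤ 2 / π := by rw [le_div_iff₀ hπ0]; linarith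
  have hstep1 := midpoint_rpow_le (a := ∑ i, |(m + h) i| ^ π) (b := ∑ i, |(m - h) i| ^ π)
    (Finset.sum_nonneg fun i _ => by positivity) (Finset.sum_nonneg fun i _ => by positivity)
    (β := s / π) (by rw [le_div_iff₀ hπ0]; linarith)
  refine le_trans ?_ hstep1
  have hpt : ∀ i, (A i ^ (2 / π) + B i ^ (2 / π)) ^ (1 / (2 / π)) ≤
      (|(m + h) i| ^ π + |(m - h) i| ^ π) / 2 := by
    intro i
    have e1 : A i ^ (2 / π) = m i ^ 2 := by
      rw [hA]
      simp only
      rw [← Real.rpow_mul (abs_nonneg _), mul_div_cancel₀ _ hπ0.ne']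
      norm_cast
      rw [sq_abs]
    have e2 : B i ^ (2 / π) = (π - 1) / 5 * h i ^ 2 := by
      rw [hB]
      simp only
      rw [Real.mul_rpow (by positivity) (by positivity), ← Real.rpow_mul hδ,
        ← Real.rpow_mul (abs_nonneg _), mul_div_cancel₀ _ hπ0.ne',
        show π / 2 * (2 / π) = 1 by field_simp, Real.rpow_one]
      norm_cast
      rw [sq_abs]
    rw [e1, e2, one_div_div]
    have := two_point_rpow h1 h2 (m i) (h i)
    rw [PiLp.add_apply, PiLp.sub_apply]
    linarith
  have hsum : ((∑ i, A i) ^ (2 / π) + (∑ i, B i) ^ (2 / π)) ^ (1 / (2 / π)) ≤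
      (∑ i, |(m + h) i| ^ π + ∑ i, |(m - h) i| ^ π) / 2 := by
    refine (minkowski_sum Finset.univ hα A B hA0 hB0).trans ?_
    rw [← Finset.sum_add_distrib, Finset.sum_div]
    exact Finset.sum_le_sum fun i _ => hpt i
  refine le_trans ?_ (Real.rpow_le_rpow (by positivity) hsum (by positivity : 0 ≤ s / π))
  rw [← Real.rpow_mul (by positivity), one_div_div, show π / 2 * (s / π) = s / 2 by field_simp]
  refine le_trans (le_of_eq ?_)
    (add_rpow_le_rpow_add' (by positivity) (by positivity) (by linarith : 1 ≤ s / 2))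
  rw [← Real.rpow_mul hSA, ← Real.rpow_mul hSB, show 2 / π * (s / 2) = s / π by field_simp, hB,
    ← Finset.mul_sum, Real.mul_rpow (by positivity)
      (Finset.sum_nonneg fun i _ => by positivity), ← Real.rpow_mul hδ,
    show π / 2 * (s / π) = s / 2 by field_simp]

lemma inner_gradient_eq_fderiv (φ : Vec d → ℝ) (x v : Vec d) :
    inner ℝ (gradient φ x) v = fderiv ℝ φ x v := by
  simp [gradient]

lemma bregman_nonneg_of_convexOn {φ : Vec d → ℝ} (hc : ConvexOn ℝ Set.univ φ)
    (hφ : Differentiable ℝ φ) (y x : Vec d) : 0 ≤ bregman φ y x := by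
  have hg : ConvexOn ℝ Set.univ (fun t : ℝ => φ (AffineMap.lineMap x y t)) := by
    simpa [Function.comp_def] using hc.comp_affineMap (AffineMap.lineMap (k := ℝ) x y)
  have hd : HasDerivAt (fun t : ℝ => φ (AffineMap.lineMap x y t)) (fderiv ℝ φ x (y - x)) 0 := by
    have h1 : HasDerivAt (fun t : ℝ => AffineMap.lineMap x y t) (y - x) (0 : ℝ) :=
      AffineMap.hasDerivAt_lineMap
    have h2 : HasFDerivAt φ (fderiv ℝ φ x) (AffineMap.lineMap x y (0 : ℝ)) := by
      rw [AffineMap.lineMap_apply_zero]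
      exact (hφ x).hasFDerivAt
    exact h2.comp_hasDerivAt 0 h1
  have := hg.le_slope_of_hasDerivAt (Set.mem_univ 0) (Set.mem_univ 1) one_pos hd
  rw [slope_def_field] at this
  simp only [AffineMap.lineMap_apply_zero, AffineMap.lineMap_apply_one] at this
  rw [bregman, inner_gradient_eq_fderiv]
  linarith

/-- Nonnegativity of the divergence of the midpoint from `x` bounds the gradient term, which there
acts on half of `y - x`; hence the factor `2`. -/
lemma bregman_ge_of_midpoint {φ : Vec d → ℝ} (hc : ConvexOn ℝ Set.univ φ)
    (hφ : Differentiable ℝ φ) {y x : Vec d} {c : ℝ}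
    (h : φ ((1 / 2 : ℝ) • (x + y)) + c ≤ (φ x + φ y) / 2) : 2 * c ≤ bregman φ y x := by
  have h1 := bregman_nonneg_of_convexOn hc hφ ((1 / 2 : ℝ) • (x + y)) x
  have h2 : (1 / 2 : ℝ) • (x + y) - x = (1 / 2 : ℝ) • (y - x) := by module
  rw [bregman, h2, real_inner_smul_right] at h1
  rw [bregman]
  linarith

lemma differentiable_lmNorm_rpow {π s : ℝ} (h1 : 1 < π) (h2 : π ≤ s) :
    Differentiable ℝ fun x : Vec d => lmNorm π x ^ s := by
  simp only [lmNorm_rpow]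
  have : Differentiable ℝ fun x : Vec d => ∑ i, |x i| ^ π := by
    refine Differentiable.fun_sum fun i _ => ?_
    have := (differentiable_norm_rpow (E := ℝ) h1).comp
      (EuclideanSpace.proj (𝕜 := ℝ) i).differentiable
    simpa [Function.comp_def] using this
  exact this.rpow_const fun x => Or.inr (by rw [le_div_iff₀ (by linarith)]; linarith)

lemma convexOn_lpNorm_rpow {p : ENNReal} (hp1 : 1 ≤ p) {s : ℝ} (hs : 1 ≤ s) :
    ConvexOn ℝ Set.univ fun x : Vec d => lpNorm p x ^ s := by
  refine ⟨convex_univ, fun x _ y _ a b ha hb hab => ?_⟩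
  have h1 : lpNorm p (a • x + b • y) ≤ a * lpNorm p x + b * lpNorm p y := by
    refine (lpNorm_add_le hp1 _ _).trans ?_
    rw [lpNorm_smul hp1, lpNorm_smul hp1, abs_of_nonneg ha, abs_of_nonneg hb]
  refine (Real.rpow_le_rpow (lpNorm_nonneg hp1 _) h1 (by linarith)).trans ?_
  exact (convexOn_rpow hs).2 (Set.mem_Ici.2 (lpNorm_nonneg hp1 x))
    (Set.mem_Ici.2 (lpNorm_nonneg hp1 y)) ha hb hab

/-- Explains the form of `Kq`. Since `q' - 1 = 1 / (π - 1)`, the maximum compensates `(π -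
1)^(s/2)`, and the remaining `10^(s-1) · 2 · 5^(-s/2) · 2^(-s) = 5^(s/2 - 1)` is at least one as `s
≥ 2`. -/
lemma ten_rpow_mul_le {κ π q' : ℝ} (hκ : 0 < κ) (hκ1 : κ ≤ 1) (hc : π.HolderConjugate q') :
    1 ≤ (10 * max 1 ((q' - 1) ^ ((1 + κ) / 2))) ^ (1 / κ) *
      (2 * (((π - 1) / 5) ^ (((1 + κ) / κ) / 2) * (1 / 2) ^ ((1 + κ) / κ))) := by
  have hs2 := two_le_sExp hκ hκ1
  set s := (1 + κ) / κ with hs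
  have hinv : 1 / κ = s - 1 := by rw [hs]; field_simp; ring
  have hπ : 0 < π - 1 := hc.sub_one_pos
  have hq : q' - 1 = (π - 1)⁻¹ := by
    have := hc.symm.conjugate_eq
    have := hc.conjugate_eq
    rw [this]; field_simp; ring
  have hq0 : 0 ≤ q' - 1 := by rw [hq]; positivity
  have h1 : (π - 1) ^ (-(s / 2)) ≤ (max 1 ((q' - 1) ^ ((1 + κ) / 2))) ^ (1 / κ) := by
    have : (π - 1) ^ (-(s / 2)) = ((q' - 1) ^ ((1 + κ) / 2)) ^ (1 / κ) := by
      rw [← Real.rpow_mul hq0, hq, Real.inv_rpow hπ.le, Real.rpow_neg hπ.le,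
        show (1 + κ) / 2 * (1 / κ) = s / 2 by rw [hs]; field_simp]
    rw [this]
    exact Real.rpow_le_rpow (by positivity) (le_max_right _ _) (by positivity)
  rw [Real.mul_rpow (by norm_num) (by positivity), hinv]
  rw [hinv] at h1
  have h2 : (1 : ℝ) ≤ 10 ^ (s - 1) * (2 * (((1 : ℝ) / 5) ^ (s / 2) * (1 / 2) ^ s)) := by
    have e1 : (2 : ℝ) * (1 / 2) ^ s = (1 / 2) ^ (s - 1) := by
      rw [Real.rpow_sub_one (by norm_num)]; ring
    have e2 : (10 : ℝ) ^ (s - 1) * (1 / 2) ^ (s - 1) = 5 ^ (s - 1) := by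
      rw [← Real.mul_rpow (by norm_num) (by norm_num)]; norm_num
    have e3 : (5 : ℝ) ^ (s - 1) * (1 / 5) ^ (s / 2) = 5 ^ (s / 2 - 1) := by
      rw [one_div, Real.inv_rpow (by norm_num), ← div_eq_mul_inv, ← Real.rpow_sub (by norm_num)]
      congr 1; ring
    calc (1 : ℝ) ≤ 5 ^ (s / 2 - 1) := Real.one_le_rpow (by norm_num) (by linarith)
      _ = 10 ^ (s - 1) * (2 * (((1 : ℝ) / 5) ^ (s / 2) * (1 / 2) ^ s)) := by
        rw [← e3, ← e2, ← e1]; ring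
  have h3 : ((π - 1) / 5) ^ (s / 2) = (π - 1) ^ (s / 2) * (1 / 5) ^ (s / 2) := by
    rw [← Real.mul_rpow hπ.le (by norm_num)]; congr 1; ring
  have h4 : (π - 1) ^ (-(s / 2)) * (π - 1) ^ (s / 2) = 1 := by
    rw [← Real.rpow_add hπ]; simp
  calc (1 : ℝ) ≤ 10 ^ (s - 1) * (2 * (((1 : ℝ) / 5) ^ (s / 2) * (1 / 2) ^ s)) := h2
    _ = 10 ^ (s - 1) * (π - 1) ^ (-(s / 2)) *
        (2 * ((π - 1) ^ (s / 2) * (1 / 5) ^ (s / 2) * (1 / 2) ^ s)) := by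
      linear_combination (10 ^ (s - 1) * (2 * (((1 : ℝ) / 5) ^ (s / 2) * (1 / 2) ^ s))) * (-h4)
    _ ≤ _ := by
      rw [h3]
      gcongr

lemma powerProx_eq (κ : ℝ) (p q : ENNReal) (x₀ : Vec d) :
    powerProx κ p q x₀ = fun x => Kq κ q ^ (1 / κ) * (κ / (1 + κ)) *
      lpNorm p (x + -x₀) ^ ((1 + κ) / κ) := by
  ext x
  rw [powerProx, sExp, sub_eq_add_neg, mul_assoc]

lemma differentiable_powerProx {κ : ℝ} (hκ : 0 < κ) (hκ1 : κ ≤ 1) {p : ENNReal} (q : ENNReal)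
    (hp1 : 1 < p) (hp2 : p ≤ 2) (x₀ : Vec d) : Differentiable ℝ (powerProx κ p q x₀) := by
  have hpt : p ≠ ⊤ := (hp2.trans_lt (by simp)).ne
  have h1 : 1 < p.toReal := by
    simpa using (ENNReal.toReal_lt_toReal (by simp) hpt).2 hp1
  have h2 := (toReal_mem_Icc hp1.le hp2).2
  rw [powerProx_eq]
  simp only [lpNorm_eq_lmNorm hp1.le hp2]
  exact ((differentiable_lmNorm_rpow h1 (h2.trans (two_le_sExp hκ hκ1))).comp
    (differentiable_id.add_const (-x₀))).const_mul _

/-- The standard prox-functions are uniformly convex. -/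
lemma uniformlyConvex_powerProx {κ : ℝ} (hκ : 0 < κ) (hκ1 : κ ≤ 1) {p q : ENNReal}
    (hp1 : 1 < p) (hp2 : p ≤ 2) (hpq : p.HolderConjugate q) (x₀ : Vec d) :
    UniformlyConvex p 1 ((1 + κ) / κ) (powerProx κ p q x₀) := by
  have hpt : p ≠ ⊤ := (hp2.trans_lt (by simp)).ne
  have h1 : 1 < p.toReal := by
    simpa using (ENNReal.toReal_lt_toReal (by simp) hpt).2 hp1
  have h2 := (toReal_mem_Icc hp1.le hp2).2
  have hc : p.toReal.HolderConjugate q.toReal := ENNReal.HolderConjugate.toReal h1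
  have hs2 := two_le_sExp hκ hκ1
  have hK0 : 0 < Kq κ q := by unfold Kq; positivity
  have hconv : ConvexOn ℝ Set.univ (powerProx κ p q x₀) := by
    rw [powerProx_eq]
    have := (convexOn_lpNorm_rpow (d := d) hp1.le
      (by linarith : 1 ≤ (1 + κ) / κ)).translate_left (-x₀)
    exact ConvexOn.smul (by positivity) (by simpa [Function.comp_def] using this)
  have hdiff := differentiable_powerProx hκ hκ1 q hp1 hp2 x₀
  refine ⟨hdiff, hconv, fun x y => ?_⟩
  have hmid := lmNorm_midpoint h1 h2 hs2 ((1 / 2 : ℝ) • (x + y) + -x₀) ((1 / 2 : ℝ) • (x - y))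
  rw [show (1 / 2 : ℝ) • (x + y) + -x₀ + (1 / 2 : ℝ) • (x - y) = x + -x₀ by module,
    show (1 / 2 : ℝ) • (x + y) + -x₀ - (1 / 2 : ℝ) • (x - y) = y + -x₀ by module,
    lmNorm_smul (by linarith), abs_of_nonneg (by norm_num : (0 : ℝ) ≤ 1 / 2),
    Real.mul_rpow (by norm_num) (lmNorm_nonneg _ _)] at hmid
  simp only [← lpNorm_eq_lmNorm hp1.le hp2] at hmid
  have hten := ten_rpow_mul_le hκ hκ1 hc
  have hKq : Kq κ q = 10 * max 1 ((q.toReal - 1) ^ ((1 + κ) / 2)) := rfl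
  rw [← hKq] at hten
  have hC0 : 0 ≤ Kq κ q ^ (1 / κ) * (κ / (1 + κ)) := by positivity
  have hmid2 := mul_le_mul_of_nonneg_left hmid hC0
  refine le_trans ?_ (bregman_ge_of_midpoint hconv hdiff
    (c := Kq κ q ^ (1 / κ) * (κ / (1 + κ)) * (((p.toReal - 1) / 5) ^ (((1 + κ) / κ) / 2) *
      ((1 / 2) ^ ((1 + κ) / κ) * lpNorm p (x - y) ^ ((1 + κ) / κ)))) ?_)
  · have h0 : 0 ≤ κ / (1 + κ) * lpNorm p (x - y) ^ ((1 + κ) / κ) :=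
      mul_nonneg (by positivity) (Real.rpow_nonneg (lpNorm_nonneg hp1.le _) _)
    have := mul_le_mul_of_nonneg_right hten h0
    rw [one_div_div]
    linarith
  · rw [powerProx_eq]
    simp only
    linarith

/-- The growth constant of the standard prox-functions at their centre. -/
lemma hasProxGrowth_powerProx {κ : ℝ} (hκ : 0 < κ) {p : ENNReal} (q : ENNReal)
    (hp1 : 1 < p) (x₀ : Vec d) :
    HasProxGrowth p ((1 + κ) / κ) (Kq κ q ^ (1 / κ)) x₀ (powerProx κ p q x₀) := by
  have hK0 : 0 < Kq κ q := by unfold Kq; positivity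
  have hs : (1 + κ) / κ ≠ 0 := by positivity
  have hval : powerProx κ p q x₀ x₀ = 0 := by
    rw [powerProx, sub_self, lpNorm_zero hp1.le, sExp, Real.zero_rpow hs, mul_zero, mul_zero]
  have hgrad : gradient (powerProx κ p q x₀) x₀ = 0 := by
    have hmin : IsLocalMin (powerProx κ p q x₀) x₀ := by
      refine Filter.Eventually.of_forall fun y => ?_
      rw [hval, powerProx]
      have := lpNorm_nonneg hp1.le (y - x₀)
      positivity
    rw [gradient, hmin.fderiv_eq_zero, map_zero]
  intro x
  rw [bregman, hval, hgrad, inner_zero_left, powerProx, sExp]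
  apply le_of_eq
  field_simp
  ring

end PowerProx

end ZORestart

/-! ### Constants of the schedule and admissible noise. -/

namespace ZORestart

section Schedule

/-- The `s`-th root of the constant factor in the number of steps. -/
noncomputable def stepConst (κ r : ℝ) : ℝ :=
  2 * 2 ^ ((1 + κ) / κ) + 80010 + 4 * 8 ^ r

/-- The constant factor in the admissible noise level. -/
noncomputable def noiseConst (κ r : ℝ) : ℝ :=
  1 / (32 * ((1 + κ) / κ) * 16 ^ r * stepConst κ r ^ 2)

/-- The Euclidean part of `σ_q`. -/
noncomputable def sigmaBase (d : ℕ) (q : ENNReal) (M₂ : ℝ) : ℝ :=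
  √d / (2 : ℝ) ^ (1 / 4 : ℝ) * aq d q * M₂

lemma one_le_stepConst (κ r : ℝ) : 1 ≤ stepConst κ r := by
  have h1 : (0 : ℝ) < 2 ^ ((1 + κ) / κ) := by positivity
  have h2 : (0 : ℝ) < 8 ^ r := by positivity
  unfold stepConst; linarith

lemma noiseConst_pos {κ : ℝ} (hκ : 0 < κ) (r : ℝ) : 0 < noiseConst κ r := by
  have := one_le_stepConst κ r
  unfold noiseConst; positivity

lemma noiseLevel_eq (d : ℕ) (r μ M₂ : ℝ) {R : ℝ} (hR : 0 ≤ R) (k : ℕ) :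
    noiseLevel d r μ M₂ R k = μ ^ 2 * (R / 2 ^ k) ^ (2 * r - 1) / (M₂ * √d) := by
  rw [noiseLevel, Real.div_rpow hR (by positivity), Real.rpow_mul (by norm_num) (k : ℝ),
    Real.rpow_natCast]
  ring

/-- The consequences of the schedule for a single restart with radius `ρ`. -/
structure EpochBounds (d : ℕ) (q : ENNReal) (κ r μ M₂ L ρ Δ σ : ℝ) (T : ℕ) (τ ν : ℝ) : Prop where
  steps_pos : 0 < T
  sigma_pos : 0 < σ
  tau_pos : 0 < τ
  nu_pos : 0 < ν
  sigma_ge : sigmaBase d q M₂ ^ (1 + κ) + (d * aq d q * Δ / τ) ^ (1 + κ) ≤ σ ^ (1 + κ)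
  sigma_le : σ ≤ 2 * sigmaBase d q M₂
  tau_le : M₂ * τ ≤ μ * ρ ^ r / (2 * 2 ^ r) / (stepConst κ r * L ^ r)
  noise_le : 2 * √d * Δ / τ ≤ 1 / (2 * ((1 + κ) / κ)) * (M₂ * τ / ρ)
  nu_mul : ν * T = ρ ^ ((1 + κ) / κ) / (M₂ * τ)
  nu_rpow : ν ^ (1 + κ) * σ ^ (1 + κ) * T = ρ ^ ((1 + κ) / κ)

variable {d : ℕ} {q : ENNReal} {κ r μ M₂ L ρ Δ : ℝ}

/-- The algebra of `noise_bounds` with the real powers abbreviated: `X = ρ^(r-1)`, `b = 2^r`, `l =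
L^r`, `y = 8^r`, `z = 16^r`, `D = √d` and `Γ` the step constant. -/
lemma noise_bounds_aux {D μ M ρ X b l c s Γ t Δ y z : ℝ} (hl : 0 < l)
    (hs : 0 < s) (hμ : 0 < μ) (hM : 0 < M) (hρ : 0 < ρ) (hX : 0 < X) (hb : 0 < b) (hΓ : 0 < Γ)
    (hc : 0 < c) (ht : 0 < t) (hc1 : c * (32 * z * Γ) ≤ 1) (hc2 : 64 * s * c * b ^ 2 * Γ ^ 2 ≤ 1)
    (hz : z = y * b) (hX2 : μ * X ≤ y * l * (4 * M))
    (hn : D * Δ * M ≤ c / l ^ 2 * (μ ^ 2 * (X ^ 2 * ρ)))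
    (hτ : μ * (X * ρ) / (2 * b) / (2 * (Γ * l)) ≤ M * t) :
    2 * (D * Δ) ≤ M * t ∧ 2 * D * Δ / t ≤ 1 / (2 * s) * (M * t / ρ) := by
  have hb0 : μ * (X * ρ) / (2 * b) / (2 * (Γ * l)) = μ * X * ρ / (4 * b * Γ * l) := by
    field_simp; ring
  rw [hb0] at hτ
  have hpos : 0 < μ * X * ρ / (4 * b * Γ * l) := by positivity
  constructor
  · have : 2 * (D * Δ) * M ≤ M * t * M := by
      refine le_trans ?_ (mul_le_mul_of_nonneg_right hτ hM.le)
      have h3 : 2 * (c / l ^ 2 * (μ ^ 2 * (X ^ 2 * ρ))) =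
          μ * X * ρ / (4 * b * Γ * l) * (8 * c * b * Γ / l * (μ * X)) := by
        field_simp; ring
      have h4 : 8 * c * b * Γ / l * (μ * X) ≤ M := by
        refine (mul_le_mul_of_nonneg_left hX2 (by positivity)).trans ?_
        have h6 : 8 * c * b * Γ / l * (y * l * (4 * M)) = c * (32 * z * Γ) * M := by
          rw [hz]; field_simp; ring
        rw [h6]
        exact mul_le_of_le_one_left hM.le hc1
      have := mul_le_mul_of_nonneg_left h4 hpos.le
      linarith
    exact le_of_mul_le_mul_right this hM
  · have hsq : (μ * X * ρ / (4 * b * Γ * l)) ^ 2 ≤ (M * t) ^ 2 :=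
      pow_le_pow_left₀ hpos.le hτ 2
    have h3 : 4 * s * ρ * (c / l ^ 2 * (μ ^ 2 * (X ^ 2 * ρ))) =
        (μ * X * ρ / (4 * b * Γ * l)) ^ 2 * (64 * s * c * b ^ 2 * Γ ^ 2) := by
      field_simp; ring
    have h4 : 4 * s * ρ * (D * Δ * M) ≤ (M * t) ^ 2 := by
      refine (mul_le_mul_of_nonneg_left hn (by positivity)).trans ?_
      rw [h3]
      exact (mul_le_of_le_one_right (sq_nonneg _) hc2).trans hsq
    rw [div_le_iff₀ ht]
    have h5 : 1 / (2 * s) * (M * t / ρ) * t = (M * t) ^ 2 / (2 * s * ρ * M) := by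
      field_simp
    rw [h5, le_div_iff₀ (by positivity)]
    linarith

/-- A lower bound on the smoothing radius alone makes the noise harmless: `√d M₂ Δ` is at most of
order `μ² ρ^(2r-1)`, whereas `(M₂ t)²` is at least of order `μ² ρ^(2r)`. The first conclusion also
uses that `μ ρ^(r-1)` is bounded by a multiple of `M₂`. -/
lemma noise_bounds (hd : 0 < d) (hκ : 0 < κ) (hκ1 : κ ≤ 1) (hr : 1 ≤ r) (hμ : 0 < μ) (hM : 0 < M₂)
    (hL : 1 ≤ L) (hρ : 0 < ρ) (hρR : μ * ρ ^ (r - 1) ≤ (8 * L) ^ (r - 1) * (4 * M₂))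
    (hΔ2 : Δ ≤ noiseConst κ r / L ^ (2 * r) *
      (μ ^ 2 * ρ ^ (2 * r - 1) / (M₂ * √d))) {t : ℝ} (ht : 0 < t)
    (hτ : μ * ρ ^ r / (2 * 2 ^ r) / (2 * (stepConst κ r * L ^ r)) ≤ M₂ * t) :
    2 * (√d * Δ) ≤ M₂ * t ∧ 2 * √d * Δ / t ≤ 1 / (2 * ((1 + κ) / κ)) * (M₂ * t / ρ) := by
  have hs2 := two_le_sExp hκ hκ1
  set s := (1 + κ) / κ with hs
  have hΓ := one_le_stepConst κ r
  have hcdef : noiseConst κ r * (32 * s * 16 ^ r * stepConst κ r ^ 2) = 1 := by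
    rw [noiseConst, ← hs]
    have : (0 : ℝ) < 16 ^ r := by positivity
    field_simp
  have hc0 := noiseConst_pos hκ r
  set c := noiseConst κ r
  set Γ := stepConst κ r
  have hd0 : 0 < √(d : ℝ) := by positivity
  have hL0 : 0 < L := by linarith
  set X := ρ ^ (r - 1) with hX
  have hX0 : 0 < X := by positivity
  have e1 : ρ ^ r = X * ρ := by
    rw [hX, ← Real.rpow_add_one hρ.ne']; congr 1; ring
  have e2 : ρ ^ (2 * r - 1) = X ^ 2 * ρ := by
    rw [hX, ← Real.rpow_natCast, ← Real.rpow_mul hρ.le, ← Real.rpow_add_one hρ.ne']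
    congr 1; push_cast; ring
  set l := L ^ r with hl
  have hl1 : 1 ≤ l := Real.one_le_rpow hL (by linarith)
  have e3 : L ^ (2 * r) = l ^ 2 := by
    rw [hl, ← Real.rpow_natCast, ← Real.rpow_mul hL0.le]; congr 1; push_cast; ring
  have h8 : (8 * L) ^ (r - 1) ≤ 8 ^ r * l := by
    rw [hl, ← Real.mul_rpow (by norm_num) hL0.le]
    exact Real.rpow_le_rpow_of_exponent_le (by linarith) (by linarith)
  have h2r : (2 : ℝ) ≤ 2 ^ r := by
    simpa using Real.rpow_le_rpow_of_exponent_le (by norm_num : (1 : ℝ) ≤ 2) hr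
  have h16 : (16 : ℝ) ^ r = 8 ^ r * 2 ^ r := by
    rw [← Real.mul_rpow (by norm_num) (by norm_num)]; norm_num
  have h8r : (8 : ℝ) ^ r = 2 ^ r * 2 ^ r * 2 ^ r := by
    rw [← Real.mul_rpow (by norm_num) (by norm_num), ← Real.mul_rpow (by norm_num) (by norm_num)]
    norm_num
  rw [e2, e3] at hΔ2
  rw [e1] at hτ
  set b := (2 : ℝ) ^ r with hb
  have hn : √d * Δ * M₂ ≤ c / l ^ 2 * (μ ^ 2 * (X ^ 2 * ρ)) := by
    have := mul_le_mul_of_nonneg_left hΔ2 (by positivity : 0 ≤ √d * M₂)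
    refine le_trans (le_of_eq (by ring)) (this.trans (le_of_eq ?_))
    field_simp
  have hcpos : 0 < c * (32 * s * 16 ^ r) := by positivity
  have hc1 : c * (32 * 16 ^ r * Γ) ≤ 1 := by
    rw [← hcdef]
    have : (1 : ℝ) ≤ s * Γ := by nlinarith
    have h0 : 0 ≤ c * (32 * 16 ^ r * Γ) := by positivity
    nlinarith
  have hc2 : 64 * s * c * b ^ 2 * Γ ^ 2 ≤ 1 := by
    rw [← hcdef, h16, h8r]
    have hb4 : 2 * b ^ 2 ≤ b ^ 4 := by
      have : 2 * b ^ 2 ≤ b ^ 2 * b ^ 2 :=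
        mul_le_mul_of_nonneg_right (by nlinarith) (sq_nonneg b)
      linarith [show b ^ 2 * b ^ 2 = b ^ 4 by ring]
    have := mul_le_mul_of_nonneg_left hb4 (by positivity : 0 ≤ 32 * s * c * Γ ^ 2)
    linarith
  exact noise_bounds_aux (by positivity) (by linarith) hμ hM hρ hX0 (by positivity)
    (by positivity) hc0 ht hc1 (by linarith) h16 (hρR.trans (mul_le_mul_of_nonneg_right h8
      (by positivity))) hn hτ

end Schedule

end ZORestart

/-! ### The implicit equations for the parameters of one restart. -/

namespace ZORestart

section ScheduleBounds

variable {d : ℕ} {q : ENNReal} {κ r μ M₂ L ρ Δ σ τ ν : ℝ} {T : ℕ}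

lemma sigmaBase_pos (hd : 0 < d) (ha : 0 < aq d q) (hM : 0 < M₂) : 0 < sigmaBase d q M₂ := by
  unfold sigmaBase; positivity

/-- The noise part of `σ` is dominated by its noiseless part. Absolute values are needed because the
sign of `τ` is not known when this is used. -/
lemma abs_noise_le (ha : 0 < aq d q) {t : ℝ} (ht : t ≠ 0) (hΔ : 0 ≤ Δ)
    (h : 2 * (√d * Δ) ≤ M₂ * |t|) : |d * aq d q * Δ / t| ≤ sigmaBase d q M₂ := by
  have h2 : (2 : ℝ) ^ (1 / 4 : ℝ) ≤ 2 := by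
    simpa using Real.rpow_le_rpow_of_exponent_le (by norm_num : (1 : ℝ) ≤ 2)
      (by norm_num : (1 / 4 : ℝ) ≤ 1)
  have h20 : (0 : ℝ) < (2 : ℝ) ^ (1 / 4 : ℝ) := by positivity
  have hsq : (d : ℝ) = √d * √d := (Real.mul_self_sqrt (Nat.cast_nonneg d)).symm
  have hd0 : 0 ≤ √(d : ℝ) := Real.sqrt_nonneg _
  rw [abs_div, abs_of_nonneg (by positivity : 0 ≤ d * aq d q * Δ),
    div_le_iff₀ (abs_pos.2 ht), sigmaBase, div_mul_eq_mul_div, div_mul_eq_mul_div,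
    div_mul_eq_mul_div, le_div_iff₀ h20]
  calc d * aq d q * Δ * 2 ^ (1 / 4 : ℝ) ≤ d * aq d q * Δ * 2 := by gcongr
    _ = √d * aq d q * (2 * (√d * Δ)) := by
      conv_lhs => rw [hsq]
      ring
    _ ≤ √d * aq d q * (M₂ * |t|) := by gcongr
    _ = _ := by ring

lemma sigmaq_rpow {D : ℝ} (hκ : 0 < κ) (hD0 : 0 ≤ D) (hS : 0 < sigmaBase d q M₂)
    (hD : d * aq d q * Δ / τ = D) :
    sigmaq d q κ M₂ Δ τ ^ (1 + κ) =
      2 ^ κ * sigmaBase d q M₂ ^ (1 + κ) + 2 ^ κ * D ^ (1 + κ) := by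
  rw [sigmaq, hD, ← Real.rpow_mul, one_div_mul_cancel (by positivity), Real.rpow_one]
  · rfl
  · exact add_nonneg (mul_nonneg (by positivity) (Real.rpow_nonneg hS.le _)) (by positivity)

lemma sigmaq_pos_of_nonneg {D : ℝ} (hD0 : 0 ≤ D) (hS : 0 < sigmaBase d q M₂)
    (hD : d * aq d q * Δ / τ = D) : 0 < sigmaq d q κ M₂ Δ τ := by
  rw [sigmaq, hD]
  refine Real.rpow_pos_of_pos ?_ _
  have : 0 < (2 : ℝ) ^ κ * sigmaBase d q M₂ ^ (1 + κ) := by positivity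
  exact add_pos_of_pos_of_nonneg this (by positivity)

lemma sigmaq_nonneg_of_abs_le (hκ : 0 < κ)
    (hD : |d * aq d q * Δ / τ| ≤ sigmaBase d q M₂) : 0 ≤ sigmaq d q κ M₂ Δ τ := by
  rw [sigmaq]
  refine Real.rpow_nonneg ?_ _
  have h1 := Real.abs_rpow_le_abs_rpow (d * aq d q * Δ / τ) (1 + κ)
  have h2 := Real.rpow_le_rpow (abs_nonneg _) hD (by linarith : 0 ≤ 1 + κ)
  have h3 := (abs_le.1 (h1.trans h2)).1
  rw [← mul_add]
  refine mul_nonneg (by positivity) ?_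
  rw [sigmaBase] at h3
  rw [sigmaBase] at *
  linarith

lemma stepFactor_eq (hL : 0 < L) :
    stepConst κ r ^ ((1 + κ) / κ) * L ^ (r * ((1 + κ) / κ)) =
      (stepConst κ r * L ^ r) ^ ((1 + κ) / κ) := by
  have := one_le_stepConst κ r
  rw [Real.mul_rpow (by linarith) (by positivity), ← Real.rpow_mul hL.le]

/-- The schedule of one restart determines its parameters up to constants. -/
lemma epochBounds_of_schedule (hd : 0 < d) (ha : 0 < aq d q) (hκ : 0 < κ) (hκ1 : κ ≤ 1)
    (hr : 1 ≤ r) (hμ : 0 < μ) (hM : 0 < M₂) (hL : 1 ≤ L) (hρ : 0 < ρ)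
    (hρR : μ * ρ ^ (r - 1) ≤ (8 * L) ^ (r - 1) * (4 * M₂)) (hΔ : 0 ≤ Δ)
    (hΔ2 : Δ ≤ noiseConst κ r / L ^ (2 * r) * (μ ^ 2 * ρ ^ (2 * r - 1) / (M₂ * √d)))
    (hσ : σ = sigmaq d q κ M₂ Δ τ)
    (hT1 : stepConst κ r ^ ((1 + κ) / κ) * L ^ (r * ((1 + κ) / κ)) *
      (σ * 2 ^ (1 + r) / (μ * ρ ^ (r - 1))) ^ ((1 + κ) / κ) ≤ T)
    (hT2 : (T : ℝ) ≤ 2 * (stepConst κ r ^ ((1 + κ) / κ) * L ^ (r * ((1 + κ) / κ)) *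
      (σ * 2 ^ (1 + r) / (μ * ρ ^ (r - 1))) ^ ((1 + κ) / κ)))
    (hτ : τ = σ * ρ / (M₂ * (T : ℝ) ^ (κ / (1 + κ))))
    (hν : ν = ρ ^ (1 / κ) / σ * (T : ℝ) ^ (-(1 / (1 + κ)))) :
    EpochBounds d q κ r μ M₂ L ρ Δ σ T τ ν := by
  have hS := sigmaBase_pos hd ha hM
  have hs2 := two_le_sExp hκ hκ1
  have hL0 : 0 < L := by linarith
  have hΓ := one_le_stepConst κ r
  rw [stepFactor_eq hL0] at hT1 hT2
  have hinv : κ / (1 + κ) = ((1 + κ) / κ)⁻¹ := by rw [inv_div]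
  have hκs : 1 / κ = (1 + κ) / κ - 1 := by field_simp; ring
  have hκs2 : (1 + κ) / κ * (1 + κ)⁻¹ = 1 / κ := by field_simp
  have hρr : ρ ^ r = ρ ^ (r - 1) * ρ := by
    rw [← Real.rpow_add_one hρ.ne']; congr 1; ring
  have hnb := fun {t : ℝ} (ht : 0 < t) => noise_bounds (L := L) hd hκ hκ1 hr hμ hM hL hρ hρR hΔ2 ht
  have h2r : (2 : ℝ) ^ (1 + r) = 2 * 2 ^ r := by rw [Real.rpow_add (by norm_num), Real.rpow_one]
  set s := (1 + κ) / κ with hs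
  set Λ := stepConst κ r * L ^ r with hΛ
  have hΛ0 : 0 < Λ := by positivity
  set Q := 2 ^ (1 + r) / (μ * ρ ^ (r - 1)) with hQ
  have hQ0 : 0 < Q := by positivity
  have hσQ : σ * 2 ^ (1 + r) / (μ * ρ ^ (r - 1)) = σ * Q := by rw [hQ, mul_div_assoc]
  rw [hσQ] at hT1 hT2
  have hbQ : μ * ρ ^ r / (2 * 2 ^ r) = ρ / Q := by
    rw [hQ, hρr, h2r]; field_simp
  rw [hbQ] at hnb
  rw [hinv] at hτ
  -- positivity of `T`
  have hτ0 : τ = 0 → 0 < σ := fun h => by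
    rw [hσ]; exact sigmaq_pos_of_nonneg le_rfl hS (by rw [h, div_zero])
  -- With `T = 0`, division by zero gives `τ = 0`, so the noise term vanishes and `σ > 0`; but then
  -- the lower bound on `T` is positive.
  have hTpos : 0 < T := by
    rcases Nat.eq_zero_or_pos T with h | h
    · have h1 : τ = 0 := by
        rw [hτ, h, Nat.cast_zero, Real.zero_rpow (by positivity), mul_zero, div_zero]
      have h2 := hτ0 h1
      rw [h, Nat.cast_zero] at hT1
      have : 0 < Λ ^ s * (σ * Q) ^ s := by positivity
      linarith
    · exact h
  have hT0 : (0 : ℝ) < T := by exact_mod_cast hTpos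
  have hTr0 : 0 < (T : ℝ) ^ s⁻¹ := by positivity
  have hσne : σ ≠ 0 := fun h => by
    have := hτ0 (by rw [hτ, h, zero_mul, zero_div])
    exact this.ne' h
  have hτne : τ ≠ 0 := by
    rw [hτ]; exact div_ne_zero (mul_ne_zero hσne hρ.ne') (by positivity)
  have hTle : (T : ℝ) ^ s⁻¹ ≤ 2 * (Λ * (|σ| * Q)) := by
    have h1 : (T : ℝ) ≤ (2 * (Λ * (|σ| * Q))) ^ s := by
      refine hT2.trans ?_
      have h2 : (σ * Q) ^ s ≤ (|σ| * Q) ^ s := by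
        refine (le_abs_self _).trans ((Real.abs_rpow_le_abs_rpow _ _).trans (le_of_eq ?_))
        rw [abs_mul, abs_of_pos hQ0]
      have h3 : (2 : ℝ) ≤ 2 ^ s := by
        simpa using Real.rpow_le_rpow_of_exponent_le (by norm_num : (1 : ℝ) ≤ 2)
          (by linarith : 1 ≤ s)
      rw [Real.mul_rpow (x := 2) (by norm_num) (by positivity),
        Real.mul_rpow (x := Λ) hΛ0.le (by positivity)]
      calc 2 * (Λ ^ s * (σ * Q) ^ s) ≤ 2 * (Λ ^ s * (|σ| * Q) ^ s) := by gcongr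
        _ ≤ _ := by gcongr
    calc (T : ℝ) ^ s⁻¹ ≤ ((2 * (Λ * (|σ| * Q))) ^ s) ^ s⁻¹ :=
          Real.rpow_le_rpow hT0.le h1 (by positivity)
      _ = _ := Real.rpow_rpow_inv (by positivity) (by positivity)
  -- The signs are recovered in this order: `|τ|` is bounded below, so the noise term is dominated
  -- in absolute value, so `σ ≥ 0`, so `τ > 0`. Only the upper bound on `T` enters here.
  have hlow : ρ / Q / (2 * Λ) ≤ M₂ * |τ| := by
    have : M₂ * |τ| = |σ| * ρ / (T : ℝ) ^ s⁻¹ := by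
      rw [hτ, abs_div, abs_mul, abs_mul, abs_of_pos hρ, abs_of_pos hM, abs_of_pos hTr0]
      field_simp
    rw [this, le_div_iff₀ hTr0]
    refine (mul_le_mul_of_nonneg_left hTle (by positivity)).trans (le_of_eq ?_)
    field_simp
  have hD := abs_noise_le ha hτne hΔ (hnb (abs_pos.2 hτne) hlow).1
  have hσpos : 0 < σ := lt_of_le_of_ne
    (by rw [hσ]; exact sigmaq_nonneg_of_abs_le hκ hD) hσne.symm
  have hτpos : 0 < τ := by rw [hτ]; positivity
  rw [abs_of_pos hτpos] at hlow
  have hD0 : 0 ≤ d * aq d q * Δ / τ := by positivity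
  rw [abs_of_nonneg hD0] at hD
  have hσpow := sigmaq_rpow hκ hD0 hS rfl
  rw [← hσ] at hσpow
  have h2κ : (1 : ℝ) ≤ 2 ^ κ := Real.one_le_rpow (by norm_num) hκ.le
  have hMτ : M₂ * τ = σ * ρ / (T : ℝ) ^ s⁻¹ := by rw [hτ]; field_simp
  refine ⟨hTpos, hσpos, hτpos, by rw [hν]; positivity, ?_, ?_, ?_, (hnb hτpos hlow).2, ?_, ?_⟩
  · rw [hσpow, ← mul_add]
    exact le_mul_of_one_le_left (by positivity) h2κ
  · have h1 : σ ^ (1 + κ) ≤ (2 * sigmaBase d q M₂) ^ (1 + κ) := by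
      rw [hσpow, Real.mul_rpow (by norm_num) hS.le, Real.rpow_add (x := 2) (by norm_num),
        Real.rpow_one]
      have := Real.rpow_le_rpow hD0 hD (by linarith : 0 ≤ 1 + κ)
      have := mul_le_mul_of_nonneg_left this (by positivity : 0 ≤ (2 : ℝ) ^ κ)
      linarith
    exact (Real.rpow_le_rpow_iff hσpos.le (by positivity) (by positivity)).1 h1
  · rw [hbQ, hMτ]
    have h1 : Λ * (σ * Q) ≤ (T : ℝ) ^ s⁻¹ := by
      rw [← Real.mul_rpow hΛ0.le (by positivity)] at hT1
      calc Λ * (σ * Q) = ((Λ * (σ * Q)) ^ s) ^ s⁻¹ :=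
            (Real.rpow_rpow_inv (by positivity) (by positivity)).symm
        _ ≤ _ := Real.rpow_le_rpow (by positivity) hT1 (by positivity)
    rw [div_le_iff₀ hTr0]
    calc σ * ρ = ρ / Q / Λ * (Λ * (σ * Q)) := by field_simp
      _ ≤ _ := by gcongr
  · rw [hMτ, hν]
    have h1 : (T : ℝ) ^ (-(1 / (1 + κ))) * T = (T : ℝ) ^ s⁻¹ := by
      rw [← Real.rpow_add_one hT0.ne']
      congr 1
      rw [← hinv]; field_simp; ring
    have h2 : ρ ^ (1 / κ) * ρ = ρ ^ s := by
      rw [← Real.rpow_add_one hρ.ne', hκs]; congr 1; ring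
    rw [← h2, mul_assoc, h1]
    field_simp
  · rw [hν, ← Real.mul_rpow (by positivity) hσpos.le]
    have h1 : ρ ^ (1 / κ) / σ * (T : ℝ) ^ (-(1 / (1 + κ))) * σ =
        ρ ^ (1 / κ) * (T : ℝ) ^ (-(1 / (1 + κ))) := by field_simp
    rw [h1, Real.mul_rpow (by positivity) (by positivity), ← Real.rpow_mul hρ.le,
      ← Real.rpow_mul hT0.le, neg_mul, one_div_mul_cancel (by positivity), Real.rpow_neg_one,
      mul_assoc, inv_mul_cancel₀ hT0.ne', mul_one]
    congr 1; field_simp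

/-- Every admissible noise level admits a choice of the parameters of one restart. -/
lemma exists_schedule (hd : 0 < d) (ha : 0 < aq d q) (hda : 1 ≤ √d * aq d q) (hκ : 0 < κ)
    (hκ1 : κ ≤ 1) (hr : (1 + κ) / κ ≤ r) (hμ : 0 < μ) (hM : 0 < M₂) (hL : 1 ≤ L) (hρ : 0 < ρ)
    (hρR : μ * ρ ^ (r - 1) ≤ (8 * L) ^ (r - 1) * (4 * M₂)) (hΔ : 0 ≤ Δ) :
    ∃ (σ : ℝ) (T : ℕ) (τ ν : ℝ), σ = sigmaq d q κ M₂ Δ τ ∧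
      stepConst κ r ^ ((1 + κ) / κ) * L ^ (r * ((1 + κ) / κ)) *
        (σ * 2 ^ (1 + r) / (μ * ρ ^ (r - 1))) ^ ((1 + κ) / κ) ≤ T ∧
      (T : ℝ) ≤ 2 * (stepConst κ r ^ ((1 + κ) / κ) * L ^ (r * ((1 + κ) / κ)) *
        (σ * 2 ^ (1 + r) / (μ * ρ ^ (r - 1))) ^ ((1 + κ) / κ)) ∧
      τ = σ * ρ / (M₂ * (T : ℝ) ^ (κ / (1 + κ))) ∧
      ν = ρ ^ (1 / κ) / σ * (T : ℝ) ^ (-(1 / (1 + κ))) := by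
  have hS := sigmaBase_pos hd ha hM
  have hs2 := two_le_sExp hκ hκ1
  have hL0 : 0 < L := by linarith
  have hΓ := one_le_stepConst κ r
  have hinv : κ / (1 + κ) = ((1 + κ) / κ)⁻¹ := by rw [inv_div]
  rw [stepFactor_eq hL0, hinv]
  have hΛlow : (8 * L) ^ (r - 1) * 4 ≤ stepConst κ r * L ^ r := by
    have h8 : (8 * L) ^ (r - 1) ≤ 8 ^ r * L ^ r := by
      rw [← Real.mul_rpow (by norm_num) hL0.le]
      exact Real.rpow_le_rpow_of_exponent_le (by linarith) (by linarith)
    have h2 : 4 * 8 ^ r ≤ stepConst κ r := by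
      have : (0 : ℝ) < 2 ^ ((1 + κ) / κ) := by positivity
      unfold stepConst; linarith
    calc (8 * L) ^ (r - 1) * 4 ≤ 8 ^ r * L ^ r * 4 := by gcongr
      _ = 4 * 8 ^ r * L ^ r := by ring
      _ ≤ _ := by gcongr
  set s := (1 + κ) / κ with hs
  set Λ := stepConst κ r * L ^ r with hΛ
  have hΛ0 : 0 < Λ := by positivity
  have h2r : (2 : ℝ) ≤ 2 ^ (1 + r) := by
    simpa using Real.rpow_le_rpow_of_exponent_le (by norm_num : (1 : ℝ) ≤ 2)
      (by linarith : 1 ≤ 1 + r)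
  set X := ρ ^ (r - 1) with hX
  have hX0 : 0 < X := by positivity
  set Q := 2 ^ (1 + r) / (μ * X) with hQ
  have hQ0 : 0 < Q := by positivity
  have hσQ : ∀ σ : ℝ, σ * 2 ^ (1 + r) / (μ * X) = σ * Q := fun σ => by
    rw [hQ, mul_div_assoc]
  simp_rw [hσQ]
  -- The ansatz `T = x (Λ σ Q)^s` with a free factor `x ∈ [1, 2]` breaks the circle: `σ` cancels
  -- from `τ`, so the noise term becomes the explicit function `D x`, then `σ = S x` and `T = H x`.
  -- It remains to make `H x` an integer.
  set D : ℝ → ℝ := fun x => d * aq d q * Δ * (M₂ * (x ^ s⁻¹ * Λ) * Q / ρ) with hD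
  set S : ℝ → ℝ := fun x => ((2 : ℝ) ^ κ * sigmaBase d q M₂ ^ (1 + κ) +
    (2 : ℝ) ^ κ * D x ^ (1 + κ)) ^ (1 / (1 + κ)) with hSdef
  set H : ℝ → ℝ := fun x => x * (Λ * (S x * Q)) ^ s with hH
  have hD0 : ∀ x, 0 ≤ x → 0 ≤ D x := fun x hx => by rw [hD]; positivity
  have hcont : Continuous H := by
    have h1 : Continuous D := by
      rw [hD]
      have : Continuous fun x : ℝ => x ^ s⁻¹ :=
        continuous_id.rpow_const fun x => Or.inr (by positivity)
      fun_prop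
    have h2 : Continuous S := by
      rw [hSdef]
      exact (continuous_const.add (continuous_const.mul (h1.rpow_const fun x =>
        Or.inr (by linarith)))).rpow_const fun x => Or.inr (by positivity)
    rw [hH]
    exact continuous_id.mul ((continuous_const.mul (h2.mul continuous_const)).rpow_const
      fun x => Or.inr (by positivity))
  have hSge : ∀ x, 0 ≤ x → sigmaBase d q M₂ ≤ S x := by
    intro x hx
    have h2κ : (1 : ℝ) ≤ 2 ^ κ := Real.one_le_rpow (by norm_num) hκ.le
    have := hD0 x hx
    have h1 : sigmaBase d q M₂ ^ (1 + κ) ≤ (2 : ℝ) ^ κ * sigmaBase d q M₂ ^ (1 + κ) +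
        (2 : ℝ) ^ κ * D x ^ (1 + κ) :=
      (le_mul_of_one_le_left (by positivity) h2κ).trans
        (le_add_of_nonneg_right (by positivity))
    have h2 := Real.rpow_le_rpow (by positivity) h1 (by positivity : 0 ≤ 1 / (1 + κ))
    rwa [← Real.rpow_mul hS.le, mul_one_div_cancel (by positivity), Real.rpow_one] at h2
  have hSpos : ∀ x, 0 ≤ x → 0 < S x := fun x hx => hS.trans_le (hSge x hx)
  have hSmono : S 1 ≤ S 2 := by
    have h1 := hD0 1 zero_le_one
    have h2 : D 1 ≤ D 2 := by
      have : (1 : ℝ) ^ s⁻¹ ≤ 2 ^ s⁻¹ :=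
        Real.rpow_le_rpow (by norm_num) (by norm_num) (by positivity)
      simp only [hD]
      gcongr
    simp only [hSdef]
    gcongr
  have hH12 : 2 * H 1 ≤ H 2 := by
    have h1 := (hSpos 1 zero_le_one).le
    simp only [hH, one_mul]
    gcongr
  have hH1 : 1 ≤ H 1 := by
    simp only [hH, one_mul]
    refine Real.one_le_rpow ?_ (by positivity)
    have h4 : (2 : ℝ) ^ (1 / 4 : ℝ) ≤ 2 := by
      simpa using Real.rpow_le_rpow_of_exponent_le (by norm_num : (1 : ℝ) ≤ 2)
        (by norm_num : (1 / 4 : ℝ) ≤ 1)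
    have hb : M₂ / 2 ≤ sigmaBase d q M₂ := by
      have : sigmaBase d q M₂ = √d * aq d q * (M₂ / (2 : ℝ) ^ (1 / 4 : ℝ)) := by
        rw [sigmaBase]; ring
      rw [this]
      calc M₂ / 2 ≤ M₂ / (2 : ℝ) ^ (1 / 4 : ℝ) := by gcongr
        _ ≤ _ := le_mul_of_one_le_left (by positivity) hda
    have hΛX : μ * X ≤ Λ * M₂ := by nlinarith
    calc (1 : ℝ) = μ * X * (1 / 2 * (2 / (μ * X))) := by field_simp
      _ ≤ Λ * M₂ * (1 / 2 * (2 ^ (1 + r) / (μ * X))) := by gcongr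
      _ = Λ * (M₂ / 2 * Q) := by rw [hQ]; ring
      _ ≤ Λ * (S 1 * Q) := by
        have := hb.trans (hSge 1 zero_le_one)
        gcongr
  -- As `H 1 ≥ 1`, the ceiling lies between `H 1` and `H 1 + 1 ≤ 2 H 1 ≤ H 2`.
  obtain ⟨x, hx, hxT⟩ : ((⌈H 1⌉₊ : ℕ) : ℝ) ∈ H '' Set.Icc 1 2 := by
    refine intermediate_value_Icc (by norm_num) hcont.continuousOn ⟨Nat.le_ceil _, ?_⟩
    have := Nat.ceil_lt_add_one (by linarith : 0 ≤ H 1)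
    linarith
  have hx0 : 0 < x := by linarith [hx.1]
  have hσ0 := hSpos x hx0.le
  have hTpow : ((⌈H 1⌉₊ : ℕ) : ℝ) ^ s⁻¹ = x ^ s⁻¹ * (Λ * (S x * Q)) := by
    rw [← hxT, hH]
    simp only
    rw [Real.mul_rpow hx0.le (by positivity), Real.rpow_rpow_inv (by positivity) (by positivity)]
  refine ⟨S x, ⌈H 1⌉₊, S x * ρ / (M₂ * ((⌈H 1⌉₊ : ℕ) : ℝ) ^ s⁻¹), _, ?_, ?_, ?_, rfl, rfl⟩
  · have : d * aq d q * Δ / (S x * ρ / (M₂ * ((⌈H 1⌉₊ : ℕ) : ℝ) ^ s⁻¹)) = D x := by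
      rw [hTpow, hD]
      field_simp
    rw [sigmaq, this]
    rfl
  · rw [← Real.mul_rpow hΛ0.le (by positivity), ← hxT]
    exact le_mul_of_one_le_left (by positivity) hx.1
  · rw [← Real.mul_rpow hΛ0.le (by positivity), ← hxT]
    exact mul_le_mul_of_nonneg_right hx.2 (by positivity)

end ScheduleBounds

end ZORestart

/-! ### Number of restarts, last noise level and total number of steps. -/

namespace ZORestart

section Rounding

variable {d : ℕ} {q : ENNReal} {κ r μ ε R L M₂ : ℝ}

/-- The target radius `Z = (2ε/μ)^(1/r)` solves `(μ/2) Z^r = ε`, and the number of restarts is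
`⌈log₂ (R / Z)⌉`. Rounding makes the last radius smaller than `Z` by a factor of at most two. -/
lemma numRestarts_spec (hr : 1 ≤ r) (hμ : 0 < μ) (hε : 0 < ε) (hR : 0 < R)
    (h : 2 * ε < μ * R ^ r) :
    1 ≤ numRestarts r μ ε R ∧ R / 2 ^ numRestarts r μ ε R ≤ (2 * ε / μ) ^ (1 / r) ∧
      (2 * ε / μ) ^ (1 / r) ≤ 2 * (R / 2 ^ numRestarts r μ ε R) := by
  have hr0 : 0 < r := by linarith
  set Z := (2 * ε / μ) ^ (1 / r) with hZ
  have hZ0 : 0 < Z := by positivity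
  have hZr : Z ^ r = 2 * ε / μ := by
    rw [hZ, ← Real.rpow_mul (by positivity), one_div_mul_cancel hr0.ne', Real.rpow_one]
  have hX : μ * R ^ r / (2 * ε) = (R / Z) ^ r := by
    rw [Real.div_rpow hR.le hZ0.le, hZr]; field_simp
  have hZR : Z < R := by
    refine (Real.rpow_lt_rpow_iff hZ0.le hR.le hr0).1 ?_
    rw [hZr, div_lt_iff₀ hμ]; linarith
  have hY1 : 1 < R / Z := (one_lt_div hZ0).2 hZR
  have hN : numRestarts r μ ε R = ⌈Real.logb 2 (R / Z)⌉₊ := by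
    rw [numRestarts, hX, Real.logb_rpow_eq_mul_logb_of_pos (by positivity), ← mul_assoc,
      one_div_mul_cancel hr0.ne', one_mul]
  have hlog : 0 < Real.logb 2 (R / Z) := Real.logb_pos (by norm_num) hY1
  set N := numRestarts r μ ε R
  have h1 : R / Z ≤ 2 ^ N := by
    have := Nat.le_ceil (Real.logb 2 (R / Z))
    rw [← hN, Real.logb_le_iff_le_rpow (by norm_num) (by positivity), Real.rpow_natCast] at this
    exact this
  have h2 : (2 : ℝ) ^ N ≤ 2 * (R / Z) := by
    have := Nat.ceil_lt_add_one hlog.le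
    rw [← hN] at this
    have h3 : ((N : ℝ) - 1) ≤ Real.logb 2 (R / Z) := by linarith
    rw [Real.le_logb_iff_rpow_le (by norm_num) (by positivity),
      Real.rpow_sub_one (by norm_num), Real.rpow_natCast] at h3
    linarith
  refine ⟨?_, ?_, ?_⟩
  · rw [hN]; exact Nat.ceil_pos.2 hlog
  · rw [div_le_iff₀ hZ0] at h1
    rw [div_le_iff₀ (by positivity)]
    linarith
  · rw [← mul_div_assoc] at h2 ⊢
    rw [le_div_iff₀ hZ0] at h2
    rw [le_div_iff₀ (by positivity)]
    linarith

/-- The common scale of the last noise level and the accuracy. -/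
lemma noise_scale (hr : 1 ≤ r) (hμ : 0 < μ) (hε : 0 < ε) :
    μ ^ 2 * ((2 * ε / μ) ^ (1 / r)) ^ (2 * r - 1) =
      2 ^ (2 - 1 / r) * (μ ^ (1 / r) * ε ^ (2 - 1 / r)) := by
  have hr0 : 0 < r := by linarith
  rw [← Real.rpow_mul (by positivity), show 1 / r * (2 * r - 1) = 2 - 1 / r by field_simp,
    Real.div_rpow (by positivity) hμ.le, Real.mul_rpow (by norm_num) hε.le]
  have : μ ^ 2 = μ ^ (2 - 1 / r) * μ ^ (1 / r) := by
    rw [← Real.rpow_add hμ, ← Real.rpow_natCast]; congr 1; push_cast; ring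
  rw [this]
  field_simp

/-- The admissible noise level of the last restart. -/
lemma noiseLevel_bounds (hd : 0 < d) (hr : 1 ≤ r) (hμ : 0 < μ) (hε : 0 < ε) (hR : 0 < R)
    (hM : 0 < M₂) (h : 2 * ε < μ * R ^ r) :
    2 ^ (-(2 * r)) * (μ ^ (1 / r) / (M₂ * √d) * ε ^ (2 - 1 / r)) ≤
        noiseLevel d r μ M₂ R (numRestarts r μ ε R) ∧
      noiseLevel d r μ M₂ R (numRestarts r μ ε R) ≤
        4 * (μ ^ (1 / r) / (M₂ * √d) * ε ^ (2 - 1 / r)) := by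
  obtain ⟨-, h1, h2⟩ := numRestarts_spec hr hμ hε hR h
  have hsc := noise_scale hr hμ hε
  rw [noiseLevel_eq _ _ _ _ hR.le]
  set ρ := R / 2 ^ numRestarts r μ ε R
  have hρ : 0 < ρ := by positivity
  set Z := (2 * ε / μ) ^ (1 / r)
  have hZ : 0 < Z := by positivity
  have hd0 : 0 < √(d : ℝ) := by positivity
  have hr0 : 0 < r := by linarith
  have hexp : 1 / r ≤ 1 := by rw [div_le_one hr0]; exact hr
  have hexp0 : 0 < 1 / r := by positivity
  have key : ∀ c, c * (μ ^ (1 / r) / (M₂ * √d) * ε ^ (2 - 1 / r)) =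
      c * (μ ^ (1 / r) * ε ^ (2 - 1 / r)) / (M₂ * √d) := fun c => by ring
  rw [key, key]
  constructor
  · rw [div_le_div_iff_of_pos_right (by positivity)]
    have h3 : Z ^ (2 * r - 1) ≤ 2 ^ (2 * r) * ρ ^ (2 * r - 1) := by
      refine (Real.rpow_le_rpow hZ.le h2 (by linarith)).trans ?_
      rw [Real.mul_rpow (by norm_num) hρ.le]
      gcongr
      · norm_num
      · linarith
    have h4 : (1 : ℝ) ≤ 2 ^ (2 - 1 / r) := Real.one_le_rpow (by norm_num) (by linarith)
    have h5 : 0 ≤ μ ^ (1 / r) * ε ^ (2 - 1 / r) := by positivity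
    have h6 := mul_le_mul_of_nonneg_right h4 h5
    rw [Real.rpow_neg (by norm_num), inv_mul_le_iff₀ (by positivity)]
    have h7 := mul_le_mul_of_nonneg_left h3 (sq_nonneg μ)
    linarith
  · rw [div_le_div_iff_of_pos_right (by positivity)]
    have h3 : ρ ^ (2 * r - 1) ≤ Z ^ (2 * r - 1) := Real.rpow_le_rpow hρ.le h1 (by linarith)
    have h4 : (2 : ℝ) ^ (2 - 1 / r) ≤ 4 := by
      calc (2 : ℝ) ^ (2 - 1 / r) ≤ 2 ^ (2 : ℝ) :=
            Real.rpow_le_rpow_of_exponent_le (by norm_num) (by linarith)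
        _ = 4 := by norm_num
    have h5 : 0 ≤ μ ^ (1 / r) * ε ^ (2 - 1 / r) := by positivity
    have h6 := mul_le_mul_of_nonneg_right h4 h5
    have h7 := mul_le_mul_of_nonneg_left h3 (sq_nonneg μ)
    linarith

lemma sum_geometric_le (N : ℕ) {x : ℝ} (hx : 2 ≤ x) :
    ∑ k ∈ Finset.Icc 1 N, x ^ k ≤ 2 * x ^ N := by
  induction N with
  | zero => simp
  | succ n ih =>
    rw [Finset.sum_Icc_succ_top (by omega), pow_succ]
    have : 0 ≤ x ^ n := by positivity
    nlinarith

/-- The total number of steps. -/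
lemma sum_steps_le (hκ : 0 < κ) (hκ1 : κ ≤ 1) (hr : 2 ≤ r) (hμ : 0 < μ) (hε : 0 < ε)
    (hR : 0 < R) (hM : 0 < M₂) (ha : 0 < aq d q) (hd : 0 < d) (h : 2 * ε < μ * R ^ r) {Λ : ℝ}
    (hΛ : 0 < Λ) {T : ℕ → ℕ}
    (hT : ∀ k ∈ Finset.Icc 1 (numRestarts r μ ε R), (T k : ℝ) ≤ 2 * (Λ *
      (2 * sigmaBase d q M₂ * 2 ^ (1 + r) / (μ * (R / 2 ^ k) ^ (r - 1))) ^ ((1 + κ) / κ))) :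
    ((∑ k ∈ Finset.Icc 1 (numRestarts r μ ε R), T k : ℕ) : ℝ) ≤
      4 * Λ * (2 ^ (1 + 2 * r)) ^ ((1 + κ) / κ) *
        (aq d q * M₂ * √d / μ ^ (1 / r) * (1 / ε ^ ((r - 1) / r))) ^ ((1 + κ) / κ) := by
  obtain ⟨-, -, h2⟩ := numRestarts_spec (by linarith) hμ hε hR h
  set N := numRestarts r μ ε R
  have hS := sigmaBase_pos (M₂ := M₂) hd ha hM
  have hs2 := two_le_sExp hκ hκ1
  have hr0 : 0 < r := by linarith
  have hd0 : 0 < √(d : ℝ) := by positivity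
  set s := (1 + κ) / κ
  -- The ratio of consecutive step bounds. It is at least `2`, so the last restart accounts for at
  -- least half of the sum.
  set x := ((2 : ℝ) ^ (r - 1)) ^ s with hx
  have hx2 : 2 ≤ x := by
    rw [hx, ← Real.rpow_mul (by norm_num)]
    calc (2 : ℝ) = 2 ^ (1 : ℝ) := by norm_num
      _ ≤ 2 ^ ((r - 1) * s) := Real.rpow_le_rpow_of_exponent_le (by norm_num) (by nlinarith)
  set Y := 2 * sigmaBase d q M₂ * 2 ^ (1 + r) / (μ * R ^ (r - 1)) with hY
  have hY0 : 0 < Y := by positivity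
  have hterm : ∀ k : ℕ, (2 * sigmaBase d q M₂ * 2 ^ (1 + r) / (μ * (R / 2 ^ k) ^ (r - 1))) ^ s =
      Y ^ s * x ^ k := by
    intro k
    have : 2 * sigmaBase d q M₂ * 2 ^ (1 + r) / (μ * (R / 2 ^ k) ^ (r - 1)) =
        Y * ((2 : ℝ) ^ (r - 1)) ^ k := by
      rw [Real.div_rpow hR.le (by positivity), hY, ← Real.rpow_natCast, ← Real.rpow_natCast,
        ← Real.rpow_mul (by norm_num), ← Real.rpow_mul (by norm_num), mul_comm (r - 1)]
      field_simp
    rw [this, Real.mul_rpow hY0.le (by positivity), hx,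
      Real.rpow_pow_comm (x := (2 : ℝ) ^ (r - 1)) (by positivity) s k]
  push_cast
  calc ∑ k ∈ Finset.Icc 1 N, (T k : ℝ) ≤ ∑ k ∈ Finset.Icc 1 N, 2 * Λ * Y ^ s * x ^ k := by
        refine Finset.sum_le_sum fun k hk => (hT k hk).trans (le_of_eq ?_)
        rw [hterm]; ring
    _ = 2 * Λ * Y ^ s * ∑ k ∈ Finset.Icc 1 N, x ^ k := by rw [Finset.mul_sum]
    _ ≤ 2 * Λ * Y ^ s * (2 * x ^ N) := by
        gcongr
        exact sum_geometric_le N hx2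
    _ = 4 * Λ * (Y ^ s * x ^ N) := by ring
    _ ≤ 4 * Λ * ((2 ^ (1 + 2 * r)) ^ s *
        (aq d q * M₂ * √d / μ ^ (1 / r) * (1 / ε ^ ((r - 1) / r))) ^ s) := by
      rw [← hterm, ← Real.mul_rpow (by positivity) (by positivity)]
      refine mul_le_mul_of_nonneg_left (Real.rpow_le_rpow (by positivity) ?_ (by positivity))
        (by positivity)
      have hSle : sigmaBase d q M₂ ≤ aq d q * M₂ * √d := by
        have h4 : (1 : ℝ) ≤ (2 : ℝ) ^ (1 / 4 : ℝ) := Real.one_le_rpow (by norm_num) (by norm_num)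
        rw [sigmaBase]
        calc √d / (2 : ℝ) ^ (1 / 4 : ℝ) * aq d q * M₂ ≤ √d * aq d q * M₂ := by
              gcongr
              exact div_le_self hd0.le h4
          _ = _ := by ring
      have hlow : (ε / μ) ^ ((r - 1) / r) ≤ 2 ^ (r - 1) * (R / 2 ^ N) ^ (r - 1) := by
        rw [← Real.mul_rpow (by norm_num) (by positivity),
          show (r - 1) / r = 1 / r * (r - 1) by ring, Real.rpow_mul (by positivity)]
        refine Real.rpow_le_rpow (by positivity) (le_trans ?_ h2) (by linarith)
        gcongr
        linarith
      have hμe : μ = μ ^ (1 / r) * μ ^ ((r - 1) / r) := by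
        rw [← Real.rpow_add hμ, show 1 / r + (r - 1) / r = 1 by field_simp; ring, Real.rpow_one]
      rw [Real.div_rpow hε.le hμ.le, div_le_iff₀ (by positivity)] at hlow
      rw [div_le_iff₀ (by positivity)]
      have e1 : (2 : ℝ) ^ (1 + 2 * r) = 2 * 2 ^ (1 + r) * 2 ^ (r - 1) := by
        rw [mul_assoc, ← Real.rpow_add (by norm_num), ← Real.rpow_one_add' (by norm_num) (by linarith)]
        congr 1; ring
      rw [e1]
      calc 2 * sigmaBase d q M₂ * 2 ^ (1 + r)
          ≤ 2 * (aq d q * M₂ * √d) * 2 ^ (1 + r) := by gcongr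
        _ = 2 * (aq d q * M₂ * √d) * 2 ^ (1 + r) / ε ^ ((r - 1) / r) * ε ^ ((r - 1) / r) := by
          field_simp
        _ ≤ 2 * (aq d q * M₂ * √d) * 2 ^ (1 + r) / ε ^ ((r - 1) / r) *
            (2 ^ (r - 1) * (R / 2 ^ N) ^ (r - 1) * μ ^ ((r - 1) / r)) := by gcongr
        _ = 2 * 2 ^ (1 + r) * 2 ^ (r - 1) * (aq d q * M₂ * √d / μ ^ (1 / r) *
            (1 / ε ^ ((r - 1) / r))) * (μ ^ (1 / r) * μ ^ ((r - 1) / r) *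
              (R / 2 ^ N) ^ (r - 1)) := by field_simp
        _ = _ := by rw [← hμe]
    _ = _ := by ring

end Rounding

end ZORestart

/-! ### Extension of the objective beyond the neighbourhood of `X`. -/

namespace ZORestart

section Objective

variable {d : ℕ}

lemma nbhd_eq_image (X : Set (Vec d)) (t : ℝ) :
    nbhd X t = (fun a : Vec d × Vec d => a.1 + t • a.2) '' (X ×ˢ Metric.closedBall 0 1) := by
  ext z
  constructor
  · rintro ⟨x, hx, u, hu, rfl⟩
    exact ⟨(x, u), ⟨hx, by simpa using hu⟩, rfl⟩
  · rintro ⟨⟨x, u⟩, ⟨hx, hu⟩, rfl⟩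
    exact ⟨x, hx, u, by simpa using hu, rfl⟩

lemma isCompact_nbhd {X : Set (Vec d)} (hX : IsCompact X) (t : ℝ) : IsCompact (nbhd X t) := by
  rw [nbhd_eq_image]
  exact (hX.prod (isCompact_closedBall _ _)).image (by fun_prop)

lemma convex_nbhd {X : Set (Vec d)} (hX : Convex ℝ X) (t : ℝ) : Convex ℝ (nbhd X t) := by
  rintro _ ⟨x, hx, u, hu, rfl⟩ _ ⟨y, hy, v, hv, rfl⟩ a b ha hb hab
  refine ⟨a • x + b • y, hX hx hy ha hb hab, a • u + b • v, ?_, by module⟩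
  refine (norm_add_le _ _).trans ?_
  rw [norm_smul, norm_smul, Real.norm_of_nonneg ha, Real.norm_of_nonneg hb]
  nlinarith

lemma add_smul_mem_nbhd {X : Set (Vec d)} {t τ : ℝ} (ht : 0 < t) (hτ : 0 ≤ τ) (hτt : τ ≤ t)
    {x u : Vec d} (hx : x ∈ X) (hu : ‖u‖ ≤ 1) : x + τ • u ∈ nbhd X t := by
  refine ⟨x, hx, (τ / t) • u, ?_, ?_⟩
  · rw [norm_smul, Real.norm_of_nonneg (by positivity)]
    have : τ / t ≤ 1 := (div_le_one ht).2 hτt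
    nlinarith [norm_nonneg u]
  · rw [smul_smul, mul_div_cancel₀ _ ht.ne']

lemma mem_nbhd_of_mem {X : Set (Vec d)} {t : ℝ} {x : Vec d} (hx : x ∈ X) : x ∈ nbhd X t :=
  ⟨x, hx, 0, by simp, by simp⟩

/-- A nonexpansive retraction onto a compact convex set. -/
lemma exists_nonexpansive_retraction {K : Set (Vec d)} (hK : IsCompact K) (hc : Convex ℝ K)
    (hn : K.Nonempty) : ∃ π : Vec d → Vec d, (∀ x, π x ∈ K) ∧ (∀ x ∈ K, π x = x) ∧
      ∀ x y, ‖π x - π y‖ ≤ ‖x - y‖ := by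
  have hex : ∀ u : Vec d, ∃ v ∈ K, ∀ w ∈ K, inner ℝ (u - v) (w - v) ≤ 0 := by
    intro u
    obtain ⟨v, hv, h⟩ := exists_norm_eq_iInf_of_complete_convex hn hK.isComplete hc u
    exact ⟨v, hv, (norm_eq_iInf_iff_real_inner_le_zero hc hv).1 h⟩
  choose π hπ hin using hex
  have hne : ∀ x y, ‖π x - π y‖ ≤ ‖x - y‖ := by
    intro x y
    have h1 := hin x (π y) (hπ y)
    have h2 := hin y (π x) (hπ x)
    have h3 : ‖π x - π y‖ ^ 2 = inner ℝ (x - y) (π x - π y) + inner ℝ (x - π x) (π y - π x) +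
        inner ℝ (y - π y) (π x - π y) := by
      rw [← real_inner_self_eq_norm_sq]
      simp only [inner_sub_left, inner_sub_right]
      ring
    have h4 := real_inner_le_norm (x - y) (π x - π y)
    rcases (norm_nonneg (π x - π y)).eq_or_lt with h | h
    · rw [← h]; positivity
    · refine le_of_mul_le_mul_right ?_ h
      nlinarith
  refine ⟨π, hπ, fun x hx => ?_, hne⟩
  have := hin x x hx
  rw [real_inner_self_eq_norm_sq] at this
  have h0 : ‖x - π x‖ = 0 := by nlinarith [norm_nonneg (x - π x)]
  exact (sub_eq_zero.1 (norm_eq_zero.1 h0)).symm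

variable {Ξ : Type*} [MeasurableSpace Ξ]

/-- A stochastic objective that is Lipschitz on the whole space. -/
structure IsLipschitzObjective (κ M₂ : ℝ) (S X : Set (Vec d)) (𝒟 : Measure Ξ)
    (h : Vec d → Ξ → ℝ) (K : Ξ → ℝ) : Prop where
  le : ∀ s, M₂ ≤ K s
  integrable_lip : Integrable K 𝒟
  integrable_rpow : Integrable (fun s => K s ^ (1 + κ)) 𝒟
  integral_lip : ∫ s, K s ∂𝒟 ≤ 2 * M₂
  integral_rpow : ∫ s, K s ^ (1 + κ) ∂𝒟 ≤ 2 * M₂ ^ (1 + κ)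
  lipschitz : ∀ s x y, |h x s - h y s| ≤ K s * ‖x - y‖
  measurable : ∀ x, Measurable (h x)
  convex : ∀ s, ConvexOn ℝ S fun x => h x s
  integrable : ∀ x ∈ X, Integrable (h x) 𝒟

/-- An objective that is Lipschitz near `X` agrees there with a globally Lipschitz one. -/
lemma IsObjective.exists_extension {κ M₂ t : ℝ} (hκ : 0 < κ) (hM : 0 < M₂) {X : Set (Vec d)}
    (hXc : IsCompact X) (hX : Convex ℝ X) (hXn : X.Nonempty) {𝒟 : Measure Ξ}
    [IsProbabilityMeasure 𝒟] {f : Vec d → Ξ → ℝ} (hf : IsObjective κ M₂ t X 𝒟 f) :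
    ∃ h K, IsLipschitzObjective κ M₂ (nbhd X t) X 𝒟 h K ∧
      ∀ x ∈ nbhd X t, ∀ s, h x s = f x s := by
  obtain ⟨M, hM0, hlip, hint, hle⟩ := hf.lipschitz
  obtain ⟨π, hπ, hid, hne⟩ := exists_nonexpansive_retraction (isCompact_nbhd hXc t)
    (convex_nbhd hX t) (hXn.mono fun x hx => mem_nbhd_of_mem hx)
  have hκ0 : 0 < 1 + κ := by linarith
  have hmax : ∀ s, max (M s) M₂ ^ (1 + κ) ≤ M s ^ (1 + κ) + M₂ ^ (1 + κ) := by
    intro s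
    have h1 := Real.rpow_nonneg (hM0 s) (1 + κ)
    have h2 := Real.rpow_nonneg hM.le (1 + κ)
    rcases max_choice (M s) M₂ with h | h <;> rw [h] <;> linarith
  have hMm : AEMeasurable M 𝒟 := by
    have := hint.aemeasurable.pow_const (1 / (1 + κ))
    refine this.congr (Filter.Eventually.of_forall fun s => ?_)
    simp only
    rw [← Real.rpow_mul (hM0 s), mul_one_div_cancel hκ0.ne', Real.rpow_one]
  have hKm : AEMeasurable (fun s => max (M s) M₂) 𝒟 := hMm.max aemeasurable_const
  have hKpos : ∀ s, 0 < max (M s) M₂ := fun s => lt_max_of_lt_right hM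
  have hint2 : Integrable (fun s => M s ^ (1 + κ) + M₂ ^ (1 + κ)) 𝒟 := hint.add (integrable_const _)
  have hintK : Integrable (fun s => max (M s) M₂ ^ (1 + κ)) 𝒟 := by
    refine hint2.mono' (hKm.pow_const _).aestronglyMeasurable
      (Filter.Eventually.of_forall fun s => ?_)
    rw [Real.norm_of_nonneg (Real.rpow_nonneg (hKpos s).le _)]
    exact hmax s
  have hintle : ∫ s, max (M s) M₂ ^ (1 + κ) ∂𝒟 ≤ 2 * M₂ ^ (1 + κ) := by
    refine (integral_mono hintK hint2 hmax).trans ?_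
    rw [integral_add hint (integrable_const _), integral_const]
    simp only [probReal_univ, smul_eq_mul, one_mul]
    linarith
  -- Since `max (M s) M₂ / M₂ ≥ 1`, it is at most its own `(1 + κ)`-th power; this bounds the first
  -- moment without Hölder's inequality.
  have hKle : ∀ s, max (M s) M₂ ≤ M₂ * (M₂ ^ (1 + κ))⁻¹ * max (M s) M₂ ^ (1 + κ) := by
    intro s
    set k := max (M s) M₂
    have hk : 1 ≤ k / M₂ := (one_le_div hM).2 (le_max_right _ _)
    have h1 : k / M₂ ≤ (k / M₂) ^ (1 + κ) := by
      simpa using Real.rpow_le_rpow_of_exponent_le hk (by linarith : (1 : ℝ) ≤ 1 + κ)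
    rw [Real.div_rpow (hKpos s).le hM.le, div_le_iff₀ hM] at h1
    refine h1.trans (le_of_eq (by ring))
  have hintK1 : Integrable (fun s => max (M s) M₂) 𝒟 := by
    refine (hintK.const_mul (M₂ * (M₂ ^ (1 + κ))⁻¹)).mono' hKm.aestronglyMeasurable
      (Filter.Eventually.of_forall fun s => ?_)
    rw [Real.norm_of_nonneg (hKpos s).le]
    exact hKle s
  -- Composing with a nonexpansive retraction keeps the Lipschitz constant and leaves `f` unchanged
  -- on the neighbourhood. The maximum with `M₂` makes the constant positive for every sample, at
  -- the cost of a factor `2` in its moments.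
  refine ⟨fun x s => f (π x) s, fun s => max (M s) M₂,
    ⟨fun s => le_max_right _ _, hintK1, hintK, ?_, hintle, fun s x y => ?_,
      fun x => hf.measurable _ (hπ x), fun s => ?_, fun x hx => ?_⟩, fun x hx s => ?_⟩
  · refine (integral_mono hintK1 (hintK.const_mul (M₂ * (M₂ ^ (1 + κ))⁻¹)) hKle).trans ?_
    rw [integral_const_mul]
    have hp : 0 < M₂ ^ (1 + κ) := by positivity
    refine (mul_le_mul_of_nonneg_left hintle (by positivity)).trans (le_of_eq ?_)
    field_simp
  · refine (hlip s _ (hπ x) _ (hπ y)).trans ?_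
    exact mul_le_mul (le_max_left _ _) (hne x y) (norm_nonneg _) (hKpos s).le
  · exact (hf.convex s).congr fun x hx => by simp only [hid x hx]
  · rw [hid x (mem_nbhd_of_mem hx)]
    exact hf.integrable x hx
  · simp only [hid x hx]

namespace IsLipschitzObjective

variable {κ M₂ : ℝ} {S X : Set (Vec d)} {𝒟 : Measure Ξ} {h : Vec d → Ξ → ℝ} {K : Ξ → ℝ}

lemma integrable_all (hh : IsLipschitzObjective κ M₂ S X 𝒟 h K) (hXn : X.Nonempty) (x : Vec d) :
    Integrable (h x) 𝒟 := by
  obtain ⟨y, hy⟩ := hXn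
  have h1 : Integrable (fun s => h x s - h y s) 𝒟 :=
    (hh.integrable_lip.mul_const ‖x - y‖).mono'
      ((hh.measurable x).sub (hh.measurable y)).aestronglyMeasurable
      (Filter.Eventually.of_forall fun s => hh.lipschitz s x y)
  refine (h1.add (hh.integrable y hy)).congr (Filter.Eventually.of_forall fun s => ?_)
  simp

lemma abs_expObj_sub_le (hh : IsLipschitzObjective κ M₂ S X 𝒟 h K) (hXn : X.Nonempty)
    (x y : Vec d) : |expObj 𝒟 h x - expObj 𝒟 h y| ≤ 2 * M₂ * ‖x - y‖ := by
  rw [expObj, expObj, ← integral_sub (hh.integrable_all hXn x) (hh.integrable_all hXn y)]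
  refine (abs_integral_le_integral_abs).trans ?_
  refine (integral_mono ((hh.integrable_all hXn x).sub (hh.integrable_all hXn y)).abs
    (hh.integrable_lip.mul_const ‖x - y‖) fun s => hh.lipschitz s x y).trans ?_
  rw [integral_mul_const]
  exact mul_le_mul_of_nonneg_right hh.integral_lip (norm_nonneg _)

lemma continuous_expObj (hh : IsLipschitzObjective κ M₂ S X 𝒟 h K) (hM : 0 < M₂)
    (hXn : X.Nonempty) : Continuous (expObj 𝒟 h) := by
  have : LipschitzWith ⟨2 * M₂, by positivity⟩ (expObj 𝒟 h) := by
    refine LipschitzWith.of_dist_le_mul fun x y => ?_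
    rw [Real.dist_eq, dist_eq_norm]
    exact hh.abs_expObj_sub_le hXn x y
  exact this.continuous

lemma convexOn_expObj (hh : IsLipschitzObjective κ M₂ S X 𝒟 h K) (hXS : X ⊆ S)
    (hX : Convex ℝ X) (hXn : X.Nonempty) : ConvexOn ℝ X (expObj 𝒟 h) := by
  refine ⟨hX, fun x hx y hy a b ha hb hab => ?_⟩
  have hix := hh.integrable_all hXn x
  have hiy := hh.integrable_all hXn y
  simp only [expObj, smul_eq_mul]
  rw [← integral_const_mul, ← integral_const_mul,
    ← integral_add (hix.const_mul a) (hiy.const_mul b)]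
  exact integral_mono (hh.integrable_all hXn _) ((hix.const_mul a).add (hiy.const_mul b))
    fun s => (hh.convex s).2 (hXS hx) (hXS hy) ha hb hab

lemma measurable_uncurry (hh : IsLipschitzObjective κ M₂ S X 𝒟 h K) (hM : 0 < M₂) :
    Measurable fun a : Vec d × Ξ => h a.1 a.2 := by
  have hc : ∀ s, Continuous fun x => h x s := by
    intro s
    have hK : 0 ≤ K s := hM.le.trans (hh.le s)
    have : LipschitzWith ⟨K s, hK⟩ fun x => h x s := by
      refine LipschitzWith.of_dist_le_mul fun x y => ?_
      rw [Real.dist_eq, dist_eq_norm]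
      exact hh.lipschitz s x y
    exact this.continuous
  exact measurable_uncurry_of_continuous_of_measurable hc hh.measurable

end IsLipschitzObjective

end Objective

/-! ### The radius `R0` against the Lipschitz and growth constants. -/

section Radius

variable {d : ℕ} {p : ENNReal} {κ r μ M₂ L : ℝ} {X : Set (Vec d)} {F : Vec d → ℝ}
  {x' x₀ : Vec d} {Ψ : Vec d → ℝ}

/-- Growth from below against the Lipschitz bound from above: `(μ/2) y^r ≤ 2 M₂ y` for the distance
`y`; divide by `y`. -/
lemma HasGrowth.mul_lpNorm_rpow_le (hp1 : 1 ≤ p) (hp2 : p ≤ 2) (hr : 1 < r)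
    (hM : 0 < M₂) (h : HasGrowth p r μ X F x')
    (hF : ∀ x y, |F x - F y| ≤ 2 * M₂ * ‖x - y‖) {z : Vec d} (hz : z ∈ X) :
    μ * lpNorm p (z - x') ^ (r - 1) ≤ 4 * M₂ := by
  have h1 := h.growth z hz
  have h2 := (le_abs_self _).trans (hF z x')
  have h3 := norm_le_lpNorm hp1 hp2 (z - x')
  rcases (lpNorm_nonneg hp1 (z - x')).eq_or_lt with h0 | h0
  · rw [← h0, Real.zero_rpow (by linarith)]
    linarith
  · have h4 : lpNorm p (z - x') ^ r = lpNorm p (z - x') ^ (r - 1) * lpNorm p (z - x') := by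
      rw [← Real.rpow_add_one h0.ne']; congr 1; ring
    refine le_of_mul_le_mul_right ?_ h0
    rw [h4] at h1
    have h5 := mul_le_mul_of_nonneg_left h3 (by positivity : 0 ≤ 2 * M₂)
    linarith

/-- The scale that bounds the distances in `X`. -/
lemma HasGrowth.lpNorm_le (hp1 : 1 ≤ p) (hp2 : p ≤ 2) (hr : 1 < r) (hμ : 0 < μ)
    (hM : 0 < M₂) (h : HasGrowth p r μ X F x')
    (hF : ∀ x y, |F x - F y| ≤ 2 * M₂ * ‖x - y‖) {z : Vec d} (hz : z ∈ X) :
    lpNorm p (z - x') ≤ (4 * M₂ / μ) ^ (1 / (r - 1)) := by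
  have h1 := h.mul_lpNorm_rpow_le hp1 hp2 hr hM hF hz
  have hr1 : 0 < r - 1 := by linarith
  have h2 : lpNorm p (z - x') ^ (r - 1) ≤ 4 * M₂ / μ := by
    rw [le_div_iff₀ hμ]; linarith
  have h3 := Real.rpow_le_rpow (Real.rpow_nonneg (lpNorm_nonneg hp1 _) _) h2
    (by positivity : 0 ≤ 1 / (r - 1))
  rwa [← Real.rpow_mul (lpNorm_nonneg hp1 _), mul_one_div_cancel hr1.ne', Real.rpow_one] at h3

/-- Points of `X` and their reflections in one another lie within `4 ρ` of the centre, so the growth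
there bounds `s D` by `2 L (4ρ)^s`. The factor enters the root through `2 L ≤ (2 L)^s`. -/
lemma rpow_bregman_le (hκ : 0 < κ) (hκ1 : κ ≤ 1) (hp1 : 1 ≤ p)
    (hΨ : UniformlyConvex p 1 ((1 + κ) / κ) Ψ) (hL1 : 1 ≤ L)
    (hL : HasProxGrowth p ((1 + κ) / κ) L x₀ Ψ) {ρ : ℝ} (hρ : 0 ≤ ρ)
    (hX : ∀ z ∈ X, lpNorm p (z - x') ≤ ρ) (hx₀ : x₀ ∈ X) {x y : Vec d} (hx : x ∈ X) (hy : y ∈ X) :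
    (sExp κ * bregman Ψ x y) ^ (κ / (1 + κ)) ≤ 8 * L * ρ := by
  have hs2 := two_le_sExp hκ hκ1
  have hinv : κ / (1 + κ) = ((1 + κ) / κ)⁻¹ := by rw [inv_div]
  rw [sExp, hinv]
  set s := (1 + κ) / κ
  have hs0 : 0 < s := by linarith
  have hdist : ∀ a ∈ X, ∀ b ∈ X, lpNorm p (a - b) ≤ 2 * ρ := by
    intro a ha b hb
    have h1 := lpNorm_add_le hp1 (a - x') (x' - b)
    rw [sub_add_sub_cancel, lpNorm_sub_comm hp1 x' b] at h1
    linarith [hX a ha, hX b hb]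
  have h1 := bregman_le_of_hasProxGrowth hs0 hp1 hΨ hL x y
  have h2 : lpNorm p (x - x₀) ≤ 4 * ρ := (hdist x hx x₀ hx₀).trans (by linarith)
  have h3 : lpNorm p ((2 : ℝ) • y - x - x₀) ≤ 4 * ρ := by
    have := lpNorm_add_le hp1 (y - x) (y - x₀)
    rw [show y - x + (y - x₀) = (2 : ℝ) • y - x - x₀ by module] at this
    linarith [hdist y hy x hx, hdist y hy x₀ hx₀]
  have h4 := Real.rpow_le_rpow (lpNorm_nonneg hp1 _) h2 hs0.le
  have h5 := Real.rpow_le_rpow (lpNorm_nonneg hp1 _) h3 hs0.le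
  have hLs : 0 ≤ L / s := by positivity
  have h6 : s * bregman Ψ x y ≤ 2 * L * (4 * ρ) ^ s := by
    have h7 : bregman Ψ x y ≤ L / s * (2 * (4 * ρ) ^ s) := by
      have := mul_le_mul_of_nonneg_left h4 hLs
      have := mul_le_mul_of_nonneg_left h5 hLs
      linarith
    calc s * bregman Ψ x y ≤ s * (L / s * (2 * (4 * ρ) ^ s)) := by gcongr
      _ = _ := by field_simp
  have h8 : 2 * L * (4 * ρ) ^ s ≤ (8 * L * ρ) ^ s := by
    rw [show 8 * L * ρ = 2 * L * (4 * ρ) by ring,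
      Real.mul_rpow (x := 2 * L) (by positivity) (by positivity)]
    have : 2 * L ≤ (2 * L) ^ s := by
      simpa using Real.rpow_le_rpow_of_exponent_le (by linarith : 1 ≤ 2 * L)
        (by linarith : 1 ≤ s)
    exact mul_le_mul_of_nonneg_right this (by positivity)
  have h0 : 0 ≤ s * bregman Ψ x y := mul_nonneg hs0.le (hΨ.bregman_nonneg hs0 hp1 _ _)
  calc (s * bregman Ψ x y) ^ s⁻¹ ≤ ((8 * L * ρ) ^ s) ^ s⁻¹ :=
        Real.rpow_le_rpow h0 (h6.trans h8) (by positivity)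
    _ = _ := Real.rpow_rpow_inv (by positivity) hs0.ne'

/-- The radius `R₀` is bounded in terms of the Lipschitz and growth constants. -/
lemma mul_R0_rpow_le (hκ : 0 < κ) (hκ1 : κ ≤ 1) (hp1 : 1 ≤ p) (hp2 : p ≤ 2) (hr : 1 < r)
    (hμ : 0 < μ) (hM : 0 < M₂) (hΨ : UniformlyConvex p 1 ((1 + κ) / κ) Ψ) (hL1 : 1 ≤ L)
    (hL : HasProxGrowth p ((1 + κ) / κ) L x₀ Ψ) (hx₀ : x₀ ∈ X)
    (h : HasGrowth p r μ X F x') (hF : ∀ x y, |F x - F y| ≤ 2 * M₂ * ‖x - y‖) :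
    0 ≤ R0 κ X Ψ ∧ μ * R0 κ X Ψ ^ (r - 1) ≤ (8 * L) ^ (r - 1) * (4 * M₂) ∧
      ∀ x ∈ X, ∀ y ∈ X, lpNorm p (x - y) ≤ R0 κ X Ψ := by
  have hs2 := two_le_sExp hκ hκ1
  have hr1 : 0 < r - 1 := by linarith
  set ρ := (4 * M₂ / μ) ^ (1 / (r - 1)) with hρ
  have hρ0 : 0 < ρ := by positivity
  have hup : ∀ x ∈ X, ∀ y ∈ X, (sExp κ * bregman Ψ x y) ^ (κ / (1 + κ)) ≤ 8 * L * ρ :=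
    fun x hx y hy => rpow_bregman_le hκ hκ1 hp1 hΨ hL1 hL hρ0.le
      (fun z hz => h.lpNorm_le hp1 hp2 hr hμ hM hF hz) hx₀ hx hy
  -- Without boundedness `sSup` would take its default value and could not dominate the diameter.
  have hbdd : BddAbove {ρ | ∃ x ∈ X, ∃ y ∈ X, ρ = (sExp κ * bregman Ψ x y) ^ (κ / (1 + κ))} :=
    ⟨8 * L * ρ, by rintro _ ⟨x, hx, y, hy, rfl⟩; exact hup x hx y hy⟩
  have hdist : ∀ x ∈ X, ∀ y ∈ X, lpNorm p (x - y) ≤ R0 κ X Ψ := by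
    intro x hx y hy
    refine le_trans ?_ (le_csSup hbdd ⟨x, hx, y, hy, rfl⟩)
    have hinv : κ / (1 + κ) = ((1 + κ) / κ)⁻¹ := by rw [inv_div]
    rw [hinv, sExp]
    have hl := hΨ.lower y x
    set s := (1 + κ) / κ
    have hs0 : 0 < s := by linarith
    rw [lpNorm_sub_comm hp1] at hl
    have h1 : lpNorm p (x - y) ^ s ≤ s * bregman Ψ x y := by
      have := mul_le_mul_of_nonneg_left hl hs0.le
      rwa [← mul_assoc, mul_one_div_cancel hs0.ne', one_mul] at this
    calc lpNorm p (x - y) = (lpNorm p (x - y) ^ s) ^ s⁻¹ :=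
          (Real.rpow_rpow_inv (lpNorm_nonneg hp1 _) hs0.ne').symm
      _ ≤ _ := Real.rpow_le_rpow (Real.rpow_nonneg (lpNorm_nonneg hp1 _) _) h1 (by positivity)
  have hR0 : 0 ≤ R0 κ X Ψ := (lpNorm_nonneg hp1 _).trans (hdist x₀ hx₀ x₀ hx₀)
  refine ⟨hR0, ?_, hdist⟩
  have hle : R0 κ X Ψ ≤ 8 * L * ρ := by
    refine csSup_le ⟨_, x₀, hx₀, x₀, hx₀, rfl⟩ ?_
    rintro _ ⟨x, hx, y, hy, rfl⟩
    exact hup x hx y hy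
  have h1 := Real.rpow_le_rpow hR0 hle hr1.le
  rw [Real.mul_rpow (by positivity) hρ0.le] at h1
  have h2 : ρ ^ (r - 1) = 4 * M₂ / μ := by
    rw [hρ, ← Real.rpow_mul (by positivity), one_div_mul_cancel hr1.ne', Real.rpow_one]
  rw [h2] at h1
  calc μ * R0 κ X Ψ ^ (r - 1) ≤ μ * ((8 * L) ^ (r - 1) * (4 * M₂ / μ)) := by gcongr
    _ = _ := by field_simp

end Radius

end ZORestart

/-! ### Expected progress of one zeroth-order mirror step. -/

namespace ZORestart

section OneStep

variable {d : ℕ} {Ξ : Type*}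

/-- One step of ZO-RSMD as a function of the centre, the current point and the sample. -/
noncomputable def zoStep (X : Set (Vec d)) (Ψ : Vec d → ℝ) (x₀ : Vec d) (ν τ : ℝ)
    (h : Vec d → Ξ → ℝ) (δ : Vec d → ℝ) (w x : Vec d) (ζ : Ξ × Vec d) : Vec d :=
  mirrorStep X (recentre Ψ x₀ w) ν x (gradEst (fun y => h y ζ.1 + δ y) τ x ζ.2)

variable {p q : ENNReal} {κ M₂ t τ ν Δ L : ℝ} {X : Set (Vec d)} {Ψ : Vec d → ℝ} {x₀ : Vec d}
  {h : Vec d → Ξ → ℝ} {δ : Vec d → ℝ}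

lemma zoStep_mem (hκ : 0 < κ) (hκ1 : κ ≤ 1) (hp1 : 1 ≤ p) (hp2 : p ≤ 2)
    (hXc : IsCompact X) (hXn : X.Nonempty) (hΨ : UniformlyConvex p 1 ((1 + κ) / κ) Ψ)
    (w x : Vec d) (ζ : Ξ × Vec d) : zoStep X Ψ x₀ ν τ h δ w x ζ ∈ X :=
  (isLinMin_mirrorStep hκ hκ1 hp1 hp2 hXc hXn (hΨ.recentre x₀ w) ν x _).1

variable [MeasurableSpace Ξ] {𝒟 : Measure Ξ} {K : Ξ → ℝ}

lemma measurable_gradEst {Ω : Type*} [MeasurableSpace Ω]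
    (hh : Measurable fun a : Vec d × Ξ => h a.1 a.2) (hδ : Measurable δ)
    (τ : ℝ) {x : Ω → Vec d} {ζ : Ω → Ξ × Vec d} (hx : Measurable x) (hζ : Measurable ζ) :
    Measurable fun ω => gradEst (fun y => h y (ζ ω).1 + δ y) τ (x ω) (ζ ω).2 := by
  simp only [gradEst]
  have h5 : Measurable fun ω => x ω + τ • (ζ ω).2 := hx.add (hζ.snd.const_smul τ)
  have h6 : Measurable fun ω => x ω - τ • (ζ ω).2 := hx.sub (hζ.snd.const_smul τ)
  have h1 : Measurable fun ω => h (x ω + τ • (ζ ω).2) (ζ ω).1 := hh.comp (h5.prodMk hζ.fst)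
  have h2 : Measurable fun ω => h (x ω - τ • (ζ ω).2) (ζ ω).1 := hh.comp (h6.prodMk hζ.fst)
  exact (((h1.add (hδ.comp h5)).sub (h2.add (hδ.comp h6))).const_mul _).smul hζ.snd

lemma measurable_zoStep (hκ : 0 < κ) (hκ1 : κ ≤ 1) (hp1 : 1 ≤ p) (hp2 : p ≤ 2)
    (hXc : IsCompact X) (hXn : X.Nonempty) (hX : Convex ℝ X)
    (hΨ : UniformlyConvex p 1 ((1 + κ) / κ) Ψ) (hh : Measurable fun a : Vec d × Ξ => h a.1 a.2)
    (hδ : Measurable δ) (ν τ : ℝ) {Ω : Type*} [MeasurableSpace Ω] {w x : Ω → Vec d}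
    {ζ : Ω → Ξ × Vec d} (hw : Measurable w) (hx : Measurable x) (hζ : Measurable ζ) :
    Measurable fun ω => zoStep X Ψ x₀ ν τ h δ (w ω) (x ω) (ζ ω) := by
  have h1 := measurable_mirrorStep_recentre hκ hκ1 hp1 hp2 hXc hXn hX hΨ x₀ ν
  have h2 := hw.prodMk (hx.prodMk (measurable_gradEst hh hδ τ hx hζ))
  have h3 := h1.comp h2
  simpa only [Function.comp_def, zoStep] using h3

lemma measurable_bregman_recentre (hΨ : Continuous Ψ) {Ω : Type*} [MeasurableSpace Ω]
    {W Z : Ω → Vec d} (hW : Measurable W) (hZ : Measurable Z) (u : Vec d) :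
    Measurable fun ω => bregman (recentre Ψ x₀ (W ω)) u (Z ω) := by
  have h1 : ∀ ω, bregman (recentre Ψ x₀ (W ω)) u (Z ω) =
      Ψ (u - W ω + x₀) - Ψ (Z ω - W ω + x₀) -
        inner ℝ (gradient Ψ (Z ω - W ω + x₀)) (u - Z ω) := by
    intro ω
    rw [bregman_recentre, bregman]
    congr 2; abel
  simp_rw [h1]
  have h4 : Measurable fun ω => Z ω - W ω + x₀ := (hZ.sub hW).add_const _
  have h5 : Measurable fun ω => u - W ω + x₀ := (hW.const_sub _).add_const _
  exact ((hΨ.measurable.comp h5).sub (hΨ.measurable.comp h4)).sub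
    (((measurable_gradient Ψ).comp h4).inner (hZ.const_sub _))

/-- A crude uniform bound that serves only for integrability. -/
lemma exists_bregman_recentre_le (hκ : 0 < κ) (hp1 : 1 ≤ p) (hp2 : p ≤ 2) (hXc : IsCompact X)
    (hΨ : UniformlyConvex p 1 ((1 + κ) / κ) Ψ) (hL1 : 1 ≤ L)
    (hL : HasProxGrowth p ((1 + κ) / κ) L x₀ Ψ) :
    ∃ B, 0 ≤ B ∧ ∀ w ∈ X, ∀ u ∈ X, ∀ x ∈ X, bregman (recentre Ψ x₀ w) u x ≤ B := by
  have hs0 : 0 < (1 + κ) / κ := by positivity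
  obtain ⟨b, hb⟩ := hXc.isBounded.exists_norm_le
  refine ⟨L / ((1 + κ) / κ) * (d * (4 * |b|)) ^ ((1 + κ) / κ) +
    L / ((1 + κ) / κ) * (d * (4 * |b|)) ^ ((1 + κ) / κ), by positivity, fun w hw u hu x hx => ?_⟩
  have hw := (hb w hw).trans (le_abs_self b)
  have hu := (hb u hu).trans (le_abs_self b)
  have hx := (hb x hx).trans (le_abs_self b)
  rw [bregman_recentre]
  refine (bregman_le_of_hasProxGrowth hs0 hp1 hΨ hL _ _).trans ?_
  rw [show u - w + x₀ - x₀ = u - w by abel,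
    show (2 : ℝ) • (x - w + x₀) - (u - w + x₀) - x₀ = (2 : ℝ) • x - u - w by module]
  have hmain : ∀ v : Vec d, ‖v‖ ≤ 4 * |b| → L / ((1 + κ) / κ) * lpNorm p v ^ ((1 + κ) / κ) ≤
      L / ((1 + κ) / κ) * (d * (4 * |b|)) ^ ((1 + κ) / κ) := by
    intro v hv
    refine mul_le_mul_of_nonneg_left (Real.rpow_le_rpow (lpNorm_nonneg hp1 _) ?_ hs0.le)
      (by positivity)
    exact (lpNorm_le_mul_norm hp1 hp2 v).trans (by gcongr)
  refine add_le_add (hmain _ ?_) (hmain _ ?_)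
  · refine (norm_sub_le _ _).trans ?_
    linarith [abs_nonneg b]
  · refine (norm_sub_le _ _).trans ?_
    have h1 := norm_sub_le ((2 : ℝ) • x) u
    rw [norm_smul, Real.norm_of_nonneg (by norm_num : (0 : ℝ) ≤ 2)] at h1
    linarith

lemma integrable_bregman_recentre (hκ : 0 < κ) (hp1 : 1 ≤ p) (hp2 : p ≤ 2)
    (hXc : IsCompact X) (hΨ : UniformlyConvex p 1 ((1 + κ) / κ) Ψ) (hL1 : 1 ≤ L)
    (hL : HasProxGrowth p ((1 + κ) / κ) L x₀ Ψ) {Ω : Type*} [MeasurableSpace Ω] {P : Measure Ω}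
    [IsFiniteMeasure P] {W Z : Ω → Vec d} (hWm : Measurable W) (hZm : Measurable Z)
    (hW : ∀ ω, W ω ∈ X) (hZ : ∀ ω, Z ω ∈ X) {u : Vec d} (hu : u ∈ X) :
    Integrable (fun ω => bregman (recentre Ψ x₀ (W ω)) u (Z ω)) P := by
  obtain ⟨B, hB0, hB⟩ := exists_bregman_recentre_le hκ hp1 hp2 hXc hΨ hL1 hL
  have hs0 : 0 < (1 + κ) / κ := by positivity
  have hm2 := measurable_bregman_recentre (x₀ := x₀) hΨ.differentiable.continuous hWm hZm u
  refine (integrable_const B).mono' hm2.aestronglyMeasurable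
    (Filter.Eventually.of_forall fun ω => ?_)
  rw [Real.norm_of_nonneg ((hΨ.recentre x₀ _).bregman_nonneg hs0 hp1 _ _)]
  exact hB _ (hW ω) u hu _ (hZ ω)

/-- The worst-case size of the estimate has the wrong order in `d`; it is used only for
integrability. -/
lemma exists_gradEst_eq_smul (hh : IsLipschitzObjective κ M₂ (nbhd X t) X 𝒟 h K) (hτ : 0 < τ)
    (hδ : ∀ x, |δ x| ≤ Δ) (x : Vec d) (s : Ξ) {e : Vec d} (he : ‖e‖ = 1) :
    ∃ c : ℝ, gradEst (fun y => h y s + δ y) τ x e = c • e ∧ |c| ≤ d * (K s + Δ / τ) := by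
  refine ⟨_, rfl, ?_⟩
  have h1 := hh.lipschitz s (x + τ • e) (x - τ • e)
  rw [show x + τ • e - (x - τ • e) = (2 * τ) • e by module, norm_smul,
    Real.norm_of_nonneg (by positivity), he, mul_one] at h1
  have h2 := hδ (x + τ • e)
  have h3 := hδ (x - τ • e)
  rw [abs_mul, abs_of_nonneg (by positivity : (0 : ℝ) ≤ d / (2 * τ))]
  have h4 : |h (x + τ • e) s + δ (x + τ • e) - (h (x - τ • e) s + δ (x - τ • e))| ≤
      K s * (2 * τ) + 2 * Δ := by
    rw [abs_le] at *
    constructor <;> linarith [h1.1, h1.2, h2.1, h2.2, h3.1, h3.2]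
  calc d / (2 * τ) * |h (x + τ • e) s + δ (x + τ • e) - (h (x - τ • e) s + δ (x - τ • e))|
      ≤ d / (2 * τ) * (K s * (2 * τ) + 2 * Δ) := by gcongr
    _ = d * (K s + Δ / τ) := by field_simp

lemma exists_lmNorm_le_of_norm_eq_one {m : ℝ} (hm : 0 < m) :
    ∃ b, 0 ≤ b ∧ ∀ e : Vec d, ‖e‖ = 1 → lmNorm m e ≤ b := by
  obtain ⟨b, hb⟩ := (isCompact_sphere (0 : Vec d) 1).exists_bound_of_continuousOn
    (continuous_lmNorm hm).continuousOn
  refine ⟨|b|, abs_nonneg b, fun e he => ?_⟩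
  exact ((le_abs_self _).trans (hb e (by simpa using he))).trans (le_abs_self b)

lemma ae_norm_snd_eq_one [SFinite 𝒟] (hd : 0 < d) :
    ∀ᵐ ζ : Ξ × Vec d ∂(𝒟.prod (uniformSphere d)), ‖ζ.2‖ = 1 := by
  have := isProbabilityMeasure_uniformSphere hd
  exact Measure.quasiMeasurePreserving_snd.ae ae_norm_eq_one_uniformSphere

variable [IsProbabilityMeasure 𝒟]

lemma integrable_inner_gradEst (hd : 0 < d)
    (hh : IsLipschitzObjective κ M₂ (nbhd X t) X 𝒟 h K) (hM : 0 < M₂) (hτ : 0 < τ)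
    (hδm : Measurable δ) (hδ : ∀ x, |δ x| ≤ Δ) (x v : Vec d) :
    Integrable (fun ζ : Ξ × Vec d => inner ℝ (gradEst (fun y => h y ζ.1 + δ y) τ x ζ.2) v)
      (𝒟.prod (uniformSphere d)) := by
  have := isProbabilityMeasure_uniformSphere hd
  have hK : Integrable (fun ζ : Ξ × Vec d => d * (K ζ.1 + Δ / τ) * ‖v‖)
      (𝒟.prod (uniformSphere d)) :=
    (((hh.integrable_lip.add (integrable_const _)).const_mul _).mul_const _).comp_fst _
  have hg := measurable_gradEst (x := fun _ : Ξ × Vec d => x) (hh.measurable_uncurry hM) hδm τ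
    measurable_const measurable_id
  refine hK.mono' (hg.inner measurable_const).aestronglyMeasurable ?_
  filter_upwards [ae_norm_snd_eq_one hd] with ζ hζ
  obtain ⟨c, hc, hc2⟩ := exists_gradEst_eq_smul hh hτ hδ x ζ.1 hζ
  rw [hc, real_inner_smul_left, norm_mul, Real.norm_eq_abs]
  have h1 := norm_inner_le_norm (𝕜 := ℝ) ζ.2 v
  rw [hζ, one_mul] at h1
  exact mul_le_mul hc2 h1 (norm_nonneg _) ((abs_nonneg _).trans hc2)

lemma integrable_gradEst_rpow (hd : 0 < d) (hκ : 0 < κ) (hκ1 : κ ≤ 1)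
    (hh : IsLipschitzObjective κ M₂ (nbhd X t) X 𝒟 h K) (hM : 0 < M₂) (hτ : 0 < τ)
    (hΔ : 0 ≤ Δ) (hδm : Measurable δ) (hδ : ∀ x, |δ x| ≤ Δ) {m C : ℝ} (hm : 0 < m) (hC : 0 < C)
    (x : Vec d) :
    Integrable (fun ζ : Ξ × Vec d =>
      (C * lmNorm m (gradEst (fun y => h y ζ.1 + δ y) τ x ζ.2)) ^ (1 + κ))
      (𝒟.prod (uniformSphere d)) := by
  have := isProbabilityMeasure_uniformSphere hd
  obtain ⟨b, hb0, hb⟩ := exists_lmNorm_le_of_norm_eq_one (d := d) hm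
  have hK : Integrable (fun ζ : Ξ × Vec d => (C * d * b) ^ (1 + κ) *
      (2 * (K ζ.1 ^ (1 + κ) + (Δ / τ) ^ (1 + κ)))) (𝒟.prod (uniformSphere d)) :=
    (((hh.integrable_rpow.add (integrable_const _)).const_mul _).const_mul _).comp_fst _
  have hg := measurable_gradEst (x := fun _ : Ξ × Vec d => x) (hh.measurable_uncurry hM) hδm τ
    measurable_const measurable_id
  refine hK.mono' (((((continuous_lmNorm hm).measurable.comp hg).const_mul C).pow_const
    _).aestronglyMeasurable) ?_
  filter_upwards [ae_norm_snd_eq_one hd] with ζ hζ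
  obtain ⟨c, hc, hc2⟩ := exists_gradEst_eq_smul hh hτ hδ x ζ.1 hζ
  have hK0 : 0 ≤ K ζ.1 := hM.le.trans (hh.le _)
  have h1 := lmNorm_nonneg m (gradEst (fun y => h y ζ.1 + δ y) τ x ζ.2)
  rw [Real.norm_of_nonneg (by positivity), hc, lmNorm_smul hm]
  have hle : C * (|c| * lmNorm m ζ.2) ≤ C * d * b * (K ζ.1 + Δ / τ) := by
    have := mul_le_mul hc2 (hb _ hζ) (lmNorm_nonneg _ _) ((abs_nonneg _).trans hc2)
    calc C * (|c| * lmNorm m ζ.2) ≤ C * (d * (K ζ.1 + Δ / τ) * b) := by gcongr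
      _ = _ := by ring
  have h2 := lmNorm_nonneg m ζ.2
  refine (Real.rpow_le_rpow (by positivity) hle (by linarith)).trans ?_
  rw [Real.mul_rpow (by positivity) (by positivity)]
  exact mul_le_mul_of_nonneg_left
    (rpow_add_le_two_mul hK0 (by positivity) (by linarith) (by linarith)) (by positivity)

/-- The bias bound of a single sample averaged over `ξ`; the constant `4` comes from `E K ≤ 2 M₂`.
-/
lemma integral_inner_gradEst_ge (hd : 0 < d) 
    (hh : IsLipschitzObjective κ M₂ (nbhd X t) X 𝒟 h K) (hM : 0 < M₂) (ht : 0 < t) (hτ : 0 < τ)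
    (hτt : τ ≤ t) (hΔ : 0 ≤ Δ) (hδm : Measurable δ) (hδ : ∀ x, |δ x| ≤ Δ) {x u : Vec d}
    (hx : x ∈ X) (hu : u ∈ X) :
    expObj 𝒟 h x - expObj 𝒟 h u - 4 * M₂ * τ - 2 * √d * Δ / τ * ‖x - u‖ ≤
      ∫ ζ : Ξ × Vec d, inner ℝ (gradEst (fun y => h y ζ.1 + δ y) τ x ζ.2) (x - u)
        ∂(𝒟.prod (uniformSphere d)) := by
  have := isProbabilityMeasure_uniformSphere hd
  have hint := integrable_inner_gradEst hd hh hM hτ hδm hδ x (x - u)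
  rw [integral_prod _ hint]
  have hxu : Integrable (fun s => h x s - h u s) 𝒟 := (hh.integrable x hx).sub (hh.integrable u hu)
  have hiK : Integrable (fun s => 2 * K s * τ) 𝒟 := (hh.integrable_lip.const_mul 2).mul_const τ
  have hxuK : Integrable (fun s => h x s - h u s - 2 * K s * τ) 𝒟 := hxu.sub hiK
  have hi1 : Integrable (fun s => h x s - h u s - 2 * K s * τ - 2 * √d * Δ / τ * ‖x - u‖) 𝒟 :=
    hxuK.sub (integrable_const _)
  have hle := integral_mono hi1 hint.integral_prod_left fun s =>
    sub_le_integral_inner_gradEst hd (hh.convex s) (hM.le.trans (hh.le s)) hτ hΔ (hh.lipschitz s)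
      (fun b hb => add_smul_mem_nbhd ht hτ.le hτt hx hb)
      (fun b hb => add_smul_mem_nbhd ht hτ.le hτt hu hb) hδm fun b _ => hδ _
  refine le_trans ?_ hle
  rw [integral_sub hxuK (integrable_const _), integral_sub hxu hiK, integral_sub (hh.integrable x hx) (hh.integrable u hu), integral_mul_const,
    integral_const_mul, integral_const]
  simp only [probReal_univ, smul_eq_mul, one_mul]
  have h1 := mul_le_mul_of_nonneg_right hh.integral_lip hτ.le
  simp only [expObj]
  linarith

/-- The moment bound of a single sample averaged over `ξ`. The extra factor `4` consists of `E
K^(1+κ) ≤ 2 M₂^(1+κ)` and of the `2^(1/4)` in `sigmaBase`, whose power is at most `2`. -/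
lemma integral_gradEst_prod_rpow_le (hd : 0 < d) (hκ : 0 < κ) (hκ1 : κ ≤ 1)
    (hh : IsLipschitzObjective κ M₂ (nbhd X t) X 𝒟 h K) (hM : 0 < M₂) (hτ : 0 < τ)
    (hΔ : 0 ≤ Δ) (hδm : Measurable δ) (hδ : ∀ x, |δ x| ≤ Δ) {m C : ℝ} (hm : 0 < m) (hC : 0 < C)
    (ha : 0 < aq d q) (hNa : ∫ e, (C * lmNorm m e) ^ 4 ∂(uniformSphere d) ≤ 64 * aq d q ^ 4)
    (x : Vec d) :
    ∫ ζ : Ξ × Vec d, (C * lmNorm m (gradEst (fun y => h y ζ.1 + δ y) τ x ζ.2)) ^ (1 + κ)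
        ∂(𝒟.prod (uniformSphere d)) ≤
      40000 * (sigmaBase d q M₂ ^ (1 + κ) + (d * aq d q * Δ / τ) ^ (1 + κ)) := by
  have := isProbabilityMeasure_uniformSphere hd
  have hint := integrable_gradEst_rpow hd hκ hκ1 hh hM hτ hΔ hδm hδ hm hC x
  rw [integral_prod _ hint]
  have hKpos : ∀ s, 0 < K s := fun s => hM.trans_le (hh.le s)
  have hpt : ∀ s, ∫ e, (C * lmNorm m (gradEst (fun y => h y s + δ y) τ x e)) ^ (1 + κ)
      ∂(uniformSphere d) ≤
      10000 * ((√d * aq d q) ^ (1 + κ) * K s ^ (1 + κ) + (d * aq d q * Δ / τ) ^ (1 + κ)) := by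
    intro s
    rw [← Real.mul_rpow (by positivity) (hKpos s).le]
    exact integral_gradEst_rpow_le hd (hKpos s) hτ hΔ (by linarith) (by linarith) ha hm hC hNa
      (hh.lipschitz s) fun b _ => hδ _
  have hi : Integrable (fun s => 10000 * ((√d * aq d q) ^ (1 + κ) * K s ^ (1 + κ) +
      (d * aq d q * Δ / τ) ^ (1 + κ))) 𝒟 :=
    ((hh.integrable_rpow.const_mul _).add (integrable_const _)).const_mul _
  refine (integral_mono hint.integral_prod_left hi hpt).trans ?_
  rw [integral_const_mul, integral_add (hh.integrable_rpow.const_mul _) (integrable_const _),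
    integral_const_mul, integral_const]
  simp only [probReal_univ, smul_eq_mul, one_mul]
  have h1 : (√d * aq d q) ^ (1 + κ) * ∫ s, K s ^ (1 + κ) ∂𝒟 ≤
      4 * sigmaBase d q M₂ ^ (1 + κ) := by
    refine (mul_le_mul_of_nonneg_left hh.integral_rpow (by positivity)).trans ?_
    have h2 : (√d * aq d q) ^ (1 + κ) * M₂ ^ (1 + κ) =
        ((2 : ℝ) ^ (1 / 4 : ℝ)) ^ (1 + κ) * sigmaBase d q M₂ ^ (1 + κ) := by
      have hS := sigmaBase_pos (M₂ := M₂) hd ha hM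
      rw [← Real.mul_rpow (by positivity) hM.le, ← Real.mul_rpow (by positivity) hS.le, sigmaBase]
      congr 1
      field_simp
    have h3 : ((2 : ℝ) ^ (1 / 4 : ℝ)) ^ (1 + κ) ≤ 2 := by
      rw [← Real.rpow_mul (by norm_num)]
      simpa using Real.rpow_le_rpow_of_exponent_le (by norm_num : (1 : ℝ) ≤ 2)
        (by linarith : 1 / 4 * (1 + κ) ≤ 1)
    have hS := (sigmaBase_pos (M₂ := M₂) hd ha hM).le
    have h4 := mul_le_mul_of_nonneg_right h3 (Real.rpow_nonneg hS (1 + κ))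
    linarith
  have h5 : 0 ≤ (d * aq d q * Δ / τ) ^ (1 + κ) := by positivity
  linarith

/-- The expected progress of one step of ZO-RSMD. -/
lemma integral_bregman_zoStep_le (hd : 2 ≤ d) (hκ : 0 < κ) (hκ1 : κ ≤ 1) (hp1 : 1 ≤ p)
    (hp2 : p ≤ 2) (hpq : p.HolderConjugate q) (hXc : IsCompact X) (hX : Convex ℝ X)
    (hΨ : UniformlyConvex p 1 ((1 + κ) / κ) Ψ) (hL1 : 1 ≤ L)
    (hL : HasProxGrowth p ((1 + κ) / κ) L x₀ Ψ)
    (hh : IsLipschitzObjective κ M₂ (nbhd X t) X 𝒟 h K) (hM : 0 < M₂) (ht : 0 < t) (hτ : 0 < τ)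
    (hτt : τ ≤ t) (hν : 0 < ν) (hΔ : 0 ≤ Δ) (hδm : Measurable δ) (hδ : ∀ x, |δ x| ≤ Δ)
    {w x u : Vec d} (hw : w ∈ X) (hx : x ∈ X) (hu : u ∈ X) :
    ∫ ζ, bregman (recentre Ψ x₀ w) u (zoStep X Ψ x₀ ν τ h δ w x ζ) ∂(𝒟.prod (uniformSphere d)) ≤
      bregman (recentre Ψ x₀ w) u x - ν * (expObj 𝒟 h x - expObj 𝒟 h u) +
        ν * (4 * M₂ * τ + 2 * √d * Δ / τ * ‖x - u‖) +
        40000 * ν ^ (1 + κ) *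
          (sigmaBase d q M₂ ^ (1 + κ) + (d * aq d q * Δ / τ) ^ (1 + κ)) := by
  have hd0 : 0 < d := by omega
  have := isProbabilityMeasure_uniformSphere hd0
  have hXn : X.Nonempty := ⟨u, hu⟩
  obtain ⟨m, C, hm, hC, hdual, hNa⟩ := exists_dual_lmNorm hd hp1 hp2 hpq
  have ha := aq_pos hd hp1 hp2 hpq
  have hs0 : 0 < (1 + κ) / κ := by positivity
  have hI1 := integrable_inner_gradEst hd0 hh hM hτ hδm hδ x (x - u)
  have hI2 := integrable_gradEst_rpow hd0 hκ hκ1 hh hM hτ hΔ hδm hδ hm hC x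
  have hE1 := integral_inner_gradEst_ge hd0 hh hM ht hτ hτt hΔ hδm hδ hx hu
  have hE2 := integral_gradEst_prod_rpow_le hd0 hκ hκ1 hh hM hτ hΔ hδm hδ hm hC ha hNa x
  have hZm : Measurable fun ζ : Ξ × Vec d => zoStep X Ψ x₀ ν τ h δ w x ζ :=
    measurable_zoStep hκ hκ1 hp1 hp2 hXc hXn hX hΨ (hh.measurable_uncurry hM) hδm ν τ
      measurable_const measurable_const measurable_id
  have hI3 : Integrable (fun ζ => bregman (recentre Ψ x₀ w) u (zoStep X Ψ x₀ ν τ h δ w x ζ))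
      (𝒟.prod (uniformSphere d)) :=
    integrable_bregman_recentre (W := fun _ => w) hκ hp1 hp2 hXc hΨ hL1 hL measurable_const hZm
      (fun _ => hw) (fun ζ => zoStep_mem hκ hκ1 hp1 hp2 hXc hXn hΨ w x ζ) hu
  have hle : ∀ ζ, bregman (recentre Ψ x₀ w) u (zoStep X Ψ x₀ ν τ h δ w x ζ) ≤
      bregman (recentre Ψ x₀ w) u x + ν ^ (1 + κ) *
        (C * lmNorm m (gradEst (fun y => h y ζ.1 + δ y) τ x ζ.2)) ^ (1 + κ) -
        ν * inner ℝ (gradEst (fun y => h y ζ.1 + δ y) τ x ζ.2) (x - u) := by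
    intro ζ
    have h1 := mirrorStep_inequality hκ hκ1 hp1 hp2 hXc hX (hΨ.recentre x₀ w) hν.le x
      (gradEst (fun y => h y ζ.1 + δ y) τ x ζ.2) hu
      (mul_nonneg hC.le (lmNorm_nonneg m _)) (hdual _)
    rw [zoStep]
    linarith
  have hI4 : Integrable (fun ζ : Ξ × Vec d => bregman (recentre Ψ x₀ w) u x + ν ^ (1 + κ) *
      (C * lmNorm m (gradEst (fun y => h y ζ.1 + δ y) τ x ζ.2)) ^ (1 + κ))
      (𝒟.prod (uniformSphere d)) := (integrable_const _).add (hI2.const_mul _)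
  have hI5 : Integrable (fun ζ : Ξ × Vec d =>
      ν * inner ℝ (gradEst (fun y => h y ζ.1 + δ y) τ x ζ.2) (x - u))
      (𝒟.prod (uniformSphere d)) := hI1.const_mul ν
  have hI6 : Integrable (fun ζ : Ξ × Vec d => bregman (recentre Ψ x₀ w) u x + ν ^ (1 + κ) *
      (C * lmNorm m (gradEst (fun y => h y ζ.1 + δ y) τ x ζ.2)) ^ (1 + κ) -
      ν * inner ℝ (gradEst (fun y => h y ζ.1 + δ y) τ x ζ.2) (x - u))
      (𝒟.prod (uniformSphere d)) := hI4.sub hI5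
  refine (integral_mono hI3 hI6 hle).trans ?_
  rw [integral_sub hI4 hI5, integral_add (integrable_const _) (hI2.const_mul _),
    integral_const, integral_const_mul, integral_const_mul]
  simp only [probReal_univ, smul_eq_mul, one_mul]
  have h1 := mul_le_mul_of_nonneg_left hE1 hν.le
  have h2 := mul_le_mul_of_nonneg_left hE2 (by positivity : 0 ≤ ν ^ (1 + κ))
  linarith

end OneStep

end ZORestart

/-! ### Accuracy of a single restart. -/

namespace ZORestart

section Epoch

/-- A discrete Gronwall argument: as long as `V ≤ W`, a step adds at most `b + a W`, and `T` steps
add at most `T b + W / 2`. For `W = 2 (V 0 + T b)` the bound reproduces itself. -/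
lemma sum_le_of_recursion {V G : ℕ → ℝ} {a b ν : ℝ} {T : ℕ} (hV : ∀ j, 0 ≤ V j)
    (hG : ∀ j, 0 ≤ G j) (ha : 0 ≤ a) (hb : 0 ≤ b) (hν : 0 ≤ ν) (haT : a * T ≤ 1 / 2)
    (h : ∀ j, V (j + 1) ≤ (1 + a) * V j - ν * G j + b) :
    ν * ∑ j ∈ Finset.range T, G j ≤ 2 * (V 0 + T * b) := by
  set W := 2 * (V 0 + T * b) with hW
  have hW0 : 0 ≤ W := by have := hV 0; positivity
  have hbound : ∀ n ≤ T, V 0 + n * (b + a * W) ≤ W := by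
    intro n hn
    have hn' : (n : ℝ) ≤ T := by exact_mod_cast hn
    have h1 : (n : ℝ) * (b + a * W) ≤ T * (b + a * W) :=
      mul_le_mul_of_nonneg_right hn' (by positivity)
    have h2 := mul_le_mul_of_nonneg_right haT hW0
    linarith
  have key : ∀ n ≤ T, V n + ν * ∑ j ∈ Finset.range n, G j ≤ V 0 + n * (b + a * W) := by
    intro n
    induction n with
    | zero => intro _; simp
    | succ n ih =>
      intro hn
      have h1 := ih (by omega)
      have h2 := hbound n (by omega)
      have h3 : 0 ≤ ν * ∑ j ∈ Finset.range n, G j :=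
        mul_nonneg hν (Finset.sum_nonneg fun j _ => hG j)
      have h4 := mul_le_mul_of_nonneg_left (by linarith : V n ≤ W) ha
      rw [Finset.sum_range_succ]
      push_cast
      have := h n
      linarith
  have h1 := key T le_rfl
  have h2 := hbound T le_rfl
  have := hV T
  linarith

variable {Ω α β : Type*} [MeasurableSpace Ω] [MeasurableSpace α] [MeasurableSpace β]
  {P : Measure Ω} [IsProbabilityMeasure P]

/-- Integration with respect to one of two independent variables. -/
lemma integral_of_indepFun {Y : Ω → α} {Z : Ω → β} (hY : Measurable Y) (hZ : Measurable Z)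
    (hind : IndepFun Y Z P) {φ : α × β → ℝ} (hφ : Measurable φ)
    (hint : Integrable (fun ω => φ (Y ω, Z ω)) P) :
    ∫ ω, φ (Y ω, Z ω) ∂P = ∫ ω, ∫ b, φ (Y ω, b) ∂(P.map Z) ∂P ∧
      Integrable (fun ω => ∫ b, φ (Y ω, b) ∂(P.map Z)) P := by
  have hYp : IsProbabilityMeasure (P.map Y) := Measure.isProbabilityMeasure_map hY.aemeasurable
  have hZp : IsProbabilityMeasure (P.map Z) := Measure.isProbabilityMeasure_map hZ.aemeasurable
  have hmap := (indepFun_iff_map_prod_eq_prod_map_map hY.aemeasurable hZ.aemeasurable).1 hind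
  have hYZ : Measurable fun ω => (Y ω, Z ω) := hY.prodMk hZ
  have hi : Integrable φ ((P.map Y).prod (P.map Z)) := by
    rw [← hmap, integrable_map_measure hφ.aestronglyMeasurable hYZ.aemeasurable]
    exact hint
  constructor
  · rw [← integral_map (φ := fun ω => (Y ω, Z ω)) hYZ.aemeasurable hφ.aestronglyMeasurable, hmap,
      integral_prod _ hi, integral_map hY.aemeasurable]
    exact hi.integral_prod_left.aestronglyMeasurable
  · have := hi.integral_prod_left
    rw [integrable_map_measure this.aestronglyMeasurable hY.aemeasurable] at this
    exact this

variable {d : ℕ} {Ξ : Type*} [MeasurableSpace Ξ] {p q : ENNReal} {κ r μ M₂ t L ρ Δ σ τ ν : ℝ}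
  {T : ℕ} {X : Set (Vec d)} {Ψ : Vec d → ℝ} {x₀ : Vec d} {𝒟 : Measure Ξ}
  [IsProbabilityMeasure 𝒟] {h : Vec d → Ξ → ℝ} {K : Ξ → ℝ} {δ : Vec d → ℝ}

/-- Iterates may leave the ball of radius `ρ` about `u`, but beyond `ρ` one has `y ≤ y^s / ρ^(s-1)`,
which the divergence controls. The noise bias thereby becomes part of the growth factor of the
recursion. -/
lemma norm_sub_le_add_bregman (hκ : 0 < κ) (hp1 : 1 ≤ p) (hp2 : p ≤ 2) {Φ : Vec d → ℝ}
    (hΦ : UniformlyConvex p 1 ((1 + κ) / κ) Φ) (hρ : 0 < ρ) (x u : Vec d) :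
    ‖x - u‖ ≤ ρ + ((1 + κ) / κ) / ρ ^ ((1 + κ) / κ - 1) * bregman Φ u x := by
  have hs1 := one_lt_sExp hκ
  have h1 := hΦ.norm_rpow_le_bregman (by linarith) hp1 hp2 x u
  set s := (1 + κ) / κ
  have hs0 : 0 < s := by linarith
  set y := ‖x - u‖ with hy
  have hy0 : 0 ≤ y := norm_nonneg _
  have hD : 0 ≤ bregman Φ u x := hΦ.bregman_nonneg hs0 hp1 _ _
  rcases le_total y ρ with hle | hle
  · exact hle.trans (le_add_of_nonneg_right (by positivity))
  · have hypos : 0 < y := hρ.trans_le hle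
    have h2 : ρ ^ (s - 1) * y ≤ y ^ s := by
      rw [show y ^ s = y ^ (s - 1) * y by rw [← Real.rpow_add_one hypos.ne']; congr 1; ring]
      exact mul_le_mul_of_nonneg_right (Real.rpow_le_rpow hρ.le hle (by linarith)) hy0
    have h3 : y ≤ s / ρ ^ (s - 1) * bregman Φ u x := by
      rw [div_mul_eq_mul_div, le_div_iff₀ (by positivity), mul_comm]
      refine h2.trans ?_
      have := mul_le_mul_of_nonneg_left h1 hs0.le
      rwa [← mul_assoc, mul_one_div_cancel hs0.ne', one_mul] at this
    linarith

lemma integrable_comp_of_mem {F : Vec d → ℝ} (hF : Continuous F) (hXc : IsCompact X)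
    {x : Ω → Vec d} (hx : Measurable x) (hmem : ∀ ω, x ω ∈ X) : Integrable (fun ω => F (x ω)) P := by
  obtain ⟨B, hB⟩ := hXc.exists_bound_of_continuousOn hF.continuousOn
  exact (integrable_const B).mono' (hF.measurable.comp hx).aestronglyMeasurable
    (Filter.Eventually.of_forall fun ω => hB _ (hmem ω))

/-- The expected Bregman divergence after one step of ZO-RSMD. -/
lemma integral_bregman_step_le (hd : 2 ≤ d) (hκ : 0 < κ) (hκ1 : κ ≤ 1) (hp1 : 1 ≤ p)
    (hp2 : p ≤ 2) (hpq : p.HolderConjugate q) (hXc : IsCompact X) (hX : Convex ℝ X)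
    (hΨ : UniformlyConvex p 1 ((1 + κ) / κ) Ψ) (hL1 : 1 ≤ L)
    (hL : HasProxGrowth p ((1 + κ) / κ) L x₀ Ψ)
    (hh : IsLipschitzObjective κ M₂ (nbhd X t) X 𝒟 h K) (hM : 0 < M₂) (ht : 0 < t) (hτ : 0 < τ)
    (hτt : τ ≤ t) (hν : 0 < ν) (hΔ : 0 ≤ Δ) (hδm : Measurable δ) (hδ : ∀ x, |δ x| ≤ Δ)
    (hρ : 0 < ρ) {u : Vec d} (hu : u ∈ X) {w x : Ω → Vec d} {ζ : Ω → Ξ × Vec d}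
    (hwm : Measurable w) (hxm : Measurable x) (hζm : Measurable ζ) (hw : ∀ ω, w ω ∈ X)
    (hx : ∀ ω, x ω ∈ X) (hζ : P.map ζ = 𝒟.prod (uniformSphere d))
    (hind : IndepFun (fun ω => (w ω, x ω)) ζ P) :
    ∫ ω, bregman (recentre Ψ x₀ (w ω)) u (zoStep X Ψ x₀ ν τ h δ (w ω) (x ω) (ζ ω)) ∂P ≤
      (1 + ν * (2 * √d * Δ / τ) * (((1 + κ) / κ) / ρ ^ ((1 + κ) / κ - 1))) *
        (∫ ω, bregman (recentre Ψ x₀ (w ω)) u (x ω) ∂P) -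
        ν * ((∫ ω, expObj 𝒟 h (x ω) ∂P) - expObj 𝒟 h u) +
        (ν * (4 * M₂ * τ + 2 * √d * Δ / τ * ρ) + 40000 * ν ^ (1 + κ) *
          (sigmaBase d q M₂ ^ (1 + κ) + (d * aq d q * Δ / τ) ^ (1 + κ))) := by
  have hXn : X.Nonempty := ⟨u, hu⟩
  have hstep : Measurable fun a : (Vec d × Vec d) × Ξ × Vec d =>
      zoStep X Ψ x₀ ν τ h δ a.1.1 a.1.2 a.2 :=
    measurable_zoStep hκ hκ1 hp1 hp2 hXc hXn hX hΨ (hh.measurable_uncurry hM) hδm ν τ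
      measurable_fst.fst measurable_fst.snd measurable_snd
  have hφ := measurable_bregman_recentre (x₀ := x₀) hΨ.differentiable.continuous
    (measurable_fst.fst (f := fun a : (Vec d × Vec d) × Ξ × Vec d => a.1)) hstep u
  have hsm : Measurable fun ω => zoStep X Ψ x₀ ν τ h δ (w ω) (x ω) (ζ ω) :=
    measurable_zoStep hκ hκ1 hp1 hp2 hXc hXn hX hΨ (hh.measurable_uncurry hM) hδm ν τ
      hwm hxm hζm
  have hint := integrable_bregman_recentre (P := P) hκ hp1 hp2 hXc hΨ hL1 hL hwm hsm hw
    (fun ω => zoStep_mem hκ hκ1 hp1 hp2 hXc hXn hΨ _ _ _) hu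
  have hintx := integrable_bregman_recentre (P := P) hκ hp1 hp2 hXc hΨ hL1 hL hwm hxm hw hx hu
  have hintF := integrable_comp_of_mem (P := P) (hh.continuous_expObj hM hXn) hXc hxm hx
  -- Conditioning on the past: the current sample is independent of centre and iterate, so the bound
  -- for deterministic `w` and `x` may be integrated.
  obtain ⟨h1, h2⟩ := integral_of_indepFun (hwm.prodMk hxm) hζm hind hφ hint
  simp only at h1 h2
  rw [hζ] at h1 h2
  rw [h1]
  set β := 2 * √d * Δ / τ with hβ
  have hβ0 : 0 ≤ β := by positivity
  set c := ((1 + κ) / κ) / ρ ^ ((1 + κ) / κ - 1)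
  set E := sigmaBase d q M₂ ^ (1 + κ) + (d * aq d q * Δ / τ) ^ (1 + κ)
  have hle : ∀ ω, ∫ b, bregman (recentre Ψ x₀ (w ω)) u (zoStep X Ψ x₀ ν τ h δ (w ω) (x ω) b)
      ∂(𝒟.prod (uniformSphere d)) ≤
      (1 + ν * β * c) * bregman (recentre Ψ x₀ (w ω)) u (x ω) -
        ν * (expObj 𝒟 h (x ω) - expObj 𝒟 h u) +
        (ν * (4 * M₂ * τ + β * ρ) + 40000 * ν ^ (1 + κ) * E) := by
    intro ω
    have k1 := integral_bregman_zoStep_le hd hκ hκ1 hp1 hp2 hpq hXc hX hΨ hL1 hL hh hM ht hτ hτt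
      hν hΔ hδm hδ (hw ω) (hx ω) hu
    have k2 := norm_sub_le_add_bregman hκ hp1 hp2 (hΨ.recentre x₀ (w ω)) hρ (x ω) u
    have k3 := mul_le_mul_of_nonneg_left k2 (mul_nonneg hν.le hβ0)
    linarith
  have hi1 : Integrable (fun ω => (1 + ν * β * c) * bregman (recentre Ψ x₀ (w ω)) u (x ω)) P :=
    hintx.const_mul _
  have hi2 : Integrable (fun ω => ν * (expObj 𝒟 h (x ω) - expObj 𝒟 h u)) P :=
    (hintF.sub (integrable_const _)).const_mul _
  have hi3 : Integrable (fun ω => (1 + ν * β * c) * bregman (recentre Ψ x₀ (w ω)) u (x ω) -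
      ν * (expObj 𝒟 h (x ω) - expObj 𝒟 h u)) P := hi1.sub hi2
  have hi4 : Integrable (fun ω => (1 + ν * β * c) * bregman (recentre Ψ x₀ (w ω)) u (x ω) -
      ν * (expObj 𝒟 h (x ω) - expObj 𝒟 h u) +
      (ν * (4 * M₂ * τ + β * ρ) + 40000 * ν ^ (1 + κ) * E)) P := hi3.add (integrable_const _)
  refine (integral_mono h2 hi4 hle).trans (le_of_eq ?_)
  rw [integral_add hi3 (integrable_const _), integral_sub hi1 hi2, integral_const_mul,
    integral_const_mul, integral_sub hintF (integrable_const _), integral_const, integral_const]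
  simp only [probReal_univ, smul_eq_mul, one_mul]

/-- The recursion for the Bregman divergences yields the accuracy of a restart. -/
lemma EpochBounds.sum_le (hκ : 0 < κ) (hκ1 : κ ≤ 1) (hr : 1 ≤ r) (hμ : 0 < μ) (hL1 : 1 ≤ L)
    (hM : 0 < M₂) (hE : EpochBounds d q κ r μ M₂ L ρ Δ σ T τ ν) (hΔ : 0 ≤ Δ) (hρ : 0 < ρ)
    (ha : 0 < aq d q) (hd : 0 < d) {V G : ℕ → ℝ} (hV0 : ∀ j, 0 ≤ V j) (hG0 : ∀ j, 0 ≤ G j)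
    (hstep : ∀ j, V (j + 1) ≤
      (1 + ν * (2 * √d * Δ / τ) * (((1 + κ) / κ) / ρ ^ ((1 + κ) / κ - 1))) * V j - ν * G j +
        (ν * (4 * M₂ * τ + 2 * √d * Δ / τ * ρ) + 40000 * ν ^ (1 + κ) *
          (sigmaBase d q M₂ ^ (1 + κ) + (d * aq d q * Δ / τ) ^ (1 + κ))))
    (hVstart : V 0 ≤ L * (2 ^ ((1 + κ) / κ) * ρ ^ ((1 + κ) / κ))) :
    1 / T * ∑ j ∈ Finset.range T, G j ≤ μ / 2 * ρ ^ r := by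
  have hs2 := two_le_sExp hκ hκ1
  have hT0 : (0 : ℝ) < T := by exact_mod_cast hE.steps_pos
  have hτ := hE.tau_pos
  have hν := hE.nu_pos
  have hnoise := hE.noise_le
  have hνT := hE.nu_mul
  have hνσ := hE.nu_rpow
  have hσ := hE.sigma_ge
  have hτle := hE.tau_le
  have hD0 : 0 ≤ (d * aq d q * Δ / τ) ^ (1 + κ) := by positivity
  have hS0 := (sigmaBase_pos (M₂ := M₂) hd ha hM).le
  have hρs : ρ ^ ((1 + κ) / κ) = ρ ^ ((1 + κ) / κ - 1) * ρ := by
    rw [← Real.rpow_add_one hρ.ne']; congr 1; ring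
  have hΓ : stepConst κ r = 2 * 2 ^ ((1 + κ) / κ) + 80010 + 4 * 8 ^ r := rfl
  have hΓ1 := one_le_stepConst κ r
  set s := (1 + κ) / κ
  set β := 2 * √d * Δ / τ with hβ
  have hβ0 : 0 ≤ β := by positivity
  set E := sigmaBase d q M₂ ^ (1 + κ) + (d * aq d q * Δ / τ) ^ (1 + κ) with hEdef
  have hE0 : 0 ≤ E := add_nonneg (Real.rpow_nonneg hS0 _) hD0
  -- The admissible noise is tuned to this: `ν T = ρ^s / (M₂ τ)` and `β ≤ M₂ τ / (2 s ρ)` multiply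
  -- to exactly `1/2`.
  have haT : ν * β * (s / ρ ^ (s - 1)) * T ≤ 1 / 2 := by
    calc ν * β * (s / ρ ^ (s - 1)) * T = ν * T * β * (s / ρ ^ (s - 1)) := by ring
      _ ≤ ρ ^ s / (M₂ * τ) * (1 / (2 * s) * (M₂ * τ / ρ)) * (s / ρ ^ (s - 1)) := by
        rw [hνT]; gcongr
      _ = 1 / 2 := by rw [hρs]; field_simp
  -- Smoothing contributes `4`, noise `1` and the second-order term `40000`, each in units of `ρ^s`.
  have hTb : T * (ν * (4 * M₂ * τ + β * ρ) + 40000 * ν ^ (1 + κ) * E) ≤ 40005 * ρ ^ s := by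
    have h1 : β * ρ ≤ M₂ * τ := by
      calc β * ρ ≤ 1 / (2 * s) * (M₂ * τ / ρ) * ρ := by gcongr
        _ = 1 / (2 * s) * (M₂ * τ) := by field_simp
        _ ≤ 1 * (M₂ * τ) := by
          gcongr
          rw [div_le_one (by linarith)]; linarith
        _ = M₂ * τ := one_mul _
    have h2 : ν * T * (4 * M₂ * τ + β * ρ) ≤ 5 * ρ ^ s := by
      calc ν * T * (4 * M₂ * τ + β * ρ) ≤ ρ ^ s / (M₂ * τ) * (5 * (M₂ * τ)) := by
            rw [hνT]
            gcongr
            linarith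
        _ = 5 * ρ ^ s := by field_simp
    have h3 : ν ^ (1 + κ) * E * T ≤ ρ ^ s := by
      rw [← hνσ]
      gcongr
    linarith
  have hrec := sum_le_of_recursion (T := T) (V := V) (G := G) hV0 hG0 (by positivity) (by positivity) hν.le haT hstep
  -- Here the summands `2 · 2^s` and `80010` of `stepConst` are used: twice the starting divergence
  -- and twice `40005`.
  have hsum : ν * ∑ j ∈ Finset.range T, G j ≤ L * stepConst κ r * ρ ^ s := by
    have h8 : (0 : ℝ) ≤ 8 ^ r := by positivity
    have hρs0 : 0 ≤ ρ ^ s := by positivity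
    have h1 : 2 * 2 ^ s * L + 80010 ≤ L * stepConst κ r := by
      rw [hΓ]
      have h2s : (0 : ℝ) ≤ 2 ^ s := by positivity
      nlinarith
    have := mul_le_mul_of_nonneg_right h1 hρs0
    linarith
  have hMτ : 0 < M₂ * τ := by positivity
  have h1 : 1 / T * ∑ j ∈ Finset.range T, G j =
      (ν * ∑ j ∈ Finset.range T, G j) / (ν * T) := by
    field_simp
  have hLr : L ≤ L ^ r := by
    simpa using Real.rpow_le_rpow_of_exponent_le hL1 hr
  have h2r : (1 : ℝ) ≤ 2 ^ r := Real.one_le_rpow (by norm_num) (by linarith)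
  rw [h1, hνT]
  calc (ν * ∑ j ∈ Finset.range T, G j) / (ρ ^ s / (M₂ * τ))
      ≤ L * stepConst κ r * ρ ^ s / (ρ ^ s / (M₂ * τ)) := by gcongr
    _ = L * stepConst κ r * (M₂ * τ) := by field_simp
    _ ≤ L * stepConst κ r * (μ * ρ ^ r / (2 * 2 ^ r) / (stepConst κ r * L ^ r)) := by gcongr
    _ = μ / 2 * ρ ^ r * (L / (2 ^ r * L ^ r)) := by field_simp
    _ ≤ μ / 2 * ρ ^ r * 1 := by
      gcongr
      rw [div_le_one (by positivity)]
      nlinarith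
    _ = μ / 2 * ρ ^ r := mul_one _

/-- This is why the prox-function is recentred: the divergence of `u` from `w` becomes one from the
centre `x₀`, the only point where the growth constant applies. The factor `2` of the hypothesis is
absorbed by `s ≥ 2`. -/
lemma integral_bregman_start_le (hκ : 0 < κ) (hκ1 : κ ≤ 1) (hp1 : 1 ≤ p) (hp2 : p ≤ 2)
    (hXc : IsCompact X) (hΨ : UniformlyConvex p 1 ((1 + κ) / κ) Ψ) (hL1 : 1 ≤ L)
    (hL : HasProxGrowth p ((1 + κ) / κ) L x₀ Ψ) (hρ : 0 < ρ) {u : Vec d} (hu : u ∈ X)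
    {w : Ω → Vec d} (hwm : Measurable w) (hw : ∀ ω, w ω ∈ X)
    (hstart : ∫ ω, lpNorm p (u - w ω) ^ ((1 + κ) / κ) ∂P ≤ 2 * (2 * ρ) ^ ((1 + κ) / κ)) :
    ∫ ω, bregman (recentre Ψ x₀ (w ω)) u (w ω) ∂P ≤
      L * (2 ^ ((1 + κ) / κ) * ρ ^ ((1 + κ) / κ)) := by
  have hs2 := two_le_sExp hκ hκ1
  have hc : Continuous fun z => lpNorm p (u - z) ^ ((1 + κ) / κ) :=
    ((continuous_lpNorm hp1 hp2).comp (continuous_const.sub continuous_id)).rpow_const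
      fun _ => Or.inr (by linarith)
  have hi : Integrable (fun ω => lpNorm p (u - w ω) ^ ((1 + κ) / κ)) P :=
    integrable_comp_of_mem hc hXc hwm hw
  have h1 : ∫ ω, bregman (recentre Ψ x₀ (w ω)) u (w ω) ∂P ≤
      ∫ ω, L / ((1 + κ) / κ) * lpNorm p (u - w ω) ^ ((1 + κ) / κ) ∂P := by
    refine integral_mono (integrable_bregman_recentre hκ hp1 hp2 hXc hΨ hL1 hL hwm hwm hw hw hu)
      (hi.const_mul _) fun ω => ?_
    have h2 := hL (u - w ω + x₀)
    simp only
    rw [bregman_recentre, sub_self, zero_add]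
    rwa [add_sub_cancel_right] at h2
  rw [integral_const_mul] at h1
  refine h1.trans ((mul_le_mul_of_nonneg_left hstart (by positivity)).trans ?_)
  rw [Real.mul_rpow (by norm_num) hρ.le]
  have h3 : L / ((1 + κ) / κ) * 2 ≤ L := by
    rw [div_mul_eq_mul_div, div_le_iff₀ (by linarith)]
    nlinarith
  have h4 : 0 ≤ (2 : ℝ) ^ ((1 + κ) / κ) * ρ ^ ((1 + κ) / κ) := by positivity
  have := mul_le_mul_of_nonneg_right h3 h4
  linarith

lemma average_mem (hX : Convex ℝ X) (hT : 0 < T) {x : ℕ → Vec d} (hx : ∀ j, x j ∈ X) :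
    (1 / (T : ℝ)) • ∑ j ∈ Finset.range T, x j ∈ X := by
  have hT0 : (0 : ℝ) < T := by exact_mod_cast hT
  rw [Finset.smul_sum]
  exact hX.sum_mem (fun _ _ => by positivity) (by simp [hT0.ne']) fun j _ => hx j

lemma integral_average_le {F : Vec d → ℝ} (hFc : Continuous F) (hF : ConvexOn ℝ X F)
    (hXc : IsCompact X) (hT : 0 < T) {x : ℕ → Ω → Vec d} (hxm : ∀ j, Measurable (x j))
    (hx : ∀ j ω, x j ω ∈ X) (c : ℝ) :
    (∫ ω, F ((1 / (T : ℝ)) • ∑ j ∈ Finset.range T, x j ω) ∂P) - c ≤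
      1 / T * ∑ j ∈ Finset.range T, ((∫ ω, F (x j ω) ∂P) - c) := by
  have hT0 : (0 : ℝ) < T := by exact_mod_cast hT
  have hintF := fun j => integrable_comp_of_mem (P := P) hFc hXc (hxm j) (hx j)
  have hjen : ∀ ω, F ((1 / (T : ℝ)) • ∑ j ∈ Finset.range T, x j ω) ≤
      1 / T * ∑ j ∈ Finset.range T, F (x j ω) := by
    intro ω
    have := hF.map_sum_le (t := Finset.range T) (w := fun _ => 1 / (T : ℝ))
      (p := fun j => x j ω) (fun _ _ => by positivity) (by simp [hT0.ne'])
      (fun j _ => hx j ω)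
    rwa [← Finset.smul_sum, ← Finset.smul_sum, smul_eq_mul] at this
  have hmeas : Measurable fun ω => (1 / (T : ℝ)) • ∑ j ∈ Finset.range T, x j ω :=
    (Finset.measurable_fun_sum (Finset.range T) fun j _ => hxm j).fun_const_smul (1 / (T : ℝ))
  have hle := integral_mono (integrable_comp_of_mem (P := P) hFc hXc hmeas
      fun ω => average_mem hF.1 hT fun j => hx j ω)
    ((integrable_finsetSum (Finset.range T) fun j _ => hintF j).const_mul (1 / (T : ℝ))) hjen
  rw [integral_const_mul, integral_finsetSum _ fun j _ => hintF j] at hle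
  rw [Finset.sum_sub_distrib, Finset.sum_const, Finset.card_range, nsmul_eq_mul, mul_sub]
  have : 1 / (T : ℝ) * (T * c) = c := by field_simp
  linarith

/-- One restart halves the radius. -/
lemma integral_epoch_le (hd : 2 ≤ d) (hκ : 0 < κ) (hκ1 : κ ≤ 1) (hr : 1 ≤ r) (hμ : 0 < μ)
    (hp1 : 1 ≤ p) (hp2 : p ≤ 2) (hpq : p.HolderConjugate q) (hXc : IsCompact X) (hX : Convex ℝ X)
    (hΨ : UniformlyConvex p 1 ((1 + κ) / κ) Ψ) (hL1 : 1 ≤ L)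
    (hL : HasProxGrowth p ((1 + κ) / κ) L x₀ Ψ)
    (hh : IsLipschitzObjective κ M₂ (nbhd X t) X 𝒟 h K) (hM : 0 < M₂) (ht : 0 < t)
    (hE : EpochBounds d q κ r μ M₂ L ρ Δ σ T τ ν) (hτt : τ ≤ t) (hΔ : 0 ≤ Δ)
    (hδm : Measurable δ) (hδ : ∀ x, |δ x| ≤ Δ) (hρ : 0 < ρ) {u : Vec d} (hu : u ∈ X)
    (hmin : IsMinOn (expObj 𝒟 h) X u) {w : Ω → Vec d} {x : ℕ → Ω → Vec d}
    {ζ : ℕ → Ω → Ξ × Vec d} (hwm : Measurable w) (hxm : ∀ j, Measurable (x j))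
    (hζm : ∀ j, Measurable (ζ j)) (hw : ∀ ω, w ω ∈ X) (hx0 : x 0 = w)
    (hxs : ∀ j ω, x (j + 1) ω = zoStep X Ψ x₀ ν τ h δ (w ω) (x j ω) (ζ j ω))
    (hζ : ∀ j, P.map (ζ j) = 𝒟.prod (uniformSphere d))
    (hind : ∀ j, IndepFun (fun ω => (w ω, x j ω)) (ζ j) P)
    (hstart : ∫ ω, lpNorm p (u - w ω) ^ ((1 + κ) / κ) ∂P ≤ 2 * (2 * ρ) ^ ((1 + κ) / κ)) :
    (∫ ω, expObj 𝒟 h ((1 / (T : ℝ)) • ∑ j ∈ Finset.range T, x j ω) ∂P) - expObj 𝒟 h u ≤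
      μ / 2 * ρ ^ r := by
  have hXn : X.Nonempty := ⟨u, hu⟩
  have hs2 := two_le_sExp hκ hκ1
  have hx : ∀ j ω, x j ω ∈ X := by
    intro j ω
    cases j with
    | zero => rw [hx0]; exact hw ω
    | succ j => rw [hxs]; exact zoStep_mem hκ hκ1 hp1 hp2 hXc hXn hΨ _ _ _
  have hFc := hh.continuous_expObj hM hXn
  have hFconv := hh.convexOn_expObj (fun z hz => mem_nbhd_of_mem hz) hX hXn
  refine (integral_average_le hFc hFconv hXc hE.steps_pos hxm hx _).trans ?_
  refine hE.sum_le hκ hκ1 hr hμ hL1 hM hΔ hρ (aq_pos hd hp1 hp2 hpq) (by omega)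
    (V := fun j => ∫ ω, bregman (recentre Ψ x₀ (w ω)) u (x j ω) ∂P)
    (fun j => integral_nonneg fun ω => (hΨ.recentre x₀ (w ω)).bregman_nonneg (by linarith) hp1 _ _)
    (fun j => ?_) (fun j => ?_) ?_
  · have : ∫ _ω, expObj 𝒟 h u ∂P ≤ ∫ ω, expObj 𝒟 h (x j ω) ∂P :=
      integral_mono (integrable_const _) (integrable_comp_of_mem hFc hXc (hxm j) (hx j))
        fun ω => hmin (hx j ω)
    rw [integral_const, probReal_univ, one_smul] at this
    exact sub_nonneg.2 this
  · have := integral_bregman_step_le hd hκ hκ1 hp1 hp2 hpq hXc hX hΨ hL1 hL hh hM ht hE.tau_pos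
      hτt hE.nu_pos hΔ hδm hδ hρ hu hwm (hxm j) (hζm j) hw (hx j) (hζ j) (hind j)
    simp_rw [← hxs] at this
    exact this
  · simp only [hx0]
    exact integral_bregman_start_le hκ hκ1 hp1 hp2 hXc hΨ hL1 hL hρ hu hwm hw hstart

end Epoch

end ZORestart

/-! ### Independence of the past from the current sample. -/

namespace ZORestart

section History

variable {Ω : Type*} [mΩ : MeasurableSpace Ω] {P : Measure Ω} [IsProbabilityMeasure P]

/-- Independence of a σ-algebra from a join. -/
lemma indep_sup_left {A B C : MeasurableSpace Ω} (hA : A ≤ mΩ) (hB : B ≤ mΩ) (hC : C ≤ mΩ)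
    (hABC : Indep A (B ⊔ C) P) (hBC : Indep B C P) : Indep (A ⊔ B) C P := by
  have hgen : MeasurableSpace.generateFrom
      (Set.image2 (· ∩ ·) {a | MeasurableSet[A] a} {b | MeasurableSet[B] b}) = A ⊔ B := by
    refine le_antisymm ?_ (sup_le ?_ ?_)
    · refine MeasurableSpace.generateFrom_le ?_
      rintro _ ⟨a, ha, b, hb, rfl⟩
      have h1 : MeasurableSet[A ⊔ B] a := (le_sup_left : A ≤ A ⊔ B) _ ha
      have h2 : MeasurableSet[A ⊔ B] b := (le_sup_right : B ≤ A ⊔ B) _ hb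
      exact h1.inter h2
    · intro a ha
      exact MeasurableSpace.measurableSet_generateFrom
        ⟨a, ha, Set.univ, @MeasurableSet.univ _ B, Set.inter_univ a⟩
    · intro b hb
      exact MeasurableSpace.measurableSet_generateFrom
        ⟨Set.univ, @MeasurableSet.univ _ A, b, hb, Set.univ_inter b⟩
  rw [Indep_iff] at hABC hBC
  refine IndepSets.indep (m1 := A ⊔ B) (m2 := C) (sup_le hA hB) hC
    (p1 := Set.image2 (· ∩ ·) {a | MeasurableSet[A] a} {b | MeasurableSet[B] b})
    (p2 := {c | MeasurableSet[C] c}) ?_ (@MeasurableSpace.isPiSystem_measurableSet _ C)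
    hgen.symm (@MeasurableSpace.generateFrom_measurableSet _ C).symm ?_
  · rintro _ ⟨a, ha, b, hb, rfl⟩ _ ⟨a', ha', b', hb', rfl⟩ -
    exact ⟨a ∩ a', @MeasurableSet.inter _ A _ _ ha ha', b ∩ b',
      @MeasurableSet.inter _ B _ _ hb hb', Set.inter_inter_inter_comm a a' b b'⟩
  · rw [IndepSets_iff]
    rintro _ c ⟨a, ha, b, hb, rfl⟩ hc
    have hb' : MeasurableSet[B ⊔ C] b := (le_sup_left : B ≤ B ⊔ C) _ hb
    have hc' : MeasurableSet[B ⊔ C] c := (le_sup_right : C ≤ B ⊔ C) _ hc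
    have hbc : MeasurableSet[B ⊔ C] (b ∩ c) := hb'.inter hc'
    rw [Set.inter_assoc, hABC a _ ha hbc, hBC b c hb hc, hABC a b ha hb', mul_assoc]

variable {ι α β : Type*} [mα : MeasurableSpace α] [mβ : MeasurableSpace β]

/-- The information contained in the start and in the samples with index in `S`. -/
@[reducible] def history (z : Ω → α) (ζ : ι → Ω → β) (S : Set ι) : MeasurableSpace Ω :=
  mα.comap z ⊔ ⨆ i ∈ S, mβ.comap (ζ i)

omit mΩ in
lemma measurable_history_start (z : Ω → α) (ζ : ι → Ω → β) (S : Set ι) :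
    Measurable[history z ζ S] z :=
  Measurable.mono (comap_measurable z) le_sup_left le_rfl

omit mΩ in
lemma measurable_history_sample (z : Ω → α) (ζ : ι → Ω → β) {S : Set ι} {i : ι} (hi : i ∈ S) :
    Measurable[history z ζ S] (ζ i) :=
  Measurable.mono (comap_measurable (ζ i))
    (le_sup_of_le_right (le_iSup₂_of_le i hi le_rfl)) le_rfl

/-- A sample outside `S` is independent of those in `S`, and the start is independent of all samples
jointly; `indep_sup_left` merges the two. -/
lemma indepFun_of_measurable_history {z : Ω → α} {ζ : ι → Ω → β} (hz : Measurable z)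
    (hζ : ∀ i, Measurable (ζ i)) (hind : iIndepFun ζ P) (hzζ : IndepFun z (fun ω i => ζ i ω) P)
    {S : Set ι} {i : ι} (hi : i ∉ S) {γ : Type*} [mγ : MeasurableSpace γ] {Y : Ω → γ}
    (hY : Measurable[history z ζ S] Y) : IndepFun Y (ζ i) P := by
  rw [IndepFun_iff_Indep] at hzζ ⊢
  have hle : ∀ i, mβ.comap (ζ i) ≤ MeasurableSpace.comap (fun ω i => ζ i ω) MeasurableSpace.pi := by
    intro i
    rw [← measurable_iff_comap_le]
    exact (measurable_pi_apply i).comp (comap_measurable fun ω i => ζ i ω)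
  have hBC : Indep (⨆ j ∈ S, mβ.comap (ζ j)) (mβ.comap (ζ i)) P := by
    have := indep_iSup_of_disjoint (fun i => (hζ i).comap_le) hind
      (Set.disjoint_singleton_right.2 hi)
    simpa using this
  have hA : Indep (history z ζ S) (mβ.comap (ζ i)) P :=
    indep_sup_left hz.comap_le (iSup₂_le fun i _ => (hζ i).comap_le) (hζ i).comap_le
      (indep_of_indep_of_le_right hzζ (sup_le (iSup₂_le fun j _ => hle j) (hle i))) hBC
  exact indep_of_indep_of_le_left hA (measurable_iff_comap_le.1 hY)

end History

/-! ### Pathwise properties of the iterates. -/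

section Pathwise

variable {d : ℕ} {Ξ : Type*} {p : ENNReal} {κ t : ℝ} {X : Set (Vec d)} {Ψ : Vec d → ℝ}
  {x₀ : Vec d}

lemma rsmdIter_mem (hκ : 0 < κ) (hκ1 : κ ≤ 1) (hp1 : 1 ≤ p) (hp2 : p ≤ 2) (hXc : IsCompact X)
    {Φ : Vec d → ℝ} (hΦ : UniformlyConvex p 1 ((1 + κ) / κ) Φ) (ν τ : ℝ)
    (φ : Vec d → Ξ → ℝ) (ξ : ℕ → Ξ) (e : ℕ → Vec d) {z : Vec d} (hz : z ∈ X) (j : ℕ) :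
    rsmdIter X Φ ν τ φ ξ e z j ∈ X := by
  cases j with
  | zero => exact hz
  | succ j => exact (isLinMin_mirrorStep hκ hκ1 hp1 hp2 hXc ⟨z, hz⟩ hΦ ν _ _).1

/-- Only the values of the oracle near `X` matter. -/
lemma rsmdIter_congr (hκ : 0 < κ) (hκ1 : κ ≤ 1) (hp1 : 1 ≤ p) (hp2 : p ≤ 2) (hXc : IsCompact X)
    {Φ : Vec d → ℝ} (hΦ : UniformlyConvex p 1 ((1 + κ) / κ) Φ) (ν τ : ℝ)
    {φ φ' : Vec d → Ξ → ℝ} (hφ : ∀ x ∈ nbhd X τ, ∀ s, φ x s = φ' x s) (ξ : ℕ → Ξ) {e : ℕ → Vec d}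
    (he : ∀ j, ‖e j‖ = 1) {z : Vec d} (hz : z ∈ X) (j : ℕ) :
    rsmdIter X Φ ν τ φ ξ e z j = rsmdIter X Φ ν τ φ' ξ e z j := by
  induction j with
  | zero => rfl
  | succ j ih =>
    have hx := rsmdIter_mem hκ hκ1 hp1 hp2 hXc hΦ ν τ φ' ξ e hz j
    simp only [rsmdIter, ih]
    congr 1
    set x := rsmdIter X Φ ν τ φ' ξ e z j
    have h1 : x + τ • e j ∈ nbhd X τ := ⟨x, hx, e j, (he j).le, rfl⟩
    have h2 : x - τ • e j ∈ nbhd X τ := ⟨x, hx, -e j, by rw [norm_neg, he], by module⟩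
    simp only [gradEst, hφ _ h1, hφ _ h2]

lemma restarts_mem (hκ : 0 < κ) (hκ1 : κ ≤ 1) (hp1 : 1 ≤ p) (hp2 : p ≤ 2) (hXc : IsCompact X)
    (hX : Convex ℝ X) (hΨ : UniformlyConvex p 1 ((1 + κ) / κ) Ψ) {N : ℕ} {T : ℕ → ℕ}
    (hT : ∀ k ∈ Finset.Icc 1 N, 0 < T k) (ν τ : ℕ → ℝ) (f : Vec d → Ξ → ℝ)
    (δ : ℕ → Vec d → ℝ) (ξ : ℕ × ℕ → Ξ) (e : ℕ × ℕ → Vec d) {z : Vec d} (hz : z ∈ X) {k : ℕ}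
    (hk : k ≤ N) : restarts X Ψ x₀ T ν τ f δ ξ e z k ∈ X := by
  induction k with
  | zero => exact hz
  | succ k ih =>
    have hw := ih (by omega)
    exact average_mem hX (hT _ (Finset.mem_Icc.2 ⟨by omega, hk⟩)) fun j =>
      rsmdIter_mem hκ hκ1 hp1 hp2 hXc (hΨ.recentre x₀ _) _ _ _ _ _ hw j

/-- For unit directions all queries of restart `k` lie in `nbhd X (τ k)`. This permits exchanging
objective and noise for globally controlled versions. -/
lemma restarts_congr (hκ : 0 < κ) (hκ1 : κ ≤ 1) (hp1 : 1 ≤ p) (hp2 : p ≤ 2) (hXc : IsCompact X)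
    (hX : Convex ℝ X) (hΨ : UniformlyConvex p 1 ((1 + κ) / κ) Ψ) {N : ℕ} {T : ℕ → ℕ}
    (hT : ∀ k ∈ Finset.Icc 1 N, 0 < T k) (ν : ℕ → ℝ) {τ : ℕ → ℝ} {f f' : Vec d → Ξ → ℝ}
    {δ δ' : ℕ → Vec d → ℝ}
    (hf : ∀ k ∈ Finset.Icc 1 N, ∀ x ∈ nbhd X (τ k), ∀ s, f x s + δ k x = f' x s + δ' k x)
    (ξ : ℕ × ℕ → Ξ) {e : ℕ × ℕ → Vec d} (he : ∀ i, ‖e i‖ = 1) {z : Vec d} (hz : z ∈ X) {k : ℕ}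
    (hk : k ≤ N) :
    restarts X Ψ x₀ T ν τ f δ ξ e z k = restarts X Ψ x₀ T ν τ f' δ' ξ e z k := by
  induction k with
  | zero => rfl
  | succ k ih =>
    have hw := restarts_mem hκ hκ1 hp1 hp2 hXc hX hΨ (x₀ := x₀) hT ν τ f' δ' ξ e hz
      (by omega : k ≤ N)
    simp only [restarts, ih (by omega), rsmdOutput]
    congr 1
    exact Finset.sum_congr rfl fun j _ => rsmdIter_congr hκ hκ1 hp1 hp2 hXc (hΨ.recentre x₀ _) _ _
      (hf _ (Finset.mem_Icc.2 ⟨by omega, hk⟩)) _ (fun j => he _) hw j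

end Pathwise

end ZORestart

/-! ### Induction over the restarts. -/

namespace ZORestart

section Restarting

variable {d : ℕ} {Ω Ξ : Type*} [mΩ : MeasurableSpace Ω] [MeasurableSpace Ξ] {p q : ENNReal}
  {κ r μ M₂ t L : ℝ} {X : Set (Vec d)} {Ψ : Vec d → ℝ} {x₀ : Vec d} {h : Vec d → Ξ → ℝ}

lemma measurable_rsmdIter (hκ : 0 < κ) (hκ1 : κ ≤ 1) (hp1 : 1 ≤ p) (hp2 : p ≤ 2)
    (hXc : IsCompact X) (hXn : X.Nonempty) (hX : Convex ℝ X)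
    (hΨ : UniformlyConvex p 1 ((1 + κ) / κ) Ψ) (hh : Measurable fun a : Vec d × Ξ => h a.1 a.2)
    {δ : Vec d → ℝ} (hδ : Measurable δ) (ν τ : ℝ) {w : Ω → Vec d} {ξ : ℕ → Ω → Ξ}
    {e : ℕ → Ω → Vec d} {n : ℕ} (hw : Measurable w)
    (hζ : ∀ j < n, Measurable fun ω => (ξ j ω, e j ω)) :
    Measurable fun ω => rsmdIter X (recentre Ψ x₀ (w ω)) ν τ (fun x s => h x s + δ x)
      (fun j => ξ j ω) (fun j => e j ω) (w ω) n := by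
  induction n with
  | zero => exact hw
  | succ n ih =>
    have h1 := measurable_zoStep (x₀ := x₀) hκ hκ1 hp1 hp2 hXc hXn hX hΨ hh hδ ν τ hw
      (ih fun j hj => hζ j (by omega)) (hζ n (by omega))
    simpa only [rsmdIter, zoStep] using h1

lemma measurable_restarts (hκ : 0 < κ) (hκ1 : κ ≤ 1) (hp1 : 1 ≤ p) (hp2 : p ≤ 2)
    (hXc : IsCompact X) (hXn : X.Nonempty) (hX : Convex ℝ X)
    (hΨ : UniformlyConvex p 1 ((1 + κ) / κ) Ψ) (hh : Measurable fun a : Vec d × Ξ => h a.1 a.2)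
    {δ : ℕ → Vec d → ℝ} (hδ : ∀ k, Measurable (δ k)) (T : ℕ → ℕ) (ν τ : ℕ → ℝ) {z : Ω → Vec d}
    {ξ : ℕ × ℕ → Ω → Ξ} {e : ℕ × ℕ → Ω → Vec d} {n : ℕ} (hz : Measurable z)
    (hζ : ∀ i : ℕ × ℕ, i.1 ≤ n → Measurable fun ω => (ξ i ω, e i ω)) :
    Measurable fun ω => restarts X Ψ x₀ T ν τ h δ (fun i => ξ i ω) (fun i => e i ω) (z ω) n := by
  induction n with
  | zero => exact hz
  | succ n ih =>
    have hw := ih fun i hi => hζ i (by omega)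
    have h1 : ∀ j, _ := fun j => measurable_rsmdIter (x₀ := x₀) (n := j) hκ hκ1 hp1 hp2 hXc hXn hX
      hΨ hh (hδ (n + 1)) (ν (n + 1)) (τ (n + 1)) (ξ := fun j => ξ (n + 1, j))
      (e := fun j => e (n + 1, j)) hw fun j _ => hζ (n + 1, j) le_rfl
    exact (Finset.measurable_fun_sum (Finset.range (T (n + 1))) fun j _ => h1 j).fun_const_smul
      (1 / (T (n + 1) : ℝ))

/-- The σ-algebra on `Ω` is arbitrary and only the earlier samples are assumed measurable, so that
the lemma applies to the σ-algebra `history`. -/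
lemma measurable_restarts_prod_rsmdIter (hκ : 0 < κ) (hκ1 : κ ≤ 1) (hp1 : 1 ≤ p) (hp2 : p ≤ 2)
    (hXc : IsCompact X) (hXn : X.Nonempty) (hX : Convex ℝ X)
    (hΨ : UniformlyConvex p 1 ((1 + κ) / κ) Ψ) (hh : Measurable fun a : Vec d × Ξ => h a.1 a.2)
    {δ : ℕ → Vec d → ℝ} (hδ : ∀ k, Measurable (δ k)) (T : ℕ → ℕ) (ν τ : ℕ → ℝ) {z : Ω → Vec d}
    {ξ : ℕ × ℕ → Ω → Ξ} {e : ℕ × ℕ → Ω → Vec d} {k j : ℕ} (hz : Measurable z)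
    (hζ : ∀ i : ℕ × ℕ, i.1 ≤ k ∨ i.1 = k + 1 ∧ i.2 < j → Measurable fun ω => (ξ i ω, e i ω)) :
    Measurable fun ω =>
      (restarts X Ψ x₀ T ν τ h δ (fun i => ξ i ω) (fun i => e i ω) (z ω) k,
        rsmdIter X (recentre Ψ x₀
          (restarts X Ψ x₀ T ν τ h δ (fun i => ξ i ω) (fun i => e i ω) (z ω) k)) (ν (k + 1))
          (τ (k + 1)) (fun x s => h x s + δ (k + 1) x) (fun j => ξ (k + 1, j) ω)
          (fun j => e (k + 1, j) ω)
          (restarts X Ψ x₀ T ν τ h δ (fun i => ξ i ω) (fun i => e i ω) (z ω) k) j) := by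
  have hw := measurable_restarts (x₀ := x₀) hκ hκ1 hp1 hp2 hXc hXn hX hΨ hh hδ T ν τ hz
    fun i hi => hζ i (Or.inl hi)
  exact hw.prodMk (measurable_rsmdIter (ξ := fun j => ξ (k + 1, j)) (e := fun j => e (k + 1, j))
    hκ hκ1 hp1 hp2 hXc hXn hX hΨ hh (hδ _) _ _ hw fun j' hj' => hζ (k + 1, j') (Or.inr ⟨rfl, hj'⟩))

variable {P : Measure Ω} [IsProbabilityMeasure P] {𝒟 : Measure Ξ} [IsProbabilityMeasure 𝒟]
  {K : Ξ → ℝ}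

/-- Under the growth condition a small gap forces a small distance to the minimizer. -/
lemma HasGrowth.integral_lpNorm_rpow_le (hκ : 0 < κ) (hκ1 : κ ≤ 1) (hr : (1 + κ) / κ ≤ r)
    (hp1 : 1 ≤ p) (hp2 : p ≤ 2) (hμ : 0 < μ) (hXc : IsCompact X) {F : Vec d → ℝ} {u : Vec d}
    (hF : HasGrowth p r μ X F u) (hFc : Continuous F) {ρ : ℝ} (hρ : 0 < ρ) {Z : Ω → Vec d}
    (hZm : Measurable Z) (hZ : ∀ ω, Z ω ∈ X)
    (hgap : (∫ ω, F (Z ω) ∂P) - F u ≤ μ / 2 * ρ ^ r) :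
    ∫ ω, lpNorm p (u - Z ω) ^ ((1 + κ) / κ) ∂P ≤ 2 * ρ ^ ((1 + κ) / κ) := by
  have hs2 := two_le_sExp hκ hκ1
  set s := (1 + κ) / κ
  have hc : Continuous fun z => lpNorm p (u - z) ^ s :=
    ((continuous_lpNorm hp1 hp2).comp (continuous_const.sub continuous_id)).rpow_const
      fun _ => Or.inr (by linarith)
  have hi : Integrable (fun ω => lpNorm p (u - Z ω) ^ s) P := integrable_comp_of_mem hc hXc hZm hZ
  have hiF : Integrable (fun ω => F (Z ω)) P := integrable_comp_of_mem hFc hXc hZm hZ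
  -- The inequality `(y/ρ)^s ≤ 1 + (y/ρ)^r` stands in for Jensen and is the origin of the factor
  -- `2`; this is where `r ≥ s` is needed.
  have hpt : ∀ ω, lpNorm p (u - Z ω) ^ s ≤
      ρ ^ s + ρ ^ s / (μ / 2 * ρ ^ r) * (F (Z ω) - F u) := by
    intro ω
    have h1 := hF.growth _ (hZ ω)
    rw [lpNorm_sub_comm hp1] at h1
    set y := lpNorm p (u - Z ω)
    have hy : 0 ≤ y := lpNorm_nonneg hp1 _
    have h2 : (y / ρ) ^ s ≤ 1 + (y / ρ) ^ r := by
      have hq : 0 ≤ y / ρ := by positivity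
      rcases le_total (y / ρ) 1 with hle | hle
      · have := Real.rpow_le_one hq hle (by linarith : 0 ≤ s)
        have := Real.rpow_nonneg hq r
        linarith
      · have := Real.rpow_le_rpow_of_exponent_le hle hr
        linarith
    rw [Real.div_rpow hy hρ.le, Real.div_rpow hy hρ.le, div_le_iff₀ (by positivity)] at h2
    refine h2.trans ?_
    have h3 : (1 + y ^ r / ρ ^ r) * ρ ^ s = ρ ^ s + ρ ^ s / (μ / 2 * ρ ^ r) * (μ / 2 * y ^ r) := by
      field_simp
    rw [h3]
    gcongr
  have hi2 : Integrable (fun ω => ρ ^ s / (μ / 2 * ρ ^ r) * (F (Z ω) - F u)) P :=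
    (hiF.sub (integrable_const _)).const_mul _
  refine (integral_mono hi ((integrable_const (ρ ^ s)).add hi2) hpt).trans ?_
  simp only [Pi.add_apply]
  rw [integral_add (integrable_const _) hi2, integral_const_mul,
    integral_sub hiF (integrable_const _), integral_const, integral_const]
  simp only [probReal_univ, smul_eq_mul, one_mul]
  have h4 := mul_le_mul_of_nonneg_left hgap (by positivity : 0 ≤ ρ ^ s / (μ / 2 * ρ ^ r))
  have h5 : ρ ^ s / (μ / 2 * ρ ^ r) * (μ / 2 * ρ ^ r) = ρ ^ s := by field_simp
  linarith

/-- The accuracy of the restarts for an objective that is Lipschitz everywhere and a noise that is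
bounded everywhere. -/
lemma integral_restarts_le (hd : 2 ≤ d) (hκ : 0 < κ) (hκ1 : κ ≤ 1) (hr : (1 + κ) / κ ≤ r)
    (hμ : 0 < μ) (hp1 : 1 ≤ p) (hp2 : p ≤ 2) (hpq : p.HolderConjugate q) (hXc : IsCompact X)
    (hX : Convex ℝ X) (hΨ : UniformlyConvex p 1 ((1 + κ) / κ) Ψ) (hL1 : 1 ≤ L)
    (hL : HasProxGrowth p ((1 + κ) / κ) L x₀ Ψ)
    (hh : IsLipschitzObjective κ M₂ (nbhd X t) X 𝒟 h K) (hM : 0 < M₂) (ht : 0 < t)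
    {u : Vec d} (hF : HasGrowth p r μ X (expObj 𝒟 h) u) {R : ℝ} (hR : 0 < R)
    (hXR : ∀ x ∈ X, ∀ y ∈ X, lpNorm p (x - y) ≤ R) {N : ℕ} {Δ σ : ℕ → ℝ} {T : ℕ → ℕ} {τ ν : ℕ → ℝ}
    (hE : ∀ k ∈ Finset.Icc 1 N,
      EpochBounds d q κ r μ M₂ L (R / 2 ^ k) (Δ k) (σ k) (T k) (τ k) (ν k))
    (hτt : ∀ k ∈ Finset.Icc 1 N, τ k ≤ t) (hΔ : ∀ k ∈ Finset.Icc 1 N, 0 ≤ Δ k)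
    {δ : ℕ → Vec d → ℝ} (hδm : ∀ k, Measurable (δ k))
    (hδ : ∀ k ∈ Finset.Icc 1 N, ∀ x, |δ k x| ≤ Δ k) {ξ : ℕ × ℕ → Ω → Ξ}
    {e : ℕ × ℕ → Ω → Vec d} {z : Ω → Vec d} (hS : IsSampling X 𝒟 P ξ e z) {k : ℕ} (hk1 : 1 ≤ k)
    (hkN : k ≤ N) :
    (∫ ω, expObj 𝒟 h (restarts X Ψ x₀ T ν τ h δ (fun i => ξ i ω) (fun i => e i ω) (z ω) k) ∂P) -
      expObj 𝒟 h u ≤ μ / 2 * (R / 2 ^ k) ^ r := by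
  have hs2 := two_le_sExp hκ hκ1
  have hXn : X.Nonempty := ⟨u, hF.mem⟩
  have hhm := hh.measurable_uncurry hM
  have hFc := hh.continuous_expObj hM hXn
  have hT : ∀ k ∈ Finset.Icc 1 N, 0 < T k := fun k hk => (hE k hk).steps_pos
  have hζm : ∀ i, Measurable fun ω => (ξ i ω, e i ω) := fun i =>
    (hS.measurable_xi i).prodMk (hS.measurable_e i)
  have hZmem : ∀ k ≤ N, ∀ ω,
      restarts X Ψ x₀ T ν τ h δ (fun i => ξ i ω) (fun i => e i ω) (z ω) k ∈ X := fun k hk ω =>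
    restarts_mem hκ hκ1 hp1 hp2 hXc hX hΨ hT ν τ h δ _ _ (hS.start_mem ω) hk
  have hZm : ∀ k, Measurable fun ω =>
      restarts X Ψ x₀ T ν τ h δ (fun i => ξ i ω) (fun i => e i ω) (z ω) k := fun k =>
    measurable_restarts hκ hκ1 hp1 hp2 hXc hXn hX hΨ hhm hδm T ν τ hS.measurable_start
      fun i _ => hζm i
  have hstep : ∀ k, k + 1 ≤ N →
      (∫ ω, lpNorm p (u - restarts X Ψ x₀ T ν τ h δ (fun i => ξ i ω) (fun i => e i ω) (z ω) k) ^
        ((1 + κ) / κ) ∂P ≤ 2 * (R / 2 ^ k) ^ ((1 + κ) / κ)) →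
      (∫ ω, expObj 𝒟 h (restarts X Ψ x₀ T ν τ h δ (fun i => ξ i ω) (fun i => e i ω) (z ω)
        (k + 1)) ∂P) - expObj 𝒟 h u ≤ μ / 2 * (R / 2 ^ (k + 1)) ^ r := by
    intro k hk hstart
    have hmem : k + 1 ∈ Finset.Icc 1 N := Finset.mem_Icc.2 ⟨by omega, hk⟩
    have hind : ∀ j, IndepFun (fun ω =>
        (restarts X Ψ x₀ T ν τ h δ (fun i => ξ i ω) (fun i => e i ω) (z ω) k,
          rsmdIter X (recentre Ψ x₀
            (restarts X Ψ x₀ T ν τ h δ (fun i => ξ i ω) (fun i => e i ω) (z ω) k)) (ν (k + 1))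
            (τ (k + 1)) (fun x s => h x s + δ (k + 1) x) (fun j => ξ (k + 1, j) ω)
            (fun j => e (k + 1, j) ω)
            (restarts X Ψ x₀ T ν τ h δ (fun i => ξ i ω) (fun i => e i ω) (z ω) k) j))
        (fun ω => (ξ (k + 1, j) ω, e (k + 1, j) ω)) P := by
      intro j
      -- The indices lexicographically before `(k + 1, j)`, together with unused ones of the earlier
      -- restarts.
      refine indepFun_of_measurable_history (S := {i | i.1 ≤ k ∨ i.1 = k + 1 ∧ i.2 < j})
        (i := (k + 1, j)) hS.measurable_start hζm hS.indep hS.indep_start (by simp) ?_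
      have hz := measurable_history_start z (fun i ω => (ξ i ω, e i ω))
        {i | i.1 ≤ k ∨ i.1 = k + 1 ∧ i.2 < j}
      exact measurable_restarts_prod_rsmdIter (mΩ := history z (fun i ω => (ξ i ω, e i ω))
        {i | i.1 ≤ k ∨ i.1 = k + 1 ∧ i.2 < j}) (x₀ := x₀) hκ hκ1 hp1 hp2 hXc hXn hX hΨ hhm
        hδm T ν τ hz fun i hi => measurable_history_sample z (fun i ω => (ξ i ω, e i ω)) hi
    refine integral_epoch_le hd hκ hκ1 (by linarith) hμ hp1 hp2 hpq hXc hX hΨ hL1 hL hh hM ht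
      (hE _ hmem) (hτt _ hmem) (hΔ _ hmem) (hδm _) (hδ _ hmem) (by positivity) hF.mem hF.isMin
      (hZm k) (fun j => ?_) (fun j => hζm (k + 1, j)) (hZmem k (by omega)) rfl (fun j ω => rfl)
      (fun j => hS.law (k + 1, j)) hind ?_
    · exact measurable_rsmdIter hκ hκ1 hp1 hp2 hXc hXn hX hΨ hhm (hδm _) _ _ (hZm k)
        fun j _ => hζm (k + 1, j)
    · rwa [show 2 * (R / 2 ^ (k + 1)) = R / 2 ^ k by rw [pow_succ]; field_simp]
  -- The induction alternates between distance and gap: `hstep` turns the distance bound into a gap,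
  -- and the growth condition turns the gap into the next distance bound. It starts from the
  -- diameter bound `R`, so any random start in `X` is allowed.
  have hdist : ∀ k, k + 1 ≤ N →
      ∫ ω, lpNorm p (u - restarts X Ψ x₀ T ν τ h δ (fun i => ξ i ω) (fun i => e i ω) (z ω) k) ^
        ((1 + κ) / κ) ∂P ≤ 2 * (R / 2 ^ k) ^ ((1 + κ) / κ) := by
    intro k
    induction k with
    | zero =>
      intro _
      have hpt : ∀ ω, lpNorm p (u - restarts X Ψ x₀ T ν τ h δ (fun i => ξ i ω)
          (fun i => e i ω) (z ω) 0) ^ ((1 + κ) / κ) ≤ R ^ ((1 + κ) / κ) := fun ω =>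
        Real.rpow_le_rpow (lpNorm_nonneg hp1 _) (hXR _ hF.mem _ (hS.start_mem ω)) (by linarith)
      have h1 := integral_mono_of_nonneg (μ := P)
        (Filter.Eventually.of_forall fun ω => Real.rpow_nonneg (lpNorm_nonneg hp1 _) _)
        (integrable_const (R ^ ((1 + κ) / κ))) (Filter.Eventually.of_forall hpt)
      rw [integral_const, probReal_univ, one_smul] at h1
      have : 0 ≤ R ^ ((1 + κ) / κ) := by positivity
      rw [pow_zero, div_one]
      linarith
    | succ k ih =>
      intro hk
      exact hF.integral_lpNorm_rpow_le hκ hκ1 hr hp1 hp2 hμ hXc hFc (by positivity)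
        (hZm (k + 1)) (hZmem (k + 1) (by omega)) (hstep k (by omega) (ih (by omega)))
  obtain ⟨k, rfl⟩ : ∃ n, k = n + 1 := ⟨k - 1, by omega⟩
  exact hstep k hkN (hdist k hkN)

lemma nbhd_subset_nbhd (ht : 0 < t) {τ : ℝ} (hτ : 0 ≤ τ) (hτt : τ ≤ t) :
    nbhd X τ ⊆ nbhd X t := by
  rintro _ ⟨x, hx, u, hu, rfl⟩
  exact add_smul_mem_nbhd ht hτ hτt hx hu

end Restarting

end ZORestart

/-! ### Return to the original objective and noise. -/

namespace ZORestart

section Transfer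

variable {d : ℕ} {Ω Ξ : Type*} [MeasurableSpace Ω] [MeasurableSpace Ξ] {p q : ENNReal}
  {κ r μ M₂ t L : ℝ} {X : Set (Vec d)} {Ψ : Vec d → ℝ} {x₀ : Vec d} {f h : Vec d → Ξ → ℝ}
  {P : Measure Ω} [IsProbabilityMeasure P] {𝒟 : Measure Ξ} [IsProbabilityMeasure 𝒟] {K : Ξ → ℝ}

lemma HasGrowth.congr {F G : Vec d → ℝ} {u : Vec d} (hF : HasGrowth p r μ X F u)
    (hFG : ∀ x ∈ X, F x = G x) : HasGrowth p r μ X G u where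
  mem := hF.mem
  isMin x hx := by
    have := hF.isMin hx
    simp only [Set.mem_ofPred_eq] at this ⊢
    rwa [← hFG x hx, ← hFG u hF.mem]
  growth x hx := by
    rw [← hFG x hx, ← hFG u hF.mem]
    exact hF.growth x hx

omit [IsProbabilityMeasure P] in
lemma IsSampling.ae_norm_eq_one (hd : 0 < d) {ξ : ℕ × ℕ → Ω → Ξ} {e : ℕ × ℕ → Ω → Vec d}
    {z : Ω → Vec d} (hS : IsSampling X 𝒟 P ξ e z) : ∀ᵐ ω ∂P, ∀ i, ‖e i ω‖ = 1 := by
  refine ae_all_iff.2 fun i => ?_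
  have h1 := ae_norm_snd_eq_one (𝒟 := 𝒟) hd
  rw [← hS.law i] at h1
  exact ae_of_ae_map ((hS.measurable_xi i).prodMk (hS.measurable_e i)).aemeasurable h1

/-- The accuracy of the restarts in terms of the last radius. -/
lemma restarts_accuracy (hd : 2 ≤ d) (hκ : 0 < κ) (hκ1 : κ ≤ 1) (hr : (1 + κ) / κ ≤ r)
    (hμ : 0 < μ) (hp1 : 1 ≤ p) (hp2 : p ≤ 2) (hpq : p.HolderConjugate q) (hXc : IsCompact X)
    (hX : Convex ℝ X) (hΨ : UniformlyConvex p 1 ((1 + κ) / κ) Ψ) (hL1 : 1 ≤ L)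
    (hL : HasProxGrowth p ((1 + κ) / κ) L x₀ Ψ)
    (hh : IsLipschitzObjective κ M₂ (nbhd X t) X 𝒟 h K) (hfh : ∀ x ∈ nbhd X t, ∀ s, h x s = f x s)
    (hM : 0 < M₂) (ht : 0 < t) {u : Vec d} (hF : HasGrowth p r μ X (expObj 𝒟 f) u) {R : ℝ}
    (hR : 0 < R) (hXR : ∀ x ∈ X, ∀ y ∈ X, lpNorm p (x - y) ≤ R) {N : ℕ} (hN : 1 ≤ N)
    {Δ σ : ℕ → ℝ} {T : ℕ → ℕ} {τ ν : ℕ → ℝ} (hE : ∀ k ∈ Finset.Icc 1 N,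
      EpochBounds d q κ r μ M₂ L (R / 2 ^ k) (Δ k) (σ k) (T k) (τ k) (ν k))
    (hτt : ∀ k ∈ Finset.Icc 1 N, τ k ≤ t) (hΔ : ∀ k ∈ Finset.Icc 1 N, 0 ≤ Δ k)
    {δ : ℕ → Vec d → ℝ} (hδm : ∀ k, Measurable (δ k))
    (hδ : ∀ k ∈ Finset.Icc 1 N, ∀ x ∈ nbhd X (τ k), |δ k x| ≤ Δ k) {ξ : ℕ × ℕ → Ω → Ξ}
    {e : ℕ × ℕ → Ω → Vec d} {z : Ω → Vec d} (hS : IsSampling X 𝒟 P ξ e z) :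
    Integrable (fun ω => expObj 𝒟 f
      (restarts X Ψ x₀ T ν τ f δ (fun i => ξ i ω) (fun i => e i ω) (z ω) N)) P ∧
    (∫ ω, expObj 𝒟 f
      (restarts X Ψ x₀ T ν τ f δ (fun i => ξ i ω) (fun i => e i ω) (z ω) N) ∂P) -
      expObj 𝒟 f u ≤ μ / 2 * (R / 2 ^ N) ^ r := by
  have hXn : X.Nonempty := ⟨u, hF.mem⟩
  have hfE : ∀ x ∈ X, expObj 𝒟 f x = expObj 𝒟 h x := fun x hx => by
    simp only [expObj, hfh x (mem_nbhd_of_mem hx)]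
  -- Clipping bounds the noise everywhere, keeps it measurable and does not change it at the query
  -- points.
  set δ' : ℕ → Vec d → ℝ := fun k x => max (-(Δ k)) (min (δ k x) (Δ k)) with hδ'
  have hδm' : ∀ k, Measurable (δ' k) := fun k =>
    measurable_const.max ((hδm k).min measurable_const)
  have hbd : ∀ k ∈ Finset.Icc 1 N, ∀ x, |δ' k x| ≤ Δ k := fun k hk x =>
    abs_le.2 ⟨le_max_left _ _, max_le (by linarith [hΔ k hk]) (min_le_right _ _)⟩
  have hT : ∀ k ∈ Finset.Icc 1 N, 0 < T k := fun k hk => (hE k hk).steps_pos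
  have hagree : ∀ k ∈ Finset.Icc 1 N, ∀ x ∈ nbhd X (τ k), ∀ s,
      f x s + δ k x = h x s + δ' k x := by
    intro k hk x hx s
    obtain ⟨h1, h2⟩ := abs_le.1 (hδ k hk x hx)
    rw [hfh x (nbhd_subset_nbhd ht (hE k hk).tau_pos.le (hτt k hk) hx) s, hδ']
    simp only [min_eq_left h2, max_eq_right h1]
  have hmem : ∀ ω, restarts X Ψ x₀ T ν τ h δ' (fun i => ξ i ω) (fun i => e i ω) (z ω) N ∈ X :=
    fun ω => restarts_mem hκ hκ1 hp1 hp2 hXc hX hΨ hT ν τ h δ' _ _ (hS.start_mem ω) le_rfl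
  have hae : (fun ω => expObj 𝒟 f
      (restarts X Ψ x₀ T ν τ f δ (fun i => ξ i ω) (fun i => e i ω) (z ω) N)) =ᵐ[P]
      fun ω => expObj 𝒟 h
        (restarts X Ψ x₀ T ν τ h δ' (fun i => ξ i ω) (fun i => e i ω) (z ω) N) := by
    filter_upwards [hS.ae_norm_eq_one (by omega)] with ω hω
    rw [restarts_congr hκ hκ1 hp1 hp2 hXc hX hΨ hT ν hagree _ hω (hS.start_mem ω) le_rfl,
      hfE _ (hmem ω)]
  have hm := measurable_restarts (x₀ := x₀) (n := N) hκ hκ1 hp1 hp2 hXc hXn hX hΨ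
    (hh.measurable_uncurry hM) hδm' T ν τ hS.measurable_start
    fun i _ => (hS.measurable_xi i).prodMk (hS.measurable_e i)
  refine ⟨(integrable_comp_of_mem (hh.continuous_expObj hM hXn) hXc hm hmem).congr hae.symm, ?_⟩
  rw [integral_congr_ae hae, hfE u hF.mem]
  exact integral_restarts_le hd hκ hκ1 hr hμ hp1 hp2 hpq hXc hX hΨ hL1 hL hh hM ht (hF.congr hfE)
    hR hXR hE hτt hΔ hδm' hbd hS hN le_rfl

end Transfer

end ZORestart

/-! ### Assembly of schedule, constants and accuracy. -/

namespace ZORestart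

section Main

variable {d : ℕ} {q : ENNReal} {κ r μ M₂ L R A c B : ℝ}

lemma noiseLevel_bounds_of_const {Q n m₂ m₃ : ℝ} (hc : 0 < c) (hL : 1 ≤ L) (hQ : 0 < Q)
    (hm : m₂ ≤ m₃) (hm2 : 0 ≤ m₂) (hB1 : 2 ^ (2 * r) / c ≤ B) (hB2 : 4 * c ≤ B)
    (h1 : 2 ^ (-(2 * r)) * Q ≤ n) (h2 : n ≤ 4 * Q) :
    Q / (B * L ^ m₃) ≤ c / L ^ m₂ * n ∧ c / L ^ m₂ * n ≤ B * L ^ m₃ * Q := by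
  have hB : 0 < B := by linarith
  have hL0 : 0 < L := by linarith
  have hl2 : 1 ≤ L ^ m₂ := Real.one_le_rpow hL hm2
  have hl3 : L ^ m₂ ≤ L ^ m₃ := Real.rpow_le_rpow_of_exponent_le hL hm
  rw [div_le_iff₀ hc] at hB1
  have h2r : (0 : ℝ) < 2 ^ (2 * r) := by positivity
  rw [Real.rpow_neg (by norm_num), inv_mul_le_iff₀ h2r] at h1
  have hn : 0 < n := pos_of_mul_pos_right (hQ.trans_le h1) h2r.le
  constructor
  · rw [div_le_iff₀ (by positivity)]
    calc Q ≤ 2 ^ (2 * r) * n := h1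
      _ ≤ B * c * n := by gcongr
      _ = c / L ^ m₂ * n * (B * L ^ m₂) := by field_simp
      _ ≤ c / L ^ m₂ * n * (B * L ^ m₃) := by gcongr
  · calc c / L ^ m₂ * n ≤ c / 1 * (4 * Q) := by gcongr
      _ = 4 * c * 1 * Q := by ring
      _ ≤ B * L ^ m₃ * Q := by gcongr; exact hl2.trans hl3

lemma radius_rpow_le (hr : 1 ≤ r) (hμ : 0 < μ) (hR : 0 < R)
    (h : μ * R ^ (r - 1) ≤ B) (k : ℕ) : μ * (R / 2 ^ k) ^ (r - 1) ≤ B := by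
  refine le_trans ?_ h
  have h2 : R / 2 ^ k ≤ R := div_le_self hR.le (one_le_pow₀ (by norm_num))
  have h3 : 0 ≤ r - 1 := by linarith
  gcongr

lemma exists_isSchedule (hd : 0 < d) (ha : 0 < aq d q) (hda : 1 ≤ √d * aq d q) (hκ : 0 < κ)
    (hκ1 : κ ≤ 1) (hr : (1 + κ) / κ ≤ r) (hμ : 0 < μ) (hM : 0 < M₂) (hL : 1 ≤ L) (hR : 0 < R)
    (hRM : μ * R ^ (r - 1) ≤ (8 * L) ^ (r - 1) * (4 * M₂)) {N : ℕ} {Δ : ℕ → ℝ}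
    (hΔ : ∀ k ∈ Finset.Icc 1 N, 0 ≤ Δ k) :
    ∃ (σ : ℕ → ℝ) (T : ℕ → ℕ) (τ ν : ℕ → ℝ), IsSchedule d q κ r μ M₂ R
      (stepConst κ r ^ ((1 + κ) / κ) * L ^ (r * ((1 + κ) / κ))) N Δ σ T τ ν := by
  have hs2 := two_le_sExp hκ hκ1
  have h := fun k (hk : k ∈ Finset.Icc 1 N) =>
    exists_schedule hd ha hda hκ hκ1 hr hμ hM hL (by positivity : 0 < R / 2 ^ k)
      (radius_rpow_le (by linarith) hμ hR hRM k) (hΔ k hk)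
  choose! σ T τ ν h1 h2 h3 h4 h5 using h
  exact ⟨σ, T, τ, ν, h1, h2, h3, h4, h5⟩

lemma IsSchedule.epochBounds (hd : 0 < d) (ha : 0 < aq d q) (hκ : 0 < κ)
    (hκ1 : κ ≤ 1) (hr : 1 ≤ r) (hμ : 0 < μ) (hM : 0 < M₂) (hL : 1 ≤ L) (hR : 0 < R)
    (hRM : μ * R ^ (r - 1) ≤ (8 * L) ^ (r - 1) * (4 * M₂)) {N : ℕ} {Δ σ : ℕ → ℝ} {T : ℕ → ℕ}
    {τ ν : ℕ → ℝ} (hΔ : ∀ k ∈ Finset.Icc 1 N, 0 ≤ Δ k ∧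
      Δ k ≤ noiseConst κ r / L ^ (2 * r) * noiseLevel d r μ M₂ R k)
    (h : IsSchedule d q κ r μ M₂ R
      (stepConst κ r ^ ((1 + κ) / κ) * L ^ (r * ((1 + κ) / κ))) N Δ σ T τ ν) :
    ∀ k ∈ Finset.Icc 1 N,
      EpochBounds d q κ r μ M₂ L (R / 2 ^ k) (Δ k) (σ k) (T k) (τ k) (ν k) := by
  intro k hk
  obtain ⟨h1, h2⟩ := hΔ k hk
  rw [noiseLevel_eq _ _ _ _ hR.le] at h2
  exact epochBounds_of_schedule hd ha hκ hκ1 hr hμ hM hL (by positivity)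
    (radius_rpow_le hr hμ hR hRM k) h1 h2 (h.sigma_eq k hk) (h.steps_ge k hk) (h.steps_le k hk)
    (h.tau_eq k hk) (h.nu_eq k hk)

lemma IsSchedule.sum_steps_le (hκ : 0 < κ) (hκ1 : κ ≤ 1) (hr : 2 ≤ r) (hμ : 0 < μ) {ε : ℝ}
    (hε : 0 < ε) (hR : 0 < R) (hM : 0 < M₂) (ha : 0 < aq d q) (hd : 0 < d)
    (hεR : 2 * ε < μ * R ^ r) (hA : 0 < A) {Δ σ : ℕ → ℝ} {T : ℕ → ℕ} {τ ν : ℕ → ℝ}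
    (h : IsSchedule d q κ r μ M₂ R A (numRestarts r μ ε R) Δ σ T τ ν)
    (hE : ∀ k ∈ Finset.Icc 1 (numRestarts r μ ε R),
      EpochBounds d q κ r μ M₂ L (R / 2 ^ k) (Δ k) (σ k) (T k) (τ k) (ν k)) :
    ((∑ k ∈ Finset.Icc 1 (numRestarts r μ ε R), T k : ℕ) : ℝ) ≤
      4 * A * (2 ^ (1 + 2 * r)) ^ ((1 + κ) / κ) *
        (aq d q * M₂ * √d / μ ^ (1 / r) * (1 / ε ^ ((r - 1) / r))) ^ ((1 + κ) / κ) := by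
  have hs2 := two_le_sExp hκ hκ1
  refine ZORestart.sum_steps_le hκ hκ1 hr hμ hε hR hM ha hd hεR hA fun k hk =>
    (h.steps_le k hk).trans ?_
  have h1 := (hE k hk).sigma_le
  have h2 := (hE k hk).sigma_pos
  gcongr

end Main

end ZORestart

theorem mainTheorem4 (κ r : ℝ) (hκ : 0 < κ) (hκ1 : κ ≤ 1) (hr : (1 + κ) / κ ≤ r) :
    -- the standard prox-functions are admissible, with growth constant `K_q^(1/κ)`
    (∀ (d : ℕ) (p q : ENNReal), 1 < p → p ≤ 2 → p.HolderConjugate q →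
      ∀ x₀ : ZORestart.Vec d,
        ZORestart.UniformlyConvex p 1 ((1 + κ) / κ) (ZORestart.powerProx κ p q x₀) ∧
        ZORestart.HasProxGrowth p ((1 + κ) / κ) (ZORestart.Kq κ q ^ (1 / κ)) x₀
          (ZORestart.powerProx κ p q x₀)) ∧
    -- the constants depend on `κ` and `r` only
    ∃ A c B m₁ m₂ m₃ : ℝ, 0 < A ∧ 0 < c ∧ 0 < B ∧ 0 ≤ m₁ ∧ 0 ≤ m₂ ∧ 0 ≤ m₃ ∧
      ∀ (d : ℕ) (p q : ENNReal), 2 ≤ d → 1 ≤ p → p ≤ 2 → p.HolderConjugate q →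
      ∀ (X : Set (ZORestart.Vec d)), IsCompact X → Convex ℝ X →
      -- the prox-function and its centre
      ∀ (Ψ : ZORestart.Vec d → ℝ) (x₀ : ZORestart.Vec d) (L : ℝ),
        ZORestart.UniformlyConvex p 1 ((1 + κ) / κ) Ψ → x₀ ∈ X → IsMinOn Ψ X x₀ →
        ZORestart.HasProxGrowth p ((1 + κ) / κ) L x₀ Ψ →
      -- the objective
      ∀ (Ξ : Type*) [MeasurableSpace Ξ] (𝒟 : MeasureTheory.Measure Ξ)
        [MeasureTheory.IsProbabilityMeasure 𝒟] (f : ZORestart.Vec d → Ξ → ℝ) (M₂ t : ℝ),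
        0 < M₂ → 0 < t → ZORestart.IsObjective κ M₂ t X 𝒟 f →
      ∀ (μ ε : ℝ) (x' : ZORestart.Vec d), 0 < μ → 0 < ε →
        ZORestart.HasGrowth p r μ X (ZORestart.expObj 𝒟 f) x' →
        2 * ε < μ * ZORestart.R0 κ X Ψ ^ r →
      ∀ N : ℕ, N = ZORestart.numRestarts r μ ε (ZORestart.R0 κ X Ψ) →
      -- the admissible noise level of the last restart
      (μ ^ (1 / r) / (M₂ * √d) * ε ^ (2 - 1 / r) / (B * L ^ m₃) ≤
          c / L ^ m₂ * ZORestart.noiseLevel d r μ M₂ (ZORestart.R0 κ X Ψ) N ∧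
        c / L ^ m₂ * ZORestart.noiseLevel d r μ M₂ (ZORestart.R0 κ X Ψ) N ≤
          B * L ^ m₃ * (μ ^ (1 / r) / (M₂ * √d) * ε ^ (2 - 1 / r))) ∧
      -- every sequence of noise levels up to the admissible ones is tolerated
      ∀ Δ : ℕ → ℝ,
        (∀ k ∈ Finset.Icc 1 N, 0 ≤ Δ k ∧
          Δ k ≤ c / L ^ m₂ * ZORestart.noiseLevel d r μ M₂ (ZORestart.R0 κ X Ψ) k) →
        (∃ (σ : ℕ → ℝ) (T : ℕ → ℕ) (τ ν : ℕ → ℝ), ZORestart.IsSchedule d q κ r μ M₂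
          (ZORestart.R0 κ X Ψ) (A * L ^ m₁) N Δ σ T τ ν) ∧
        ∀ (σ : ℕ → ℝ) (T : ℕ → ℕ) (τ ν : ℕ → ℝ), ZORestart.IsSchedule d q κ r μ M₂
          (ZORestart.R0 κ X Ψ) (A * L ^ m₁) N Δ σ T τ ν →
          -- total number of steps
          ((∑ k ∈ Finset.Icc 1 N, T k : ℕ) : ℝ) ≤
            B * L ^ m₃ * (ZORestart.aq d q * M₂ * √d / μ ^ (1 / r) *
              (1 / ε ^ ((r - 1) / r))) ^ ((1 + κ) / κ) ∧
          -- accuracy of the output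
          ((∀ k ∈ Finset.Icc 1 N, τ k ≤ t) →
            ∀ (Ω : Type*) [MeasurableSpace Ω] (P : MeasureTheory.Measure Ω)
              [MeasureTheory.IsProbabilityMeasure P] (ξ : ℕ × ℕ → Ω → Ξ)
              (e : ℕ × ℕ → Ω → ZORestart.Vec d) (z : Ω → ZORestart.Vec d)
              (δ : ℕ → ZORestart.Vec d → ℝ),
              ZORestart.IsSampling X 𝒟 P ξ e z →
              (∀ k, Measurable (δ k)) →
              (∀ k ∈ Finset.Icc 1 N, ∀ x ∈ ZORestart.nbhd X (τ k), |δ k x| ≤ Δ k) →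
              MeasureTheory.Integrable (fun ω => ZORestart.expObj 𝒟 f
                (ZORestart.restarts X Ψ x₀ T ν τ f δ (fun i => ξ i ω) (fun i => e i ω)
                  (z ω) N)) P ∧
              (∫ ω, ZORestart.expObj 𝒟 f
                (ZORestart.restarts X Ψ x₀ T ν τ f δ (fun i => ξ i ω) (fun i => e i ω)
                  (z ω) N) ∂P) - ZORestart.expObj 𝒟 f x' ≤ ε) := by
  refine ⟨fun d p q hp1 hp2 hpq x₀ => ⟨ZORestart.uniformlyConvex_powerProx hκ hκ1 hp1 hp2 hpq x₀,
    ZORestart.hasProxGrowth_powerProx hκ q hp1 x₀⟩, ?_⟩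
  have hs2 := ZORestart.two_le_sExp hκ hκ1
  have hr2 : 2 ≤ r := hs2.trans hr
  have hΓ := ZORestart.one_le_stepConst κ r
  have hc := ZORestart.noiseConst_pos hκ r
  have hA : 0 < ZORestart.stepConst κ r ^ ((1 + κ) / κ) := by positivity
  have hB1 : 0 < 4 * ZORestart.stepConst κ r ^ ((1 + κ) / κ) *
    (2 ^ (1 + 2 * r)) ^ ((1 + κ) / κ) := by positivity
  have hB2 : 0 < (2 : ℝ) ^ (2 * r) / ZORestart.noiseConst κ r := by positivity
  -- The step factor is the `s`-th power of `stepConst · L^r`, hence `m₁ = r s`. The noise is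
  -- compared with `(M₂ τ)²`, which carries `L^(-2r)`, hence `m₂ = 2r`. `B` adds the constants
  -- required by the step count and by the two sides of the noise bound, and `m₃ = r s ≥ 2r` serves
  -- all three.
  refine ⟨ZORestart.stepConst κ r ^ ((1 + κ) / κ), ZORestart.noiseConst κ r,
    4 * ZORestart.stepConst κ r ^ ((1 + κ) / κ) * (2 ^ (1 + 2 * r)) ^ ((1 + κ) / κ) +
      2 ^ (2 * r) / ZORestart.noiseConst κ r + 4 * ZORestart.noiseConst κ r,
    r * ((1 + κ) / κ), 2 * r, r * ((1 + κ) / κ), hA, hc, by positivity, by positivity,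
    by positivity, by positivity, ?_⟩
  intro d p q hd hp1 hp2 hpq X hXc hX Ψ x₀ L hΨ hx₀ _ hL Ξ _ 𝒟 _ f M₂ t hM ht hf μ ε x' hμ hε
    hG hεR N hN
  subst hN
  have hd0 : 0 < d := by omega
  have ha := ZORestart.aq_pos hd hp1 hp2 hpq
  have hda := ZORestart.one_le_sqrt_mul_aq hd hp1 hp2 hpq
  have hL1 : 1 ≤ L := ZORestart.one_le_of_hasProxGrowth hd0 (by linarith) hp1 hp2 hΨ hL
  have hXn : X.Nonempty := ⟨x₀, hx₀⟩
  obtain ⟨h, K, hh, hfh⟩ := hf.exists_extension hκ hM hXc hX hXn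
  have hGh : ZORestart.HasGrowth p r μ X (ZORestart.expObj 𝒟 h) x' := hG.congr fun x hx => by
    simp only [ZORestart.expObj, hfh x (ZORestart.mem_nbhd_of_mem hx)]
  obtain ⟨hR0, hRM, hXR⟩ := ZORestart.mul_R0_rpow_le hκ hκ1 hp1 hp2 (by linarith) hμ hM hΨ hL1 hL
    hx₀ hGh fun x y => hh.abs_expObj_sub_le hXn x y
  set R := ZORestart.R0 κ X Ψ
  have hR : 0 < R := by
    refine hR0.lt_of_ne fun h0 => ?_
    rw [← h0, Real.zero_rpow (by linarith), mul_zero] at hεR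
    linarith
  obtain ⟨hN1, hN2, -⟩ := ZORestart.numRestarts_spec (by linarith) hμ hε hR hεR
  refine ⟨?_, fun Δ hΔ => ⟨ZORestart.exists_isSchedule hd0 ha hda hκ hκ1 hr hμ hM hL1 hR hRM
    fun k hk => (hΔ k hk).1, fun σ T τ ν hsch => ?_⟩⟩
  · obtain ⟨h1, h2⟩ := ZORestart.noiseLevel_bounds hd0 (by linarith) hμ hε hR hM hεR
    exact ZORestart.noiseLevel_bounds_of_const hc hL1 (by positivity) (by nlinarith)
      (by positivity) (by linarith) (by linarith) h1 h2
  have hE := hsch.epochBounds hd0 ha hκ hκ1 (by linarith) hμ hM hL1 hR hRM hΔ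
  have hL0 : 0 < L := by linarith
  refine ⟨?_, fun hτt Ω _ P _ ξ e z δ hS hδm hδ => ?_⟩
  · refine (hsch.sum_steps_le hκ hκ1 hr2 hμ hε hR hM ha hd0 hεR (by positivity) hE).trans ?_
    have hQ : 0 ≤ (ZORestart.aq d q * M₂ * √d / μ ^ (1 / r) *
      (1 / ε ^ ((r - 1) / r))) ^ ((1 + κ) / κ) := by positivity
    refine mul_le_mul_of_nonneg_right ?_ hQ
    have hLm : 0 < L ^ (r * ((1 + κ) / κ)) := by positivity
    nlinarith [mul_pos hB2 hLm, mul_pos hc hLm]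
  · obtain ⟨h1, h2⟩ := ZORestart.restarts_accuracy hd hκ hκ1 hr hμ hp1 hp2 hpq hXc hX hΨ hL1 hL hh
      hfh hM ht hG hR hXR hN1 hE hτt (fun k hk => (hΔ k hk).1) hδm hδ hS
    refine ⟨h1, h2.trans ?_⟩
    have h3 := Real.rpow_le_rpow (by positivity) hN2 (by linarith : 0 ≤ r)
    rw [← Real.rpow_mul (by positivity), one_div_mul_cancel (by linarith), Real.rpow_one] at h3
    refine (mul_le_mul_of_nonneg_left h3 (by positivity)).trans (le_of_eq ?_)
    field_simp
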